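/- **Theorem (Quasifold structure of strata).** Let $\mathfrak d$ be a real vector space of dimension $n$ and let $\Delta\subset\mathfrak d^*$ be a convex polytope of dimension $n$ with exactly $d$ facets, with chosen inward-pointing normals $X_1,\dots,X_d\in\mathfrak d$, so that $$\Delta=\{\mu\in\mathfrak d^*\mid\langle\mu,X_j\rangle\ge\lambda_j,\ j=1,\dots,d\}.$$ Let $Q\subset\mathfrak d$ be a quasilattice (the $\mathbb Z$-span of a finite set of vectors that span $\mathfrak d$ over $\mathbb R$) that contains $X_1,\dots,X_d$. *Faces.* To each (nonempty, open) face $F$ of $\Delta$ corresponds the index set $I_F\subset\{1,\dots,d\}$ with $F=\{\mu\in\Delta\mid\langle\mu,X_j\rangle=\lambda_j\Leftrightarrow j\in I_F\}$. A $p$-dimensional face $F$ is *singular* if $|I_F|>n-p$ and *regular* if $|I_F|=n-p$. Write $F\le F'$ if $F\subseteq\overline{F'}$. Put $$(\mathbb C^*)^{F^c}=\{z\in\mathbb C^d\mid z_j=0\Leftrightarrow j\in I_F\},\qquad \mathbb C^F\times(\mathbb C^*)^{F^c}=\{z\in\mathbb C^d\mid z_j=0\Rightarrow j\in I_F\},$$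 and $\mathbb C^d_\Delta=\bigcup_F \mathbb C^F\times(\mathbb C^*)^{F^c}$, the union over all faces. *Groups.* Let $\pi:\mathbb R^d\to\mathfrak d$, $e_j\mapsto X_j$, let $\mathfrak n=\ker\pi$, and for $Z\in\mathbb C^d$ let $\exp Z=(e^{2\pi iZ_j})_j\in(\mathbb C^*)^d=\mathbb C^d/\mathbb Z^d$. Let $N=\{\exp x\mid x\in\mathbb R^d,\ \pi(x)\in Q\}$, $A=\exp(i\mathfrak n)$, and $N_{\mathbb C}=NA=\ker\big(\mathbb C^d/\mathbb Z^d\to\mathfrak d_{\mathbb C}/Q\big)$, acting on $\mathbb C^d$ coordinatewise. *The space $X_\Delta$.* For $z,w\in\mathbb C^d_\Delta$ write $z\sim_N w$ if $N(\overline{Az})\cap\overline{Aw}\ne\emptyset$, with closures in $\mathbb C^d_\Delta$. Let $X_\Delta=\mathbb C^d_\Delta/\!\sim_N$, with the quotient topology. For a singular face $F$ let $\mathcal T_F\subset X_\Delta$ be the image of $\{z\in\mathbb C^d_\Delta\mid\overline{Az}\cap(\mathbb C^*)^{F^c}\ne\emptyset\}$, and let $\mathcal T_{\max}$ be the image of $R=\bigcup_{F\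 \mathrm{regular}}\mathbb C^F\times(\mathbb C^*)^{F^c}$. *Complex quasifolds.* A $k$-dimensional model is a quotient $\tilde V/\Gamma$ of a connected complex $k$-manifold by a discrete countable group acting by biholomorphisms, such that the set of points where the action is not free is closed and of real codimension at least $2$. A complex quasifold is a topological space covered by open subsets homeomorphic to models (charts), any two of which are compatible: over the overlap, the identity lifts to a biholomorphism between the universal coverings of the preimages of the overlap in the two manifolds. Then: 1. $\sim_N$ is an equivalence relation on $\mathbb C^d_\Delta$. 2. For every singular face $F$, of dimension $p$, the inclusion of $(\mathbb C^*)^{F^c}$ in $\mathbb C^d_\Delta$ induces a homeomorphism $(\mathbb C^*)^{F^c}/N_{\mathbb C}\to\mathcal T_F$, and $\mathcal T_F$ is a $p$-dimensional complex quasifold. 3. The inclusion of $R$ induces a homeomorphism $R/N_{\mathbb C}\to\mathcal T_{\max}$, and $\mathcal T_{\max}$ is an $n$-dimensional complex quasifold. In 2 and 3 the quasifold structure is induced by the projection from $S=(\mathbb C^*)^{F^c}$, respectively $S=R$: the projection lifts locally to holomorphic maps into the manifolds $\tilde V$ of the charts, and each chart map $\tilde V\to\mathcal T$ lifts to a holomorphic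 map $\tilde V\to S$. 4. Index the pieces by the set $\mathcal F$ of singular faces, ordered by $\le$, with a greatest element $\max$ added. Then the $\mathcal T_F$, $F\in\mathcal F$, are a decomposition of $X_\Delta$ by complex quasifolds, of dimension $n$: $\mathcal F$ is finite; the pieces are pairwise disjoint, locally closed and connected complex quasifolds whose union is $X_\Delta$; $\mathcal T_F\cap\overline{\mathcal T_{F'}}\ne\emptyset$ if and only if $\mathcal T_F\subseteq\overline{\mathcal T_{F'}}$, if and only if $F\le F'$; and $\mathcal T_{\max}$ is open and dense in $X_\Delta$ and has dimension $n$. -/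

import Mathlib

open scoped Manifold ContDiff Topology

/-! ## Complex quasifolds -/

/-- A complex manifold of complex dimension `k`. -/
structure ComplexMfd (k : ℕ) where
  carrier : Type
  [top : TopologicalSpace carrier]
  [charted : ChartedSpace (Fin k → ℂ) carrier]
  [mfd : IsManifold 𝓘(ℂ, Fin k → ℂ) ω carrier]
  [t2 : T2Space carrier]
  [sc : SecondCountableTopology carrier]

attribute [instance] ComplexMfd.top ComplexMfd.charted ComplexMfd.mfd ComplexMfd.t2 ComplexMfd.sc

/-- The set of points with nontrivial stabilizer. -/
def nonfreeSet (Γ V : Type) [Group Γ] [MulAction Γ V] : Set V :=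
  {x | ∃ γ : Γ, γ ≠ 1 ∧ γ • x = x}

/-- A quasifold model `V / Γ` of complex dimension `k`: a connected complex manifold `V` with an
action of a discrete (countable, possibly infinite) group `Γ` by biholomorphisms, such that the
set of points where the action is not free is closed and has real codimension at least two
(measured in the charts of `V` by the Hausdorff dimension). -/
structure QuasifoldModel (k : ℕ) extends ComplexMfd k where
  [conn : ConnectedSpace carrier]
  Γ : Type
  [grp : Group Γ]
  [cnt : Countable Γ]
  [act : MulAction Γ carrier]
  holo : ∀ γ : Γ, MDifferentiable 𝓘(ℂ, Fin k → ℂ) 𝓘(ℂ, Fin k → ℂ) (fun x : carrier => γ • x)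
  nonfree_closed : IsClosed (nonfreeSet Γ carrier)
  nonfree_codim : ∀ x ∈ nonfreeSet Γ carrier,
    dimH (chartAt (Fin k → ℂ) x '' ((chartAt (Fin k → ℂ) x).source ∩ nonfreeSet Γ carrier)) + 2
      ≤ 2 * (k : ENNReal)

attribute [instance] QuasifoldModel.conn QuasifoldModel.grp QuasifoldModel.cnt QuasifoldModel.act

/-- The quotient space of a model, with the quotient topology. -/
abbrev QuasifoldModel.Quot {k : ℕ} (M : QuasifoldModel k) : Type :=
  Quotient (MulAction.orbitRel M.Γ M.carrier)

/-- A quasifold chart on `Y`: an open subset of `Y` with a homeomorphism from a model. -/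
structure QuasifoldChart (k : ℕ) (Y : Type) [TopologicalSpace Y] extends QuasifoldModel k where
  domain : TopologicalSpace.Opens Y
  homeo : toQuasifoldModel.Quot ≃ₜ domain

/-- The map `V → V / Γ ≃ domain ⊆ Y` of a chart. -/
def QuasifoldChart.proj {k : ℕ} {Y : Type} [TopologicalSpace Y] (c : QuasifoldChart k Y)
    (x : c.carrier) : Y :=
  (c.homeo (Quotient.mk _ x) : Y)

/-- The map `a : U → V` is a holomorphic covering of the subset `C` of `V`. -/
def IsHolomorphicCoveringOnto {k : ℕ} (U V : ComplexMfd k) (a : U.carrier → V.carrier)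
    (C : Set V.carrier) : Prop :=
  IsLocalDiffeomorph 𝓘(ℂ, Fin k → ℂ) 𝓘(ℂ, Fin k → ℂ) ω a ∧ Set.range a = C ∧ IsCoveringMapOn a C

/-- Compatibility of two charts. Over the overlap of the two domains, the identity is required to
lift to a biholomorphism between the universal coverings of (the relevant components of) the
preimages of the overlap in the two models. Equivalently, and this is how it is written here,
these preimages have a common connected holomorphic covering `U`, with covering maps `a` and `b`
that induce the same map from `U` to the overlap: the universal covering of such a `U` is the
universal covering of both preimages, and conversely one can take `U` simply connected. -/
def QuasifoldChart.Compatible {k : ℕ} {Y : Type} [TopologicalSpace Y]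
    (c e : QuasifoldChart k Y) : Prop :=
  ∀ (x : c.carrier) (y : e.carrier), c.proj x = e.proj y →
    ∃ (U : ComplexMfd k) (a : U.carrier → c.carrier) (b : U.carrier → e.carrier),
      ConnectedSpace U.carrier ∧
      IsHolomorphicCoveringOnto U c.toComplexMfd a
        (connectedComponentIn {x' | c.proj x' ∈ e.domain} x) ∧
      IsHolomorphicCoveringOnto U e.toComplexMfd b
        (connectedComponentIn {y' | e.proj y' ∈ c.domain} y) ∧
      ∀ u, c.proj (a u) = e.proj (b u)

/-- A complex quasifold structure of complex dimension `k` on the topological space `Y`: a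
collection of pairwise compatible quasifold charts that covers `Y`. -/
structure ComplexQuasifold (k : ℕ) (Y : Type) [TopologicalSpace Y] where
  ι : Type
  chart : ι → QuasifoldChart k Y
  covers : ∀ y : Y, ∃ i, y ∈ (chart i).domain
  compatible : ∀ i j, (chart i).Compatible (chart j)

/-- The quasifold structure `A` on `Y` is the one induced from the subset `S` of `ℂ^d` by the map
`q : S → Y`: locally `q` lifts to holomorphic maps into the models (holomorphic on a
neighbourhood in `ℂ^d`), and the chart maps `V → Y` lift through `q` to holomorphic maps
`V → S`. -/
structure ComplexQuasifold.IsInducedBy {k d : ℕ} {Y : Type} [TopologicalSpace Y]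
    (A : ComplexQuasifold k Y) (S : Set (Fin d → ℂ)) (q : S → Y) : Prop where
  lift : ∀ (i : A.ι) (z : S) (x : (A.chart i).carrier), (A.chart i).proj x = q z →
    ∃ O ∈ 𝓝 (z : Fin d → ℂ), ∃ g : (Fin d → ℂ) → (A.chart i).carrier,
      MDifferentiableOn 𝓘(ℂ, Fin d → ℂ) 𝓘(ℂ, Fin k → ℂ) g O ∧ g z = x ∧
      ∀ w : S, (w : Fin d → ℂ) ∈ O → (A.chart i).proj (g w) = q w
  section_ : ∀ i : A.ι, ∃ s : (A.chart i).carrier → S,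
    MDifferentiable 𝓘(ℂ, Fin k → ℂ) 𝓘(ℂ, Fin d → ℂ) (fun x => (s x : Fin d → ℂ)) ∧
    ∀ x, q (s x) = (A.chart i).proj x

/-- The sets `T i` give a decomposition of `Y` by complex quasifolds, where `T i` has complex
dimension `dim i`, and `m` is the dimension of the maximal piece. -/
structure IsDecompositionByComplexQuasifolds {ι : Type} [PartialOrder ι] {Y : Type}
    [TopologicalSpace Y] (T : ι → Set Y) (dim : ι → ℕ) (m : ℕ) : Prop where
  finite : Finite ι
  disjoint : ∀ i j, i ≠ j → Disjoint (T i) (T j)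
  locallyClosed : ∀ i, IsLocallyClosed (T i)
  connected : ∀ i, IsConnected (T i)
  quasifold : ∀ i, Nonempty (ComplexQuasifold (dim i) (T i))
  covers : ⋃ i, T i = Set.univ
  meets_closure_iff_subset : ∀ i j, (T i ∩ closure (T j)).Nonempty ↔ T i ⊆ closure (T j)
  subset_closure_iff_le : ∀ i j, T i ⊆ closure (T j) ↔ i ≤ j
  maximal : ∃ i, IsTop i ∧ IsOpen (T i) ∧ Dense (T i) ∧ dim i = m

/-! ## Polytopes and their faces -/

section Polytope

variable {𝔡 : Type*} [AddCommGroup 𝔡] [Module ℝ 𝔡] {d : ℕ}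

/-- The polyhedron `{μ | ⟨μ, X j⟩ ≥ lam j for all j}` in the dual space. -/
def polyhedron (X : Fin d → 𝔡) (lam : Fin d → ℝ) : Set (Module.Dual ℝ 𝔡) :=
  {μ | ∀ j, lam j ≤ μ (X j)}

/-- The part of the polyhedron on which the `j`-th inequality is an equality. -/
def facet (X : Fin d → 𝔡) (lam : Fin d → ℝ) (j : Fin d) : Set (Module.Dual ℝ 𝔡) :=
  {μ ∈ polyhedron X lam | μ (X j) = lam j}

/-- The polyhedron is a convex polytope of full dimension (the convex hull of a finite set, with
affine span the whole dual space) that has exactly `d` facets, and `X j` is an inward normal to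
the `j`-th of them: each inequality cuts out a face of codimension one, and distinct inequalities
cut out distinct facets. -/
structure IsPolytopeWithNormals (X : Fin d → 𝔡) (lam : Fin d → ℝ) : Prop where
  polytope : ∃ s : Set (Module.Dual ℝ 𝔡), s.Finite ∧ polyhedron X lam = convexHull ℝ s
  full : affineSpan ℝ (polyhedron X lam) = ⊤
  facet_nonempty : ∀ j, (facet X lam j).Nonempty
  facet_dim : ∀ j,
    Module.finrank ℝ (vectorSpan ℝ (facet X lam j)) + 1 = Module.finrank ℝ 𝔡
  facet_injective : Function.Injective (facet X lam)

/-- The points of the polytope at which exactly the inequalities with index in `I` are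
equalities. -/
def openFace (X : Fin d → 𝔡) (lam : Fin d → ℝ) (I : Finset (Fin d)) :
    Set (Module.Dual ℝ 𝔡) :=
  {μ ∈ polyhedron X lam | ∀ j, μ (X j) = lam j ↔ j ∈ I}

/-- The (nonempty, open) faces `F`, each given by its index set `I_F`. -/
def Face (X : Fin d → 𝔡) (lam : Fin d → ℝ) : Type :=
  {I : Finset (Fin d) // (openFace X lam I).Nonempty}

namespace Face

variable {X : Fin d → 𝔡} {lam : Fin d → ℝ}

/-- The index set `I_F`. -/
def idx (F : Face X lam) : Finset (Fin d) := F.1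

/-- The open face as a set of points. -/
def points (F : Face X lam) : Set (Module.Dual ℝ 𝔡) := openFace X lam F.idx

/-- The dimension `p` of a face. -/
noncomputable def dim (F : Face X lam) : ℕ := Module.finrank ℝ (vectorSpan ℝ F.points)

/-- `r_F > n - p`. -/
def IsSingular (F : Face X lam) : Prop := Module.finrank ℝ 𝔡 < F.idx.card + F.dim

/-- `r_F = n - p`. -/
def IsRegular (F : Face X lam) : Prop := F.idx.card + F.dim = Module.finrank ℝ 𝔡

end Face

/-- Closure in the dual space, for the topology of pointwise convergence on `𝔡`. When `𝔡` is
finite-dimensional this is the usual topology of the vector space `𝔡^*`. -/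
def dualClosure (S : Set (Module.Dual ℝ 𝔡)) : Set (Module.Dual ℝ 𝔡) :=
  {μ | (μ : 𝔡 → ℝ) ∈ closure ((fun ν : Module.Dual ℝ 𝔡 => (ν : 𝔡 → ℝ)) '' S)}

theorem subset_dualClosure (S : Set (Module.Dual ℝ 𝔡)) : S ⊆ dualClosure S :=
  fun μ hμ => subset_closure ⟨μ, hμ, rfl⟩

theorem dualClosure_subset {S T : Set (Module.Dual ℝ 𝔡)} (h : S ⊆ dualClosure T) :
    dualClosure S ⊆ dualClosure T := by
  intro μ hμ
  refine closure_minimal ?_ isClosed_closure hμ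
  rintro _ ⟨ν, hν, rfl⟩
  exact h hν

theorem Face.idx_subset {X : Fin d → 𝔡} {lam : Fin d → ℝ} {F G : Face X lam}
    (h : F.points ⊆ dualClosure G.points) : G.idx ⊆ F.idx := by
  intro j hj
  obtain ⟨μ, hμ⟩ := F.2
  refine (hμ.2 j).1 ?_
  have hc : IsClosed {f : 𝔡 → ℝ | f (X j) = lam j} :=
    isClosed_eq (continuous_apply (X j)) continuous_const
  refine closure_minimal ?_ hc (h hμ)
  rintro _ ⟨ν, hν, rfl⟩
  exact (hν.2 j).2 hj

/-- The order on faces: `F ≤ G` if `F` is contained in the closure of `G`. -/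
instance {X : Fin d → 𝔡} {lam : Fin d → ℝ} : PartialOrder (Face X lam) where
  le F G := F.points ⊆ dualClosure G.points
  le_refl F := subset_dualClosure _
  le_trans _ _ _ h₁ h₂ := h₁.trans (dualClosure_subset h₂)
  le_antisymm F G h₁ h₂ :=
    Subtype.ext (Finset.Subset.antisymm (Face.idx_subset h₂) (Face.idx_subset h₁))

/-- The singular faces, with the order of the faces. -/
abbrev SingularFace (X : Fin d → 𝔡) (lam : Fin d → ℝ) : Type :=
  {F : Face X lam // F.IsSingular}

/-- The index set of the decomposition: the singular faces, together with a maximal element. -/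
abbrev StratumIndex (X : Fin d → 𝔡) (lam : Fin d → ℝ) : Type := WithTop (SingularFace X lam)

/-! ## The open set and the groups -/

/-- The set `(ℂ^*)^{J^c}`: the coordinates in `J` are zero, the others are not. -/
def coordTorus (J : Finset (Fin d)) : Set (Fin d → ℂ) := {z | ∀ j, z j = 0 ↔ j ∈ J}

/-- The set `ℂ^J × (ℂ^*)^{J^c}`. -/
def coordOpen (J : Finset (Fin d)) : Set (Fin d → ℂ) := {z | ∀ j, z j = 0 → j ∈ J}

/-- The open subset `ℂ^d_Δ` of `ℂ^d`. -/
def openDelta (X : Fin d → 𝔡) (lam : Fin d → ℝ) : Set (Fin d → ℂ) :=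
  ⋃ F : Face X lam, coordOpen F.idx

/-- The union of the sets `ℂ^F × (ℂ^*)^{F^c}` over the regular faces `F`. -/
def regularSet (X : Fin d → 𝔡) (lam : Fin d → ℝ) : Set (Fin d → ℂ) :=
  ⋃ F : {F : Face X lam // F.IsRegular}, coordOpen F.1.idx

/-- A quasilattice: the `ℤ`-span of a finite set of vectors that span `𝔡` over `ℝ`. -/
def IsQuasilattice (Q : Submodule ℤ 𝔡) : Prop :=
  Q.FG ∧ Submodule.span ℝ (Q : Set 𝔡) = ⊤

/-- The exponential `ℂ^d → ℂ^d / ℤ^d = (ℂ^*)^d`, `Z ↦ (exp (2 π i Z_j))_j`. -/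
noncomputable def expT (Z : Fin d → ℂ) : Fin d → ℂˣ :=
  fun j => Units.mk0 (Complex.exp (2 * Real.pi * Complex.I * Z j)) (Complex.exp_ne_zero _)

theorem expT_zero : expT (0 : Fin d → ℂ) = 1 := by
  funext j; ext; simp [expT]

theorem expT_add (Z W : Fin d → ℂ) : expT (Z + W) = expT Z * expT W := by
  funext j; ext; simp [expT, mul_add, Complex.exp_add]

theorem expT_neg (Z : Fin d → ℂ) : expT (-Z) = (expT Z)⁻¹ := by
  funext j; ext; simp [expT, Complex.exp_neg]

/-- The linear map `π : ℝ^d → 𝔡`, `e_j ↦ X_j`. -/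
def projR (X : Fin d → 𝔡) : (Fin d → ℝ) →ₗ[ℝ] 𝔡 := Fintype.linearCombination ℝ X

/-- The image of an additive subgroup of `ℂ^d` under the exponential. -/
noncomputable def expSubgroup (H : AddSubgroup (Fin d → ℂ)) : Subgroup (Fin d → ℂˣ) where
  carrier := expT '' (H : Set (Fin d → ℂ))
  one_mem' := ⟨0, H.zero_mem, expT_zero⟩
  mul_mem' := by
    rintro _ _ ⟨Z, hZ, rfl⟩ ⟨W, hW, rfl⟩
    exact ⟨Z + W, H.add_mem hZ hW, expT_add Z W⟩
  inv_mem' := by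
    rintro _ ⟨Z, hZ, rfl⟩
    exact ⟨-Z, H.neg_mem hZ, expT_neg Z⟩

/-- The additive group of all `Z = x + i y` in `ℂ^d` with `π x ∈ Q` and `π y ∈ R`. -/
def preimageGroup (X : Fin d → 𝔡) (Q R : AddSubgroup 𝔡) : AddSubgroup (Fin d → ℂ) where
  carrier := {Z | projR X (fun j => (Z j).re) ∈ Q ∧ projR X (fun j => (Z j).im) ∈ R}
  zero_mem' := by
    have h : (fun _ : Fin d => (0 : ℝ)) = 0 := rfl
    simp [h, Q.zero_mem, R.zero_mem]
  add_mem' := by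
    rintro Z W ⟨h₁, h₂⟩ ⟨h₃, h₄⟩
    have e₁ : (fun j => ((Z + W) j).re) = (fun j => (Z j).re) + fun j => (W j).re := by
      funext j; simp
    have e₂ : (fun j => ((Z + W) j).im) = (fun j => (Z j).im) + fun j => (W j).im := by
      funext j; simp
    exact ⟨by rw [e₁, map_add]; exact Q.add_mem h₁ h₃,
      by rw [e₂, map_add]; exact R.add_mem h₂ h₄⟩
  neg_mem' := by
    rintro Z ⟨h₁, h₂⟩
    have e₁ : (fun j => ((-Z) j).re) = -(fun j => (Z j).re) := by funext j; simp
    have e₂ : (fun j => ((-Z) j).im) = -(fun j => (Z j).im) := by funext j; simp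
    exact ⟨by rw [e₁, map_neg]; exact Q.neg_mem h₁, by rw [e₂, map_neg]; exact R.neg_mem h₂⟩

/-- The group `N_ℂ`, the kernel of `ℂ^d / ℤ^d → (𝔡 + i 𝔡) / Q`: all `exp Z`, where the real part
of `Z` is mapped by `π` into `Q` and its imaginary part to `0`. -/
noncomputable def groupNC (X : Fin d → 𝔡) (Q : Submodule ℤ 𝔡) : Subgroup (Fin d → ℂˣ) :=
  expSubgroup (preimageGroup X Q.toAddSubgroup ⊥)

/-- The group `N`, the kernel of `ℝ^d / ℤ^d → 𝔡 / Q`: all `exp x` with `x ∈ ℝ^d`, `π x ∈ Q`. -/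
noncomputable def groupN (X : Fin d → 𝔡) (Q : Submodule ℤ 𝔡) : Subgroup (Fin d → ℂˣ) :=
  expSubgroup (preimageGroup X Q.toAddSubgroup ⊤ ⊓ {
    carrier := {Z | ∀ j, (Z j).im = 0}
    zero_mem' := by simp
    add_mem' := by intro Z W h₁ h₂ j; simp [h₁ j, h₂ j]
    neg_mem' := by intro Z h j; simp [h j] })

/-- The group `A = exp (i 𝔫)`, where `𝔫 = ker π` is the Lie algebra of `N`. -/
noncomputable def groupA (X : Fin d → 𝔡) : Subgroup (Fin d → ℂˣ) :=
  expSubgroup (preimageGroup X ⊤ ⊥ ⊓ {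
    carrier := {Z | ∀ j, (Z j).re = 0}
    zero_mem' := by simp
    add_mem' := by intro Z W h₁ h₂ j; simp [h₁ j, h₂ j]
    neg_mem' := by intro Z h j; simp [h j] })

/-- The coordinatewise action of `(ℂ^*)^d` on `ℂ^d`. -/
def torusAct (t : Fin d → ℂˣ) (z : Fin d → ℂ) : Fin d → ℂ := fun j => (t j : ℂ) * z j

/-- The orbit relation of a subgroup `G` of `(ℂ^*)^d` on a subset `S` of `ℂ^d`. -/
def orbitSetoid (G : Subgroup (Fin d → ℂˣ)) (S : Set (Fin d → ℂ)) : Setoid S where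
  r z w := ∃ g ∈ G, torusAct g z = (w : Fin d → ℂ)
  iseqv :=
    { refl := fun z => ⟨1, G.one_mem, by funext j; simp [torusAct]⟩
      symm := by
        rintro z w ⟨g, hg, h⟩
        refine ⟨g⁻¹, G.inv_mem hg, ?_⟩
        rw [← h]; funext j; simp [torusAct]
      trans := by
        rintro z w v ⟨g, hg, h⟩ ⟨g', hg', h'⟩
        refine ⟨g' * g, G.mul_mem hg' hg, ?_⟩
        rw [← h', ← h]; funext j; simp [torusAct, mul_assoc] }

/-- The orbit space `S / G`, with the quotient topology. -/
abbrev OrbitSpace (G : Subgroup (Fin d → ℂˣ)) (S : Set (Fin d → ℂ)) : Type :=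
  Quotient (orbitSetoid G S)

/-! ## The quotient space and its pieces -/

/-- The closure in `ℂ^d_Δ` of the orbit `A z`. -/
def closureOrbitA (X : Fin d → 𝔡) (lam : Fin d → ℝ) (z : openDelta X lam) :
    Set (openDelta X lam) :=
  closure {w | ∃ a ∈ groupA X, torusAct a z = (w : Fin d → ℂ)}

/-- The relation `z ∼ w` on `ℂ^d_Δ`: the sets `N (closure (A z))` and `closure (A w)` meet. -/
def toricRel (X : Fin d → 𝔡) (lam : Fin d → ℝ) (Q : Submodule ℤ 𝔡) (z w : openDelta X lam) :
    Prop :=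
  ∃ u ∈ closureOrbitA X lam z, ∃ v ∈ closureOrbitA X lam w,
    ∃ g ∈ groupN X Q, torusAct g u = (v : Fin d → ℂ)

/-- The space `X_Δ`: the quotient of `ℂ^d_Δ` by the relation above, with the quotient topology.
(`Quot` is the quotient by the equivalence relation that is generated by a relation.) -/
abbrev ToricSpace (X : Fin d → 𝔡) (lam : Fin d → ℝ) (Q : Submodule ℤ 𝔡) : Type :=
  Quot (toricRel X lam Q)

/-- The piece of `X_Δ` for a singular face `F`: the image of the set of all `z` such that the
closure of `A z` meets `(ℂ^*)^{F^c}`; and, for the maximal element, the maximal piece: the image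
of the union of the sets `ℂ^F × (ℂ^*)^{F^c}` over the regular faces `F`. -/
def piece (X : Fin d → 𝔡) (lam : Fin d → ℝ) (Q : Submodule ℤ 𝔡) :
    StratumIndex X lam → Set (ToricSpace X lam Q)
  | some F => Quot.mk _ '' {z | ∃ u ∈ closureOrbitA X lam z, (u : Fin d → ℂ) ∈ coordTorus F.1.idx}
  | none => Quot.mk _ '' {z | (z : Fin d → ℂ) ∈ regularSet X lam}

/-- The dimension of a piece: `dim F` for a singular face `F`, and `n` for the maximal piece. -/
noncomputable def pieceDim (X : Fin d → 𝔡) (lam : Fin d → ℝ) : StratumIndex X lam → ℕ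
  | some F => F.1.dim
  | none => Module.finrank ℝ 𝔡

/-- The inclusion of `S` in `ℂ^d_Δ` induces a homeomorphism of the orbit space `S / N_ℂ` with the
subspace `T` of `X_Δ`, and `A` is the complex quasifold structure on `T` that is induced by the
projection of `S` onto `T`. -/
def IsOrbitQuasifold {k : ℕ} {X : Fin d → 𝔡} {lam : Fin d → ℝ} {Q : Submodule ℤ 𝔡}
    (S : Set (Fin d → ℂ)) (T : Set (ToricSpace X lam Q)) (A : ComplexQuasifold k T) : Prop :=
  S ⊆ openDelta X lam ∧
  ∃ h : OrbitSpace (groupNC X Q) S ≃ₜ T,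
    (∀ (z : S) (hz : (z : Fin d → ℂ) ∈ openDelta X lam),
      (h (Quotient.mk _ z) : ToricSpace X lam Q) = Quot.mk _ ⟨z, hz⟩) ∧
    A.IsInducedBy S (fun z => h (Quotient.mk _ z))

end Polytope

/-! Everything rests on one invariant. The index sets of faces are closed under intersection, so the
zeros of a point z of `openDelta X lam` lie in a smallest index set I, that of `faceOf z`.
Minimality and a separation argument give a linear relation among the normals X_j, j ∈ I, whose
coefficients are positive wherever z_j ≠ 0 (`exists_relation_of_minimal`). The one-parameter
subgroup of A that it defines drives z to the point `zeroOut I z`, in which all coordinates in I are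
zero. Conversely, the A-invariant functions ∏ |z_j| ^ ν(X_j) show that a point in the closure of Az
vanishes only at indices in I (`zeros_subset_faceOf_of_mem_closure`), and outside I it agrees with a
point of Az (`exists_eq_of_mem_closure`). Hence z ∼ w exactly when z and w have the same face and
their truncations lie in one N_ℂ-orbit (`toricRel_iff`), which is visibly an equivalence relation.

The pieces are therefore given by conditions on `faceOf`: equality with F, or regularity. On a
saturated open set around S, truncation (the identity for the regular piece) is continuous and reads
off the N_ℂ-orbit, so the bijection of S / N_ℂ with the piece is a homeomorphism
(`exists_orbitSpace_homeomorph`). For a regular face the normals are independent, so the relation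
above is trivial and the zeros of z fill I.

For the charts, choose a basis among the normals, or among their images modulo the span of the
normals of a singular F. The complexified kernel of π can be used to normalize the nonvanishing
coordinates outside the basis to 1, which leaves a copy of ℂ^k (`Slice`). Basis coordinates that may
vanish are kept, and the residual group multiplies them by exponentials; the others are replaced by
their logarithms, and the group translates them. The group is countable because Q is. Two charts
differ only in which coordinates are logarithmic and in the choice of basis, so exponential
coverings and an explicit biholomorphism of ℂ^k make them compatible (`Slice.chart_compatible`).

Finally F ≤ G means I_G ⊆ I_F (`face_le_iff`). Conditions on the face that pass to smaller index
sets are open, which restricts the closures of the pieces; making zero coordinates slightly nonzero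
gives the converse closure relations. -/

/-! ### The exponential and its coordinatewise coverings. -/

/-- The function `t ↦ exp (2 π i t)`. -/
noncomputable def cexp (t : ℂ) : ℂ := Complex.exp (2 * Real.pi * Complex.I * t)

theorem cexp_ne_zero (t : ℂ) : cexp t ≠ 0 := Complex.exp_ne_zero _

theorem cexp_zero : cexp 0 = 1 := by simp [cexp]

theorem cexp_add (s t : ℂ) : cexp (s + t) = cexp s * cexp t := by
  simp [cexp, mul_add, Complex.exp_add]

theorem cexp_neg (t : ℂ) : cexp (-t) = (cexp t)⁻¹ := by simp [cexp, Complex.exp_neg]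

theorem cexp_neg_mul_self (t : ℂ) : cexp (-t) * cexp t = 1 := by
  rw [cexp_neg, inv_mul_cancel₀ (cexp_ne_zero t)]

theorem cexp_sub_mul (s t : ℂ) : cexp (s - t) * cexp t = cexp s := by
  rw [← cexp_add, sub_add_cancel]

theorem cexp_eq_one_iff {t : ℂ} : cexp t = 1 ↔ ∃ m : ℤ, t = m := by
  rw [cexp, Complex.exp_eq_one_iff]
  refine exists_congr fun m => ?_
  rw [mul_comm (m : ℂ), mul_right_inj' Complex.two_pi_I_ne_zero]

theorem exists_cexp_eq {z : ℂ} (hz : z ≠ 0) : ∃ t, cexp t = z := by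
  refine ⟨Complex.log z / (2 * Real.pi * Complex.I), ?_⟩
  rw [cexp, mul_div_cancel₀ _ Complex.two_pi_I_ne_zero, Complex.exp_log hz]

theorem contDiff_cexp {n : WithTop ℕ∞} : ContDiff ℂ n cexp :=
  (contDiff_const.mul contDiff_id).cexp

theorem isCoveringMapOn_cexp : IsCoveringMapOn cexp {0}ᶜ :=
  Complex.isCoveringMapOn_exp.comp_homeomorph (Homeomorph.mulLeft₀ _ Complex.two_pi_I_ne_zero)

theorem hasStrictDerivAt_cexp (t : ℂ) :
    HasStrictDerivAt cexp (2 * Real.pi * Complex.I * cexp t) t := by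
  have h : HasStrictDerivAt (fun t : ℂ => 2 * Real.pi * Complex.I * t)
      (2 * Real.pi * Complex.I) t := by
    simpa using (hasStrictDerivAt_id t).const_mul (2 * Real.pi * Complex.I : ℂ)
  have h2 := h.cexp
  rw [mul_comm (Complex.exp _)] at h2
  exact h2

theorem isCoveringMapOn_id {E : Type*} [TopologicalSpace E] :
    IsCoveringMapOn (id : E → E) Set.univ := fun _ _ =>
  IsEvenlyCovered.to_isEvenlyCovered_preimage (I := Unit) ⟨inferInstance, Set.univ, trivial,
    isOpen_univ, isOpen_univ, (Homeomorph.prodUnique _ _).symm, fun _ => rfl⟩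

/-- A finite product of evenly covered points is evenly covered. -/
theorem IsCoveringMapOn.piMap {ι : Type*} [Finite ι] {E X : ι → Type*}
    [∀ i, TopologicalSpace (E i)] [∀ i, TopologicalSpace (X i)] {f : ∀ i, E i → X i}
    {s : ∀ i, Set (X i)} (hf : ∀ i, IsCoveringMapOn (f i) (s i)) :
    IsCoveringMapOn (Pi.map f) (Set.univ.pi s) := by
  intro x hx
  have h := fun i => hf i (x i) (hx i trivial)
  choose hd U hxU hU hfU H hH using h
  have := hd
  -- The sheets over a product of evenly covered neighbourhoods are indexed by the product of the
  -- fibres.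
  refine IsEvenlyCovered.to_isEvenlyCovered_preimage
    (I := ∀ i, f i ⁻¹' {x i}) ⟨inferInstance, Set.univ.pi U, fun i _ => hxU i,
      isOpen_set_pi Set.finite_univ fun i _ => hU i, ?_, ?_⟩
  · have : Pi.map f ⁻¹' Set.univ.pi U = Set.univ.pi fun i => f i ⁻¹' U i := by
      ext z; simp [Set.mem_pi]
    rw [this]
    exact isOpen_set_pi Set.finite_univ fun i _ => hfU i
  · have hs : ∀ i (v : U i) m, f i ((H i).symm (v, m)) = v := fun i v m => by
      rw [← hH i, Homeomorph.apply_symm_apply]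
    refine ⟨
      { toFun := fun z => (⟨fun i => f i (z.1 i), fun i _ => z.2 i trivial⟩,
          fun i => (H i ⟨z.1 i, z.2 i trivial⟩).2)
        invFun := fun p => ⟨fun i => ((H i).symm (⟨p.1.1 i, p.1.2 i trivial⟩, p.2 i)).1,
          fun i _ => by simpa [hs] using p.1.2 i trivial⟩
        left_inv := ?_
        right_inv := ?_
        continuous_toFun := ?_
        continuous_invFun := ?_ }, fun z => rfl⟩
    · intro z
      ext i
      have : ((⟨f i (z.1 i), z.2 i trivial⟩ : U i), (H i ⟨z.1 i, z.2 i trivial⟩).2)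
          = H i ⟨z.1 i, z.2 i trivial⟩ := 
        Prod.ext (Subtype.ext (hH i ⟨z.1 i, z.2 i trivial⟩).symm) rfl
      simp only
      rw [this, Homeomorph.symm_apply_apply]
    · intro p
      refine Prod.ext (Subtype.ext (funext fun i => hs i _ _)) (funext fun i => ?_)
      exact congrArg Prod.snd ((H i).apply_symm_apply (⟨p.1.1 i, p.1.2 i trivial⟩, p.2 i))
    · refine Continuous.prodMk (Continuous.subtype_mk (continuous_pi fun i => ?_) _)
        (continuous_pi fun i => ?_)
      · have : (fun z : ↥(Pi.map f ⁻¹' Set.univ.pi U) => f i (z.1 i)) =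
            fun z => (H i ⟨z.1 i, z.2 i trivial⟩).1.1 := 
          funext fun z => (hH i ⟨z.1 i, z.2 i trivial⟩).symm
        rw [this]
        exact continuous_subtype_val.comp (continuous_fst.comp ((H i).continuous.comp
          (((continuous_apply i).comp continuous_subtype_val).subtype_mk _)))
      · exact continuous_snd.comp ((H i).continuous.comp
          (((continuous_apply i).comp continuous_subtype_val).subtype_mk _))
    · refine Continuous.subtype_mk (continuous_pi fun i => ?_) _
      refine continuous_subtype_val.comp ((H i).symm.continuous.comp (Continuous.prodMk ?_ ?_))
      · exact ((continuous_apply i).comp (continuous_subtype_val.comp continuous_fst)).subtype_mk _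
      · exact (continuous_apply i).comp continuous_snd

/-- The map of `ℂ^k` that is `exp (2 π i ·)` on the coordinates in `P` and the identity on the
others. -/
noncomputable def partialExp {k : ℕ} (P : Finset (Fin k)) : (Fin k → ℂ) → Fin k → ℂ :=
  Pi.map fun i => if i ∈ P then cexp else id

section partialExp

variable {k : ℕ} (P : Finset (Fin k))

theorem partialExp_apply_of_mem {i : Fin k} (hi : i ∈ P) (u : Fin k → ℂ) :
    partialExp P u i = cexp (u i) := by simp [partialExp, hi]

theorem partialExp_apply_of_notMem {i : Fin k} (hi : i ∉ P) (u : Fin k → ℂ) :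
    partialExp P u i = u i := by simp [partialExp, hi]

theorem contDiff_partialExp {n : WithTop ℕ∞} : ContDiff ℂ n (partialExp P) := by
  rw [contDiff_pi]
  intro i
  by_cases hi : i ∈ P
  · simp only [partialExp_apply_of_mem P hi]
    exact contDiff_cexp.comp (contDiff_apply ℂ ℂ i)
  · simp only [partialExp_apply_of_notMem P hi]
    exact contDiff_apply ℂ ℂ i

theorem range_partialExp : Set.range (partialExp P) = {v | ∀ i ∈ P, v i ≠ 0} := by
  ext v
  constructor
  · rintro ⟨u, rfl⟩ i hi
    rw [partialExp_apply_of_mem P hi]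
    exact cexp_ne_zero _
  · intro hv
    have : ∀ i, ∃ t, (if i ∈ P then cexp else id) t = v i := by
      intro i
      by_cases hi : i ∈ P
      · simpa [hi] using exists_cexp_eq (hv i hi)
      · exact ⟨v i, by simp [hi]⟩
    choose u hu using this
    exact ⟨u, funext hu⟩

theorem isPreconnected_ne_zero : IsPreconnected {v : Fin k → ℂ | ∀ i ∈ P, v i ≠ 0} := by
  rw [← range_partialExp]
  exact isPreconnected_range (contDiff_partialExp (n := 0) P).continuous

theorem isCoveringMapOn_partialExp :
    IsCoveringMapOn (partialExp P) {v | ∀ i ∈ P, v i ≠ 0} := by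
  have : {v : Fin k → ℂ | ∀ i ∈ P, v i ≠ 0} =
      Set.univ.pi fun i => if i ∈ P then {0}ᶜ else Set.univ := by
    ext v
    simp only [Set.mem_ofPred_eq, Set.mem_pi, Set.mem_univ, true_imp_iff]
    refine forall_congr' fun i => ?_
    by_cases hi : i ∈ P <;> simp [hi]
  rw [this]
  refine IsCoveringMapOn.piMap fun i => ?_
  by_cases hi : i ∈ P
  · simpa [hi] using isCoveringMapOn_cexp
  · simpa [hi] using isCoveringMapOn_id

theorem exists_openPartialHomeomorph_cexp (t : ℂ) :
    ∃ φ : OpenPartialHomeomorph ℂ ℂ, (φ : ℂ → ℂ) = cexp ∧ t ∈ φ.source ∧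
      ContDiffOn ℂ ω φ.symm φ.target := by
  have hd : ∀ t, 2 * Real.pi * Complex.I * cexp t ≠ 0 := fun t =>
    mul_ne_zero Complex.two_pi_I_ne_zero (cexp_ne_zero t)
  have hc : ContDiffAt ℂ ω cexp t := contDiff_cexp.contDiffAt
  have hf := (hasStrictDerivAt_cexp t).hasDerivAt.hasFDerivAt_equiv (hd t)
  refine ⟨hc.toOpenPartialHomeomorph cexp hf (by simp), rfl,
    hc.mem_toOpenPartialHomeomorph_source hf _, fun y hy => ?_⟩
  refine (OpenPartialHomeomorph.contDiffAt_symm_deriv _ (hd _) hy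
    (hasStrictDerivAt_cexp _).hasDerivAt ?_).contDiffWithinAt
  exact contDiff_cexp.contDiffAt

theorem isLocalDiffeomorph_partialExp :
    IsLocalDiffeomorph 𝓘(ℂ, Fin k → ℂ) 𝓘(ℂ, Fin k → ℂ) ω (partialExp P) := by
  intro u
  have h : ∀ i, ∃ φ : OpenPartialHomeomorph ℂ ℂ, (φ : ℂ → ℂ) = (if i ∈ P then cexp else id) ∧
      u i ∈ φ.source ∧ ContDiffOn ℂ ω φ.symm φ.target := by
    intro i
    by_cases hi : i ∈ P
    · simpa [hi] using exists_openPartialHomeomorph_cexp (u i)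
    · exact ⟨OpenPartialHomeomorph.refl ℂ, by simp [hi], trivial, contDiffOn_id⟩
  choose φ hφ hu hs using h
  have he : (OpenPartialHomeomorph.pi φ : (Fin k → ℂ) → Fin k → ℂ) = partialExp P := by
    funext v i
    exact congrFun (hφ i) (v i)
  refine ⟨{ (OpenPartialHomeomorph.pi φ).toPartialEquiv with
    open_source := (OpenPartialHomeomorph.pi φ).open_source
    open_target := (OpenPartialHomeomorph.pi φ).open_target
    contMDiffOn_toFun := ?_
    contMDiffOn_invFun := ?_ }, fun i _ => hu i, fun v _ => (congrFun he v).symm⟩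
  · rw [contMDiffOn_iff_contDiffOn]
    change ContDiffOn ℂ ω (OpenPartialHomeomorph.pi φ) _
    rw [he]
    exact (contDiff_partialExp P).contDiffOn
  · rw [contMDiffOn_iff_contDiffOn]
    refine contDiffOn_pi.2 fun i => ?_
    exact (hs i).comp (contDiff_apply ℂ ℂ i).contDiffOn fun v hv => hv i trivial

end partialExp

/-! ### Hausdorff dimension of coordinate hyperplanes. -/

/-- A coordinate hyperplane of `ℂ^k` has real codimension two. -/
theorem dimH_coord_eq_zero {k : ℕ} (i : Fin k) :
    dimH {u : Fin k → ℂ | u i = 0} + 2 ≤ 2 * (k : ENNReal) := by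
  obtain ⟨m, rfl⟩ : ∃ m, k = m + 1 := Nat.exists_eq_succ_of_ne_zero (Fin.pos i).ne'
  -- The hyperplane is the range of a real linear map from a space of real dimension 2m, and smooth
  -- maps do not raise the dimension.
  let f : (Fin m → ℂ) →ₗ[ℝ] Fin (m + 1) → ℂ :=
    { toFun := fun u => i.insertNth 0 u
      map_add' := fun u v => by
        rw [← Fin.insertNth_add]
        simp
      map_smul' := fun c u => by
        funext j
        refine Fin.succAboveCases i ?_ (fun j => ?_) j <;> simp }
  have hf : ContDiff ℝ 1 f := f.toContinuousLinearMap.contDiff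
  have hr : {u : Fin (m + 1) → ℂ | u i = 0} ⊆ Set.range f := fun u hu =>
    ⟨i.removeNth u, by
      have h := Fin.insertNth_self_removeNth i u
      rw [show u i = 0 from hu] at h
      exact h⟩
  have h := (dimH_mono hr).trans hf.dimH_range_le
  have h2 : Module.finrank ℝ (Fin m → ℂ) = 2 * m := by
    rw [Module.finrank_pi_fintype]
    simp [Complex.finrank_real_complex, mul_comm]
  rw [h2] at h
  calc _ ≤ ((2 * m : ℕ) : ENNReal) + 2 := by gcongr
    _ = _ := by push_cast; ring

/-- A finite union has the largest of the dimensions. Nonemptiness of `S` forces k > 0; for k = 0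
and the empty set the bound would read 2 ≤ 0. -/
theorem dimH_subset_iUnion_coord {k : ℕ} {S : Set (Fin k → ℂ)} (hne : S.Nonempty)
    (hS : S ⊆ ⋃ i, {u : Fin k → ℂ | u i = 0}) : dimH S + 2 ≤ 2 * (k : ENNReal) := by
  obtain ⟨u, hu⟩ := hne
  obtain ⟨i, -⟩ := Set.mem_iUnion.1 (hS hu)
  have : Nonempty (Fin k) := ⟨i⟩
  have h := dimH_mono hS
  rw [dimH_iUnion] at h
  refine (add_le_add_left h 2).trans ?_
  rw [ENNReal.iSup_add]
  exact iSup_le dimH_coord_eq_zero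

/-! ### Slices and the models they define. -/

/-- Linear coordinates on the quotient of `ℂ^d` by the complex subspace `N`, in which the unit
vectors with index in the range of `e` become the standard basis, together with a set `K` of
coordinates that are allowed to vanish. The coordinates with index in `A` are irrelevant, and the
subgroup `H` of `ℂ^d` that acts through the exponential is countable modulo `N`. -/
structure Slice {d : ℕ} (k : ℕ) (A : Finset (Fin d)) (N : Submodule ℂ (Fin d → ℂ))
    (H : AddSubgroup (Fin d → ℂ)) where
  e : Fin k → Fin d
  B : (Fin d → ℂ) →ₗ[ℂ] (Fin k → ℂ)
  K : Finset (Fin k)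
  B_single : ∀ i, B (Pi.single (e i) 1) = Pi.single i 1
  B_of_mem : ∀ j ∈ A, B (Pi.single j 1) = 0
  B_eq_zero_iff : ∀ Z, B Z = 0 ↔ Z ∈ N
  ker_le : ∀ Z ∈ N, Z ∈ H
  single_mem : ∀ j, Pi.single j 1 ∈ H
  countable : (B '' H).Countable

/-- The map `q` identifies `Y` with the quotient of `S` by the group `exp H`, and the coordinates
with index in `A` vanish on `S`. -/
structure IsTorusQuotient {d : ℕ} (A : Finset (Fin d)) (H : AddSubgroup (Fin d → ℂ))
    {S : Set (Fin d → ℂ)} {Y : Type} [TopologicalSpace Y] (q : S → Y) : Prop where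
  continuous : Continuous q
  isOpenMap : IsOpenMap q
  eq_iff : ∀ z w : S, q z = q w ↔ ∃ Z ∈ H, ∀ j, w.1 j = cexp (Z j) * z.1 j
  zero : ∀ z ∈ S, ∀ j ∈ A, z j = 0

namespace Slice

variable {d k : ℕ} {A : Finset (Fin d)} {N : Submodule ℂ (Fin d → ℂ)}
  {H : AddSubgroup (Fin d → ℂ)} (σ τ : Slice k A N H)

theorem e_injective : Function.Injective σ.e := by
  intro i i' h
  have h1 := σ.B_single i
  rw [h, σ.B_single i'] at h1
  by_contra hne
  have := congrFun h1 i
  simp [hne] at this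

theorem e_notMem (i : Fin k) : σ.e i ∉ A := by
  intro h
  have h1 := σ.B_single i
  rw [σ.B_of_mem _ h] at h1
  simpa using congrFun h1 i

theorem not_exists_of_mem {j : Fin d} (hj : j ∈ A) : ¬ ∃ i, σ.e i = j := by
  rintro ⟨i, rfl⟩
  exact σ.e_notMem i hj

theorem B_eq_sum (Z : Fin d → ℂ) : σ.B Z = ∑ j, Z j • σ.B (Pi.single j 1) := by
  conv_lhs => rw [pi_eq_sum_univ' Z]
  simp only [map_sum, map_smul]

theorem B_extend (u : Fin k → ℂ) : σ.B (Function.extend σ.e u 0) = u := by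
  have : Function.extend σ.e u 0 = ∑ i, u i • (Pi.single (σ.e i) 1 : Fin d → ℂ) := by
    funext j
    by_cases hj : ∃ i, σ.e i = j
    · obtain ⟨i, rfl⟩ := hj
      rw [σ.e_injective.extend_apply]
      simp [Finset.sum_apply, Pi.single_apply, σ.e_injective.eq_iff]
    · rw [Function.extend_apply' _ _ _ hj]
      push Not at hj
      simp [Finset.sum_apply, fun i => (hj i).symm]
  rw [this]
  simp only [map_sum, map_smul, σ.B_single]
  funext i
  simp [Finset.sum_apply, Pi.single_apply]

theorem mem_ker_of_support (σ : Slice k A N H)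
    (Z : Fin d → ℂ) (hZ : ∀ j, j ∉ A → Z j = 0) : Z ∈ N := by
  rw [← σ.B_eq_zero_iff, σ.B_eq_sum]
  refine Finset.sum_eq_zero fun j _ => ?_
  by_cases hj : j ∈ A
  · rw [σ.B_of_mem j hj, smul_zero]
  · rw [hZ j hj, zero_smul]

theorem int_mem (σ : Slice k A N H) (Z : Fin d → ℂ) (hZ : ∀ j, ∃ m : ℤ, Z j = m) : Z ∈ H := by
  choose m hm using hZ
  have : Z = ∑ j, m j • (Pi.single j 1 : Fin d → ℂ) := by
    funext l
    simp [Finset.sum_apply, Pi.single_apply, hm]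
  rw [this]
  exact H.sum_mem fun j _ => H.zsmul_mem (σ.single_mem j) _

/-- An exponent matters only modulo integers outside `A`, and not at all inside `A`, where the
coordinates of the points vanish. Integer vectors lie in `H` by `single_mem`, and vectors supported
in `A` lie in `N`. -/
theorem mem_of_int (σ : Slice k A N H) {Z W : Fin d → ℂ} (hZ : Z ∈ H)
    (h : ∀ j, j ∉ A → ∃ m : ℤ, W j - Z j = m) :
    W ∈ H := by
  have h1 : (fun j => if j ∈ A then 0 else W j - Z j) ∈ H := by
    refine σ.int_mem _ fun j => ?_
    by_cases hj : j ∈ A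
    · exact ⟨0, by simp [hj]⟩
    · simpa [hj] using h j hj
  have h2 : (fun j => if j ∈ A then W j - Z j else 0) ∈ H :=
    σ.ker_le _ (σ.mem_ker_of_support _ fun j hj => by simp [hj])
  have : W = Z + ((fun j => if j ∈ A then 0 else W j - Z j) +
      fun j => if j ∈ A then W j - Z j else 0) := by
    funext j
    by_cases hj : j ∈ A <;> simp [hj]
  rw [this]
  exact H.add_mem hZ (H.add_mem h1 h2)

/-- Modulo `N`, each element of `H` has a representative supported on the range of `e`. This lets
the group act on the image of the section. -/
theorem extend_B_mem {Z : Fin d → ℂ} (hZ : Z ∈ H) : Function.extend σ.e (σ.B Z) 0 ∈ H := by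
  have : Function.extend σ.e (σ.B Z) 0 - Z ∈ N := by
    rw [← σ.B_eq_zero_iff, map_sub, σ.B_extend, sub_self]
  simpa using H.add_mem (σ.ker_le _ this) hZ

/-! ### The group of the model -/

/-- The action of a vector of `ℂ^k`: multiplication by the exponential on the coordinates in `K`,
translation on the others. -/
noncomputable def act (p u : Fin k → ℂ) : Fin k → ℂ :=
  fun i => if i ∈ σ.K then cexp (p i) * u i else u i + p i

theorem act_zero (u : Fin k → ℂ) : σ.act 0 u = u := by
  funext i
  simp [act, cexp_zero]

theorem act_add (p p' u : Fin k → ℂ) : σ.act (p + p') u = σ.act p (σ.act p' u) := by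
  funext i
  by_cases hi : i ∈ σ.K
  · simp [act, hi, cexp_add, mul_assoc]
  · simp [act, hi, add_assoc, add_comm (p i)]

theorem contDiff_act (p : Fin k → ℂ) {n : WithTop ℕ∞} : ContDiff ℂ n (σ.act p) := by
  rw [contDiff_pi]
  intro i
  by_cases hi : i ∈ σ.K
  · simp only [act, hi, if_true]
    exact contDiff_const.mul (contDiff_apply ℂ ℂ i)
  · simp only [act, hi, if_false]
    exact (contDiff_apply ℂ ℂ i).add contDiff_const

/-- The action of a vector as a permutation. -/
noncomputable def actPerm (p : Fin k → ℂ) : Equiv.Perm (Fin k → ℂ) where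
  toFun := σ.act p
  invFun := σ.act (-p)
  left_inv u := by rw [← σ.act_add, neg_add_cancel, σ.act_zero]
  right_inv u := by rw [← σ.act_add, add_neg_cancel, σ.act_zero]

/-- The image of `H` in the group of permutations of `ℂ^k`. -/
noncomputable def group : Subgroup (Equiv.Perm (Fin k → ℂ)) where
  carrier := σ.actPerm '' (σ.B '' H)
  one_mem' := ⟨0, ⟨0, H.zero_mem, map_zero _⟩, Equiv.ext σ.act_zero⟩
  mul_mem' := by
    rintro _ _ ⟨_, ⟨Z, hZ, rfl⟩, rfl⟩ ⟨_, ⟨W, hW, rfl⟩, rfl⟩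
    refine ⟨_, ⟨Z + W, H.add_mem hZ hW, map_add _ _ _⟩, Equiv.ext fun u => ?_⟩
    exact σ.act_add _ _ u
  inv_mem' := by
    rintro _ ⟨_, ⟨Z, hZ, rfl⟩, rfl⟩
    exact ⟨_, ⟨-Z, H.neg_mem hZ, map_neg _ _⟩, Equiv.ext fun u => rfl⟩

theorem exists_act_of_mem_group (γ : σ.group) :
    ∃ Z ∈ H, ∀ u : Fin k → ℂ, γ • u = σ.act (σ.B Z) u := by
  obtain ⟨_, _, ⟨Z, hZ, rfl⟩, rfl⟩ := γ
  exact ⟨Z, hZ, fun u => rfl⟩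

theorem exists_smul_eq_act {Z : Fin d → ℂ} (hZ : Z ∈ H) :
    ∃ γ : σ.group, ∀ u : Fin k → ℂ, γ • u = σ.act (σ.B Z) u :=
  ⟨⟨_, _, ⟨Z, hZ, rfl⟩, rfl⟩, fun _ => rfl⟩

/-- The nonfree points of the model form a union of coordinate subspaces. -/
theorem nonfreeSet_eq : nonfreeSet σ.group (Fin k → ℂ) =
    ⋃ L ∈ {L : Finset (Fin k) | L.Nonempty ∧
      ∃ γ : σ.group, γ ≠ 1 ∧ ∀ u : Fin k → ℂ, (∀ i ∈ L, u i = 0) → γ • u = u},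
      {u | ∀ i ∈ L, u i = 0} := by
  ext u
  simp only [Set.mem_iUnion, exists_prop]
  constructor
  · rintro ⟨γ, hγ, hu⟩
    obtain ⟨Z, hZ, h⟩ := σ.exists_act_of_mem_group γ
    rw [h u] at hu
    have hK : ∀ i ∉ σ.K, σ.B Z i = 0 := fun i hi => by
      simpa [act, hi] using congrFun hu i
    -- The fixed points of γ are cut out by the coordinates that it multiplies by a scalar other
    -- than 1.
    have hfix : ∀ v : Fin k → ℂ,
        (∀ i ∈ σ.K.filter fun i => cexp (σ.B Z i) ≠ 1, v i = 0) → γ • v = v := by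
      intro v hv
      rw [h v]
      funext i
      by_cases hi : i ∈ σ.K
      · by_cases h1 : cexp (σ.B Z i) = 1
        · simp [act, hi, h1]
        · simp [act, hi, hv i (by simp [hi, h1])]
      · simp [act, hi, hK i hi]
    refine ⟨σ.K.filter fun i => cexp (σ.B Z i) ≠ 1, ⟨?_, γ, hγ, hfix⟩, ?_⟩
    -- If there were no such coordinate, γ would fix every point. As the group consists of
    -- permutations, γ would then be 1.
    · rw [Finset.nonempty_iff_ne_empty]
      intro he
      rw [he] at hfix
      refine hγ (Subtype.ext (Equiv.ext fun v => hfix v (by simp)))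
    · intro i hi
      rw [Finset.mem_filter] at hi
      have h2 := congrFun hu i
      simp only [act, hi.1, if_true] at h2
      by_contra hne
      exact hi.2 (mul_right_cancel₀ hne (h2.trans (one_mul _).symm))
  · rintro ⟨L, ⟨-, γ, hγ, hfix⟩, hu⟩
    exact ⟨γ, hγ, hfix u hu⟩

theorem isClosed_nonfreeSet : IsClosed (nonfreeSet σ.group (Fin k → ℂ)) := by
  rw [σ.nonfreeSet_eq]
  refine (Set.toFinite _).isClosed_biUnion fun L _ => ?_
  simp only [Set.ofPred_forall]
  exact isClosed_iInter fun i => isClosed_iInter fun _ =>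
    isClosed_eq (continuous_apply i) continuous_const

theorem nonfreeSet_subset :
    nonfreeSet σ.group (Fin k → ℂ) ⊆ ⋃ i, {u : Fin k → ℂ | u i = 0} := by
  rw [σ.nonfreeSet_eq]
  refine Set.iUnion₂_subset fun L hL u hu => ?_
  obtain ⟨i, hi⟩ := hL.1
  exact Set.mem_iUnion.2 ⟨i, hu i hi⟩

/-- The model `ℂ^k / exp H`. -/
noncomputable def model : QuasifoldModel k where
  carrier := Fin k → ℂ
  conn := inferInstance
  Γ := σ.group
  cnt := by
    have : (σ.actPerm '' (σ.B '' H)).Countable := σ.countable.image _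
    exact this.to_subtype
  holo γ := by
    obtain ⟨Z, hZ, h⟩ := σ.exists_act_of_mem_group γ
    rw [mdifferentiable_iff_differentiable]
    have : (fun x : Fin k → ℂ => γ • x) = σ.act (σ.B Z) := funext h
    rw [this]
    exact (σ.contDiff_act _ (n := 1)).differentiable (by simp)
  nonfree_closed := σ.isClosed_nonfreeSet
  nonfree_codim x hx := by
    have : chartAt (Fin k → ℂ) x '' ((chartAt (Fin k → ℂ) x).source ∩
        nonfreeSet σ.group (Fin k → ℂ)) = nonfreeSet σ.group (Fin k → ℂ) := by
      simp only [chartAt_self_eq]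
      simp
    refine (congrArg (fun s => dimH s + 2) this).trans_le ?_
    exact dimH_subset_iUnion_coord ⟨x, hx⟩ σ.nonfreeSet_subset

end Slice

namespace Slice

variable {d k : ℕ} {A : Finset (Fin d)} {N : Submodule ℂ (Fin d → ℂ)}
  {H : AddSubgroup (Fin d → ℂ)} (σ τ : Slice k A N H)

/-! ### The section and the chart map -/

/-- The points of `ℂ^d` whose vanishing coordinates are those in `A` and possibly those of the
form `e i` with `i ∈ K`. -/
def region : Set (Fin d → ℂ) :=
  {z | (∀ j ∈ A, z j = 0) ∧ ∀ j ∉ A, z j = 0 → ∃ i ∈ σ.K, σ.e i = j}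

/-- The section of the chart: `ℂ^k → ℂ^d`. -/
noncomputable def sect (u : Fin k → ℂ) : Fin d → ℂ :=
  Function.extend σ.e (partialExp σ.Kᶜ u) fun j => if j ∈ A then 0 else 1

theorem sect_e_of_mem {i : Fin k} (hi : i ∈ σ.K) (u : Fin k → ℂ) : σ.sect u (σ.e i) = u i := by
  rw [sect, σ.e_injective.extend_apply, partialExp_apply_of_notMem]
  simpa using hi

theorem sect_e_of_notMem {i : Fin k} (hi : i ∉ σ.K) (u : Fin k → ℂ) :
    σ.sect u (σ.e i) = cexp (u i) := by
  rw [sect, σ.e_injective.extend_apply, partialExp_apply_of_mem]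
  simpa using hi

theorem sect_of_mem {j : Fin d} (hj : j ∈ A) (u : Fin k → ℂ) : σ.sect u j = 0 := by
  rw [sect, Function.extend_apply' _ _ _ (σ.not_exists_of_mem hj), if_pos hj]

theorem sect_of_not_exists {j : Fin d} (h : ¬ ∃ i, σ.e i = j) (hj : j ∉ A) (u : Fin k → ℂ) :
    σ.sect u j = 1 := by
  rw [sect, Function.extend_apply' _ _ _ h, if_neg hj]

theorem sect_mem_region (u : Fin k → ℂ) : σ.sect u ∈ σ.region := by
  refine ⟨fun j hj => σ.sect_of_mem hj u, fun j hj h => ?_⟩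
  by_cases hr : ∃ i, σ.e i = j
  · obtain ⟨i, rfl⟩ := hr
    by_cases hi : i ∈ σ.K
    · exact ⟨i, hi, rfl⟩
    · rw [σ.sect_e_of_notMem hi] at h
      exact absurd h (cexp_ne_zero _)
  · rw [σ.sect_of_not_exists hr hj] at h
    exact absurd h one_ne_zero

theorem contDiff_sect {n : WithTop ℕ∞} : ContDiff ℂ n σ.sect := by
  rw [contDiff_pi]
  intro j
  by_cases hr : ∃ i, σ.e i = j
  · obtain ⟨i, rfl⟩ := hr
    simp only [sect, σ.e_injective.extend_apply]
    exact (contDiff_apply ℂ ℂ i).comp (contDiff_partialExp _)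
  · simp only [sect, Function.extend_apply' _ _ _ hr]
    exact contDiff_const

/-- Equivariance of the section: multiplication on the coordinates in `K` and translation of the
logarithms on the others both become multiplication by an exponential. -/
theorem sect_act (p u : Fin k → ℂ) (j : Fin d) :
    σ.sect (σ.act p u) j = cexp (Function.extend σ.e p 0 j) * σ.sect u j := by
  by_cases hr : ∃ i, σ.e i = j
  · obtain ⟨i, rfl⟩ := hr
    rw [σ.e_injective.extend_apply]
    by_cases hi : i ∈ σ.K
    · simp [σ.sect_e_of_mem hi, act, hi]
    · simp [σ.sect_e_of_notMem hi, act, hi, cexp_add, mul_comm]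
  · rw [Function.extend_apply' _ _ _ hr]
    by_cases hj : j ∈ A
    · simp [σ.sect_of_mem hj]
    · simp [σ.sect_of_not_exists hr hj, cexp_zero]

/-- Converse of `sect_act`: points of the section in one orbit are already related by the action on
ℂ^k. -/
theorem exists_eq_act {Z : Fin d → ℂ} (hZ : Z ∈ H) {u u' : Fin k → ℂ}
    (h : ∀ j, σ.sect u' j = cexp (Z j) * σ.sect u j) :
    ∃ W ∈ H, u' = σ.act (σ.B W) u := by
  -- On `K` the exponent of `Z` is kept. Off `K` the logarithm must move by exactly u' - u, which
  -- differs from `Z` by an integer.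
  let c : Fin k → ℂ := fun i => if i ∈ σ.K then Z (σ.e i) else u' i - u i
  refine ⟨Function.extend σ.e c 0, σ.mem_of_int hZ fun j hj => ?_, ?_⟩
  · by_cases hr : ∃ i, σ.e i = j
    · obtain ⟨i, rfl⟩ := hr
      rw [σ.e_injective.extend_apply]
      by_cases hi : i ∈ σ.K
      · exact ⟨0, by simp [c, hi]⟩
      · have h1 := h (σ.e i)
        rw [σ.sect_e_of_notMem hi, σ.sect_e_of_notMem hi, ← cexp_add] at h1
        simp only [c, hi, if_false]
        rw [← cexp_eq_one_iff, sub_sub, add_comm (u i), sub_eq_add_neg, cexp_add, cexp_neg, h1,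
          mul_inv_cancel₀ (cexp_ne_zero _)]
    · rw [Function.extend_apply' _ _ _ hr, ← cexp_eq_one_iff]
      have h1 := h j
      rw [σ.sect_of_not_exists hr hj, σ.sect_of_not_exists hr hj, mul_one] at h1
      simp [cexp_neg, ← h1]
  · rw [σ.B_extend]
    funext i
    by_cases hi : i ∈ σ.K
    · have h1 := h (σ.e i)
      rw [σ.sect_e_of_mem hi, σ.sect_e_of_mem hi] at h1
      simp [act, c, hi, h1]
    · simp [act, c, hi]

/-- Near a point `z` of the region there is a holomorphic map `g` to `ℂ^k` such that `sect (g w)`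
and `w` differ by the exponential of an element of `N`. -/
theorem exists_local_lift {z : Fin d → ℂ} (hz : z ∈ σ.region) :
    ∃ O : Set (Fin d → ℂ), IsOpen O ∧ z ∈ O ∧ ∃ g : (Fin d → ℂ) → Fin k → ℂ,
      DifferentiableOn ℂ g O ∧ ∀ w ∈ O, (∀ j ∈ A, w j = 0) →
        ∃ Z ∈ N, ∀ j, σ.sect (g w) j = cexp (Z j) * w j := by
  classical
  -- The coordinates that vanish nowhere on the region; only these get a logarithm.
  let M : Finset (Fin d) := Finset.univ.filter fun j => j ∉ A ∧ ∀ i ∈ σ.K, σ.e i ≠ j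
  have hM : ∀ j ∈ M, z j ≠ 0 := by
    intro j hj h0
    simp only [M, Finset.mem_filter, Finset.mem_univ, true_and] at hj
    obtain ⟨i, hi, he⟩ := hz.2 j hj.1 h0
    exact hj.2 i hi he
  have hex : ∀ j, ∃ t, j ∈ M → cexp t = z j := fun j => by
    by_cases hj : j ∈ M
    · obtain ⟨t, ht⟩ := exists_cexp_eq (hM j hj)
      exact ⟨t, fun _ => ht⟩
    · exact ⟨0, fun h => absurd h hj⟩
  choose l hl using hex
  -- The branch of the logarithm of w_j near z_j that takes the value `l j` at z.
  let L : Fin d → (Fin d → ℂ) → ℂ := fun j w =>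
    if j ∈ M then Complex.log (w j / z j) / (2 * Real.pi * Complex.I) + l j else 0
  let O : Set (Fin d → ℂ) := ⋂ j ∈ M, {w | w j / z j ∈ Complex.slitPlane}
  have hcexp : ∀ w ∈ O, ∀ j ∈ M, cexp (L j w) = w j := by
    intro w hw j hj
    have hs : w j / z j ∈ Complex.slitPlane := Set.mem_iInter₂.1 hw j hj
    simp only [L, hj, if_true]
    rw [cexp_add, hl j hj, cexp, mul_div_cancel₀ _ Complex.two_pi_I_ne_zero,
      Complex.exp_log (Complex.slitPlane_ne_zero hs), div_mul_cancel₀ _ (hM j hj)]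
  have hLd : ∀ j, DifferentiableOn ℂ (L j) O := by
    intro j
    by_cases hj : j ∈ M
    · simp only [L, hj, if_true]
      have h : DifferentiableOn ℂ (fun w : Fin d → ℂ => Complex.log (w j / z j)) O :=
        DifferentiableOn.clog ((differentiable_apply j).mul_const (z j)⁻¹).differentiableOn
          fun w hw => Set.mem_iInter₂.1 hw j hj
      exact (h.mul_const (2 * Real.pi * Complex.I)⁻¹).add_const (l j)
    · simp only [L, hj, if_false]
      exact differentiableOn_const _
  let Λ : (Fin d → ℂ) → Fin d → ℂ := fun w j => L j w
  have hΛ : DifferentiableOn ℂ Λ O := differentiableOn_pi.2 hLd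
  have hB : DifferentiableOn ℂ (fun w => σ.B (Λ w)) O :=
    (LinearMap.toContinuousLinearMap σ.B).differentiable.comp_differentiableOn hΛ
  refine ⟨O, ?_, ?_, fun w i => if i ∈ σ.K then cexp (σ.B (Λ w) i) * w (σ.e i)
    else σ.B (Λ w) i, ?_, ?_⟩
  · exact isOpen_biInter_finset fun j _ =>
      Complex.isOpen_slitPlane.preimage ((continuous_apply j).div_const _)
  · refine Set.mem_iInter₂.2 fun j hj => ?_
    simp [div_self (hM j hj)]
  · refine differentiableOn_pi.2 fun i => ?_
    by_cases hi : i ∈ σ.K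
    · simp only [hi, if_true]
      refine DifferentiableOn.mul ?_ (differentiable_apply _).differentiableOn
      exact ((contDiff_cexp (n := 1)).differentiable (by simp)).comp_differentiableOn
        (differentiableOn_pi.1 hB i)
    · simp only [hi, if_false]
      exact differentiableOn_pi.1 hB i
  · intro w hw hwA
    -- Both terms have the same image under `B`. The second removes the logarithms `Λ w` and the
    -- first puts their `B`-coordinates back on the basis coordinates.
    refine ⟨Function.extend σ.e (σ.B (Λ w)) 0 - Λ w, ?_, fun j => ?_⟩
    · rw [← σ.B_eq_zero_iff, map_sub, σ.B_extend, sub_self]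
    · by_cases hj : j ∈ A
      · rw [σ.sect_of_mem hj, hwA j hj, mul_zero]
      rw [Pi.sub_apply]
      by_cases hr : ∃ i, σ.e i = j
      · obtain ⟨i, rfl⟩ := hr
        rw [σ.e_injective.extend_apply]
        by_cases hi : i ∈ σ.K
        · have : σ.e i ∉ M := by
            simp only [M, Finset.mem_filter, Finset.mem_univ, true_and, not_and]
            exact fun _ h => h i hi rfl
          have h0 : Λ w (σ.e i) = 0 := by simp [Λ, L, this]
          rw [σ.sect_e_of_mem hi, h0, sub_zero]
          exact if_pos hi
        · have : σ.e i ∈ M := by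
            simp only [M, Finset.mem_filter, Finset.mem_univ, true_and]
            refine ⟨hj, fun i' hi' h => hi ?_⟩
            rwa [← σ.e_injective h]
          rw [σ.sect_e_of_notMem hi, ← hcexp w hw _ this, cexp_sub_mul]
          exact congrArg cexp (if_neg hi)
      · have : j ∈ M := by
          simp only [M, Finset.mem_filter, Finset.mem_univ, true_and]
          exact ⟨hj, fun i _ h => hr ⟨i, h⟩⟩
        rw [σ.sect_of_not_exists hr hj, Function.extend_apply' _ _ _ hr]
        nth_rewrite 1 [← hcexp w hw _ this]
        rw [cexp_sub_mul]
        simp [cexp_zero]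

section Chart

variable {S : Set (Fin d → ℂ)} {Y : Type} [TopologicalSpace Y] {q : S → Y}

/-- The composition of the section with the projection. -/
noncomputable def toQuotient (hS : σ.region ⊆ S) (q : S → Y) (u : Fin k → ℂ) : Y :=
  q ⟨σ.sect u, hS (σ.sect_mem_region u)⟩

variable {σ} (hS : σ.region ⊆ S) (hq : IsTorusQuotient A H q)
include hq

theorem continuous_toQuotient : Continuous (σ.toQuotient hS q) :=
  hq.continuous.comp ((σ.contDiff_sect (n := 0)).continuous.subtype_mk _)

theorem toQuotient_eq_iff (u u' : Fin k → ℂ) :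
    σ.toQuotient hS q u = σ.toQuotient hS q u' ↔ ∃ γ : σ.group, γ • u = u' := by
  rw [toQuotient, toQuotient, hq.eq_iff]
  constructor
  · rintro ⟨Z, hZ, h⟩
    obtain ⟨W, hW, rfl⟩ := σ.exists_eq_act hZ h
    obtain ⟨γ, hγ⟩ := σ.exists_smul_eq_act hW
    exact ⟨γ, hγ u⟩
  · rintro ⟨γ, rfl⟩
    obtain ⟨Z, hZ, h⟩ := σ.exists_act_of_mem_group γ
    exact ⟨_, σ.extend_B_mem hZ, fun j => by rw [h u]; exact σ.sect_act _ _ j⟩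

theorem exists_lift (z : S) (u : Fin k → ℂ) (hu : σ.toQuotient hS q u = q z)
    (hz : (z : Fin d → ℂ) ∈ σ.region) :
    ∃ O ∈ 𝓝 (z : Fin d → ℂ), ∃ g : (Fin d → ℂ) → Fin k → ℂ, DifferentiableOn ℂ g O ∧ g z = u ∧
      ∀ w : S, (w : Fin d → ℂ) ∈ O → σ.toQuotient hS q (g w) = q w := by
  obtain ⟨O, hO, hzO, g, hg, h⟩ := σ.exists_local_lift hz
  have hgq : ∀ w : S, (w : Fin d → ℂ) ∈ O → σ.toQuotient hS q (g w) = q w := by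
    intro w hw
    obtain ⟨Z, hZ, h1⟩ := h w hw (hq.zero _ w.2)
    exact ((hq.eq_iff _ _).2 ⟨Z, σ.ker_le Z hZ, h1⟩).symm
  -- The local lift takes z only into the orbit of u; a group element corrects it.
  obtain ⟨γ, hγ⟩ := (toQuotient_eq_iff hS hq _ _).1 ((hgq z hzO).trans hu.symm)
  obtain ⟨Z, hZ, hact⟩ := σ.exists_act_of_mem_group γ
  refine ⟨O, hO.mem_nhds hzO, fun w => γ • g w, ?_, hγ, fun w hw => ?_⟩
  · simp only [hact]
    exact ((σ.contDiff_act _ (n := 1)).differentiable (by simp)).comp_differentiableOn hg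
  · rw [← hgq w hw]
    exact ((toQuotient_eq_iff hS hq _ _).2 ⟨γ, rfl⟩).symm

/-- Near a point of the section the open map `q` factors as the chart map after a continuous local
lift, so the chart map is open as well. -/
theorem isOpenMap_toQuotient : IsOpenMap (σ.toQuotient hS q) := by
  rw [isOpenMap_iff_nhds_le]
  intro u V hV
  let z : S := ⟨σ.sect u, hS (σ.sect_mem_region u)⟩
  obtain ⟨O, hO, g, hg, hgz, h⟩ := exists_lift hS hq z u rfl (σ.sect_mem_region u)
  have hgc : ContinuousAt g z := (hg.continuousOn).continuousAt hO
  have hm : (Subtype.val : S → Fin d → ℂ) ⁻¹' (O ∩ g ⁻¹' (σ.toQuotient hS q ⁻¹' V)) ∈ 𝓝 z := by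
    refine continuous_subtype_val.continuousAt.preimage_mem_nhds (Filter.inter_mem hO ?_)
    refine hgc.preimage_mem_nhds ?_
    rw [hgz]
    exact hV
  refine Filter.mem_of_superset (hq.isOpenMap.image_mem_nhds hm) ?_
  rintro _ ⟨w, ⟨hwO, hw⟩, rfl⟩
  rw [← h w hwO]
  exact hw

theorem mem_region_of_eq {z w : S} (h : q z = q w) (hz : (z : Fin d → ℂ) ∈ σ.region) :
    (w : Fin d → ℂ) ∈ σ.region := by
  obtain ⟨Z, -, h⟩ := (hq.eq_iff _ _).1 h
  refine ⟨hq.zero _ w.2, fun j hj h0 => hz.2 j hj ?_⟩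
  rw [h j] at h0
  exact (mul_eq_zero.1 h0).resolve_left (cexp_ne_zero _)

theorem range_toQuotient : Set.range (σ.toQuotient hS q) = q '' {z | z.1 ∈ σ.region} := by
  ext y
  constructor
  · rintro ⟨u, rfl⟩
    exact ⟨_, σ.sect_mem_region u, rfl⟩
  · rintro ⟨z, hz, rfl⟩
    obtain ⟨O, hO, hzO, g, hg, h⟩ := σ.exists_local_lift hz
    obtain ⟨Z, hZ, h1⟩ := h z hzO (hq.zero _ z.2)
    exact ⟨g z, ((hq.eq_iff _ _).2 ⟨Z, σ.ker_le Z hZ, h1⟩).symm⟩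

variable (σ)

/-- The chart of a slice. -/
noncomputable def chart : QuasifoldChart k Y where
  toQuasifoldModel := σ.model
  domain := ⟨Set.range (σ.toQuotient hS q), (isOpenMap_toQuotient hS hq).isOpen_range⟩
  homeo := by
    let f : Quotient (MulAction.orbitRel σ.group (Fin k → ℂ)) → Set.range (σ.toQuotient hS q) :=
      Quotient.lift (fun u => ⟨σ.toQuotient hS q u, u, rfl⟩) fun u v huv => by
        obtain ⟨γ, hγ⟩ := MulAction.orbitRel_apply.1 huv
        exact Subtype.ext ((toQuotient_eq_iff hS hq _ _).2 ⟨γ, hγ⟩).symm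
    have hinj : Function.Injective f := by
      intro a b
      refine Quotient.inductionOn₂ a b fun u v h => Quotient.sound ?_
      obtain ⟨γ, hγ⟩ := (toQuotient_eq_iff hS hq _ _).1 (congrArg Subtype.val h)
      exact Setoid.symm' _ (MulAction.orbitRel_apply.2 ⟨γ, hγ⟩)
    have hsurj : Function.Surjective f := by
      rintro ⟨_, u, rfl⟩
      exact ⟨Quotient.mk _ u, rfl⟩
    refine (Equiv.ofBijective f ⟨hinj, hsurj⟩).toHomeomorphOfContinuousOpen ?_ ?_
    · exact Continuous.quotient_lift ((continuous_toQuotient hS hq).subtype_mk _) _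
    · intro V hV
      have h1 := (isOpenMap_toQuotient hS hq) _ (hV.preimage continuous_quotient_mk')
      refine ⟨_, h1, ?_⟩
      ext ⟨_, u, rfl⟩
      constructor
      · rintro ⟨v, hv, h⟩
        exact ⟨Quotient.mk _ v, hv, Subtype.ext h⟩
      · rintro ⟨a, ha, h⟩
        induction a using Quotient.inductionOn with
        | h v => exact ⟨v, ha, congrArg Subtype.val h⟩

theorem q_mem_chart_domain_iff (z : S) : q z ∈ (σ.chart hS hq).domain ↔ z.1 ∈ σ.region := by
  change q z ∈ Set.range (σ.toQuotient hS q) ↔ _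
  rw [range_toQuotient hS hq]
  constructor
  · rintro ⟨w, hw, h⟩
    exact mem_region_of_eq hq h hw
  · exact fun h => ⟨z, h, rfl⟩

end Chart

end Slice

namespace Slice

variable {d k : ℕ} {A : Finset (Fin d)} {N : Submodule ℂ (Fin d → ℂ)}
  {H : AddSubgroup (Fin d → ℂ)} (σ τ : Slice k A N H)

/-! ### Compatibility of charts -/

/-- The two slices allow the same coordinates of `ℂ^d` to vanish. -/
def SameVanishing : Prop := ∀ j, (∃ i ∈ σ.K, σ.e i = j) ↔ ∃ i ∈ τ.K, τ.e i = j

/-- Forget the coordinates in `K`. -/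
def trunc (u : Fin k → ℂ) : Fin k → ℂ := fun i => if i ∈ σ.K then 0 else u i

theorem extend_trunc_of_exists {j : Fin d} (h : ∃ i ∈ σ.K, σ.e i = j) (u : Fin k → ℂ) :
    Function.extend σ.e (σ.trunc u) 0 j = 0 := by
  obtain ⟨i, hi, rfl⟩ := h
  rw [σ.e_injective.extend_apply]
  simp [trunc, hi]

theorem extend_trunc_of_not_exists {j : Fin d} (h : ¬ ∃ i ∈ σ.K, σ.e i = j) (u : Fin k → ℂ) :
    Function.extend σ.e (σ.trunc u) 0 j = Function.extend σ.e u 0 j := by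
  by_cases hr : ∃ i, σ.e i = j
  · obtain ⟨i, rfl⟩ := hr
    have hi : i ∉ σ.K := fun hi => h ⟨i, hi, rfl⟩
    rw [σ.e_injective.extend_apply, σ.e_injective.extend_apply]
    simp [trunc, hi]
  · rw [Function.extend_apply' _ _ _ hr, Function.extend_apply' _ _ _ hr]

theorem sect_of_not_exists_mem {j : Fin d} (hj : j ∉ A) (h : ¬ ∃ i ∈ σ.K, σ.e i = j)
    (u : Fin k → ℂ) : σ.sect u j = cexp (Function.extend σ.e u 0 j) := by
  by_cases hr : ∃ i, σ.e i = j
  · obtain ⟨i, rfl⟩ := hr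
    have hi : i ∉ σ.K := fun hi => h ⟨i, hi, rfl⟩
    rw [σ.sect_e_of_notMem hi, σ.e_injective.extend_apply]
  · rw [σ.sect_of_not_exists hr hj, Function.extend_apply' _ _ _ hr, Pi.zero_apply, cexp_zero]

/-- The linear part of the transition from `σ` to `τ`. -/
noncomputable def transLin (u : Fin k → ℂ) : Fin k → ℂ :=
  τ.B (Function.extend σ.e (σ.trunc u) 0)

/-- The transition from `σ` to `τ`. -/
noncomputable def trans (u : Fin k → ℂ) : Fin k → ℂ := fun i =>
  if i ∈ τ.K then cexp (σ.transLin τ u i) * Function.extend σ.e u 0 (τ.e i) else σ.transLin τ u i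

theorem contDiff_extend {n : WithTop ℕ∞} :
    ContDiff ℂ n fun u : Fin k → ℂ => Function.extend σ.e u (0 : Fin d → ℂ) := by
  rw [contDiff_pi]
  intro j
  by_cases hr : ∃ i, σ.e i = j
  · obtain ⟨i, rfl⟩ := hr
    simp only [σ.e_injective.extend_apply]
    exact contDiff_apply ℂ ℂ i
  · simp only [Function.extend_apply' _ _ _ hr]
    exact contDiff_const

theorem contDiff_trans {n : WithTop ℕ∞} : ContDiff ℂ n (σ.trans τ) := by
  have ht : ContDiff ℂ n σ.trunc := by
    rw [contDiff_pi]
    intro i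
    by_cases hi : i ∈ σ.K
    · simp only [trunc, hi, if_true]
      exact contDiff_const
    · simp only [trunc, hi, if_false]
      exact contDiff_apply ℂ ℂ i
  have hl : ContDiff ℂ n (σ.transLin τ) :=
    (LinearMap.toContinuousLinearMap τ.B).contDiff.comp (σ.contDiff_extend.comp ht)
  rw [contDiff_pi] at hl ⊢
  intro i
  by_cases hi : i ∈ τ.K
  · simp only [trans, hi, if_true]
    exact (contDiff_cexp.comp (hl i)).mul (contDiff_pi.1 σ.contDiff_extend (τ.e i))
  · simp only [trans, hi, if_false]
    exact hl i

variable {σ τ}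

/-- The logarithmic coordinates of one section are renormalized along the basis of the other. The
exponent is a difference of two vectors with the same image under `τ.B`, hence lies in `N`. -/
theorem sect_trans (h : σ.SameVanishing τ) (u : Fin k → ℂ) :
    ∃ Z ∈ N, ∀ j, τ.sect (σ.trans τ u) j = cexp (Z j) * σ.sect u j := by
  refine ⟨Function.extend τ.e (σ.transLin τ u) 0 - Function.extend σ.e (σ.trunc u) 0, ?_,
    fun j => ?_⟩
  · rw [← τ.B_eq_zero_iff, map_sub, τ.B_extend, transLin, sub_self]
  · by_cases hj : j ∈ A
    · rw [τ.sect_of_mem hj, σ.sect_of_mem hj, mul_zero]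
    rw [Pi.sub_apply]
    by_cases hK : ∃ i ∈ σ.K, σ.e i = j
    · rw [σ.extend_trunc_of_exists hK, sub_zero]
      obtain ⟨i', hi', rfl⟩ := (h j).1 hK
      obtain ⟨i, hi, he⟩ := hK
      rw [τ.sect_e_of_mem hi', τ.e_injective.extend_apply, trans, if_pos hi', ← he,
        σ.sect_e_of_mem hi, σ.e_injective.extend_apply]
    · have hK' : ¬ ∃ i ∈ τ.K, τ.e i = j := fun h' => hK ((h j).2 h')
      rw [σ.extend_trunc_of_not_exists hK, τ.sect_of_not_exists_mem hj hK',
        σ.sect_of_not_exists_mem hj hK, cexp_sub_mul,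
        ← τ.extend_trunc_of_not_exists hK' (σ.trans τ u),
        ← τ.extend_trunc_of_not_exists hK' (σ.transLin τ u)]
      congr 2
      funext i
      by_cases hi : i ∈ τ.K <;> simp [trunc, trans, hi]

theorem SameVanishing.symm (h : σ.SameVanishing τ) : τ.SameVanishing σ := fun j => (h j).symm

theorem trans_trans (h : σ.SameVanishing τ) (u : Fin k → ℂ) :
    τ.trans σ (σ.trans τ u) = u := by
  set c := σ.transLin τ u with hc
  -- `V` is the part of c on the coordinates that may vanish. As these indices are the same for both
  -- slices, `σ.B` merely reads off its entries.
  set V : Fin d → ℂ := Function.extend τ.e c 0 - Function.extend τ.e (τ.trunc c) 0 with hV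
  have hVK : ∀ i ∈ τ.K, V (τ.e i) = c i := fun i hi => by
    rw [hV, Pi.sub_apply, τ.extend_trunc_of_exists ⟨i, hi, rfl⟩, τ.e_injective.extend_apply,
      sub_zero]
  have hV0 : ∀ j, (¬ ∃ i ∈ τ.K, τ.e i = j) → V j = 0 := fun j hj => by
    rw [hV, Pi.sub_apply, τ.extend_trunc_of_not_exists hj, sub_self]
  have hVe : V = Function.extend σ.e (fun i => V (σ.e i)) 0 := by
    funext j
    by_cases hr : ∃ i, σ.e i = j
    · obtain ⟨i, rfl⟩ := hr
      rw [σ.e_injective.extend_apply]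
    · rw [Function.extend_apply' _ _ _ hr]
      refine hV0 j fun h' => hr ?_
      obtain ⟨i, -, hi⟩ := (h j).2 h'
      exact ⟨i, hi⟩
  have hBV : σ.B V = fun i => V (σ.e i) := by
    conv_lhs => rw [hVe, σ.B_extend]
  have ht : τ.trunc (σ.trans τ u) = τ.trunc c := by
    funext i
    by_cases hi : i ∈ τ.K <;> simp [trunc, trans, hi, hc]
  have hBc : σ.B (Function.extend τ.e c 0) = σ.trunc u := by
    have : σ.B (Function.extend τ.e c 0 - Function.extend σ.e (σ.trunc u) 0) = 0 := by
      rw [σ.B_eq_zero_iff, ← τ.B_eq_zero_iff, map_sub, τ.B_extend, hc, transLin, sub_self]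
    rwa [map_sub, σ.B_extend, sub_eq_zero] at this
  -- Going back, the linear part recovers the truncation of u up to -V, and this exponent cancels
  -- the factor that the first transition put on the coordinates in `K`.
  have hl : τ.transLin σ (σ.trans τ u) = fun i => σ.trunc u i - V (σ.e i) := by
    have : Function.extend τ.e (τ.trunc c) 0 = Function.extend τ.e c 0 - V := by
      rw [hV, sub_sub_cancel]
    rw [transLin, ht, this, map_sub, hBc, hBV]
    rfl
  funext i
  rw [trans, hl]
  beta_reduce
  by_cases hi : i ∈ σ.K
  · obtain ⟨i', hi', he⟩ := (h _).1 ⟨i, hi, rfl⟩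
    rw [if_pos hi, ← he, τ.e_injective.extend_apply, hVK i' hi', trans, if_pos hi', ← hc, he,
      σ.e_injective.extend_apply]
    simp only [trunc, hi, if_true, zero_sub]
    rw [← mul_assoc, cexp_neg_mul_self, one_mul]
  · have : V (σ.e i) = 0 := hV0 _ fun h' => hi <| by
      obtain ⟨i', hi', he⟩ := (h _).2 h'
      rwa [← σ.e_injective he]
    simp [trunc, hi, this]

/-- The transition as a biholomorphism. -/
noncomputable def transDiffeomorph (h : σ.SameVanishing τ) :
    Diffeomorph 𝓘(ℂ, Fin k → ℂ) 𝓘(ℂ, Fin k → ℂ) (Fin k → ℂ) (Fin k → ℂ) ω where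
  toFun := σ.trans τ
  invFun := τ.trans σ
  left_inv := trans_trans h
  right_inv := trans_trans h.symm
  contMDiff_toFun := (σ.contDiff_trans τ).contMDiff
  contMDiff_invFun := (τ.contDiff_trans σ).contMDiff

variable (σ τ)

/-- The coordinates in `K` whose image is allowed to vanish for `τ`. -/
noncomputable def commonK : Finset (Fin k) :=
  haveI := Classical.decPred fun i => ∃ i' ∈ τ.K, τ.e i' = σ.e i
  σ.K.filter fun i => ∃ i' ∈ τ.K, τ.e i' = σ.e i

theorem mem_commonK {i : Fin k} :
    i ∈ σ.commonK τ ↔ i ∈ σ.K ∧ ∃ i' ∈ τ.K, τ.e i' = σ.e i := by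
  simp [commonK]

/-- The slice `σ` with the coordinates that are allowed to vanish for `τ` as well. -/
noncomputable def restrict : Slice k A N H := { σ with K := σ.commonK τ }

theorem sameVanishing_restrict : (σ.restrict τ).SameVanishing (τ.restrict σ) := by
  intro j
  change (∃ i ∈ σ.commonK τ, σ.e i = j) ↔ ∃ i ∈ τ.commonK σ, τ.e i = j
  constructor
  · rintro ⟨i, hi, rfl⟩
    obtain ⟨h1, i', hi', he⟩ := (mem_commonK _ _).1 hi
    exact ⟨i', (mem_commonK _ _).2 ⟨hi', i, h1, he.symm⟩, he⟩
  · rintro ⟨i, hi, rfl⟩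
    obtain ⟨h1, i', hi', he⟩ := (mem_commonK _ _).1 hi
    exact ⟨i', (mem_commonK _ _).2 ⟨hi', i, h1, he.symm⟩, he⟩

/-- Over the overlap, the coordinates in `K` that cannot vanish for `τ` become logarithmic like the
rest. After this covering `σ` may be replaced by `σ.restrict τ`, which has the same vanishing
coordinates as `τ.restrict σ`. -/
theorem sect_partialExp (u : Fin k → ℂ) :
    σ.sect (partialExp (σ.K \ σ.commonK τ) u) = (σ.restrict τ).sect u := by
  have : partialExp σ.Kᶜ (partialExp (σ.K \ σ.commonK τ) u) = partialExp (σ.commonK τ)ᶜ u := by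
    funext i
    by_cases hi : i ∈ σ.K
    · by_cases hi' : i ∈ σ.commonK τ <;> simp [partialExp, hi, hi']
    · have hi' : i ∉ σ.commonK τ := fun h => hi ((mem_commonK _ _).1 h).1
      simp [partialExp, hi, hi']
  rw [sect, this]
  rfl

theorem sect_mem_region_iff (u : Fin k → ℂ) :
    σ.sect u ∈ τ.region ↔ ∀ i ∈ σ.K \ σ.commonK τ, u i ≠ 0 := by
  constructor
  · rintro h i hi h0
    rw [Finset.mem_sdiff, mem_commonK] at hi
    refine hi.2 ⟨hi.1, h.2 _ (σ.e_notMem i) ?_⟩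
    rw [σ.sect_e_of_mem hi.1, h0]
  · intro h
    refine ⟨fun j hj => σ.sect_of_mem hj u, fun j hj h0 => ?_⟩
    obtain ⟨i, hi, rfl⟩ := (σ.sect_mem_region u).2 j hj h0
    rw [σ.sect_e_of_mem hi] at h0
    by_contra hne
    refine h i ?_ h0
    rw [Finset.mem_sdiff, mem_commonK]
    exact ⟨hi, fun h' => hne h'.2⟩

/-- The common covering is ℂ^k itself. It covers one preimage by a partial exponential, and the
other by the transition between the restricted slices followed by a partial exponential. -/
theorem chart_compatible {S : Set (Fin d → ℂ)} {Y : Type} [TopologicalSpace Y] {q : S → Y}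
    (hq : IsTorusQuotient A H q) (hσ : σ.region ⊆ S) (hτ : τ.region ⊆ S) :
    (σ.chart hσ hq).Compatible (τ.chart hτ hq) := by
  intro x y hxy
  -- The preimage of the overlap is the complement of coordinate hyperplanes. It is connected, so
  -- the component of each of its points is all of it.
  have key : ∀ (σ τ : Slice k A N H) (hσ : σ.region ⊆ S) (hτ : τ.region ⊆ S)
      (x : Fin k → ℂ), (σ.chart hσ hq).proj x ∈ (τ.chart hτ hq).domain →
      connectedComponentIn
        {x' : Fin k → ℂ | (σ.chart hσ hq).proj x' ∈ (τ.chart hτ hq).domain} x =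
        {v | ∀ i ∈ σ.K \ σ.commonK τ, v i ≠ 0} := by
    intro σ τ hσ hτ x hx
    have h1 : {x' : Fin k → ℂ | (σ.chart hσ hq).proj x' ∈ (τ.chart hτ hq).domain} =
        {v | ∀ i ∈ σ.K \ σ.commonK τ, v i ≠ 0} := by
      ext v
      exact (τ.q_mem_chart_domain_iff hτ hq _).trans (σ.sect_mem_region_iff τ v)
    have hx' : x ∈ {v : Fin k → ℂ | ∀ i ∈ σ.K \ σ.commonK τ, v i ≠ 0} := h1 ▸ hx
    rw [h1]
    exact (isPreconnected_ne_zero _).connectedComponentIn hx'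
  have hx : (σ.chart hσ hq).proj x ∈ (τ.chart hτ hq).domain := by
    rw [hxy]
    exact ((τ.chart hτ hq).homeo _).2
  have hy : (τ.chart hτ hq).proj y ∈ (σ.chart hσ hq).domain := by
    rw [← hxy]
    exact ((σ.chart hσ hq).homeo _).2
  have hsv := σ.sameVanishing_restrict τ
  set φ : (Fin k → ℂ) → Fin k → ℂ := partialExp (τ.K \ τ.commonK σ) ∘ transDiffeomorph hsv with hφ
  have hφ1 : IsLocalDiffeomorph 𝓘(ℂ, Fin k → ℂ) 𝓘(ℂ, Fin k → ℂ) ω φ := fun u =>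
    IsLocalDiffeomorphAt.comp (hf := (transDiffeomorph hsv).isLocalDiffeomorph u)
      (hg := isLocalDiffeomorph_partialExp _ _)
  have hφ2 : Set.range φ = {v | ∀ i ∈ τ.K \ τ.commonK σ, v i ≠ 0} := by
    have hs : Function.Surjective (transDiffeomorph hsv) := (transDiffeomorph hsv).surjective
    rw [hφ, hs.range_comp, range_partialExp]
  have hφ3 : IsCoveringMapOn φ {v | ∀ i ∈ τ.K \ τ.commonK σ, v i ≠ 0} :=
    (isCoveringMapOn_partialExp _).comp_homeomorph (transDiffeomorph hsv).toHomeomorph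
  have hφ4 : ∀ u : Fin k → ℂ, ∃ Z ∈ N, ∀ j, τ.sect (φ u) j =
      cexp (Z j) * σ.sect (partialExp (σ.K \ σ.commonK τ) u) j := by
    intro u
    obtain ⟨Z, hZ, h⟩ := sect_trans hsv u
    refine ⟨Z, hZ, fun j => ?_⟩
    rw [hφ, Function.comp_apply, τ.sect_partialExp, σ.sect_partialExp]
    exact h j
  refine ⟨σ.model.toComplexMfd, partialExp (σ.K \ σ.commonK τ),
    φ, σ.model.conn, ?_, ?_, fun u => ?_⟩
  · refine ⟨isLocalDiffeomorph_partialExp _, ?_, ?_⟩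
    · exact (range_partialExp _).trans (key σ τ hσ hτ x hx).symm
    · refine (congrArg (IsCoveringMapOn _) (key σ τ hσ hτ x hx)).mpr ?_
      exact isCoveringMapOn_partialExp _
  · refine ⟨hφ1, hφ2.trans (key τ σ hτ hσ y hy).symm, ?_⟩
    exact (congrArg (IsCoveringMapOn _) (key τ σ hτ hσ y hy)).mpr hφ3
  · obtain ⟨Z, hZ, h⟩ := hφ4 u
    exact (hq.eq_iff _ _).2 ⟨Z, σ.ker_le Z hZ, h⟩

end Slice

/-! ### Gluing slices into a quasifold. -/

/-- A family of slices whose regions cover `S` gives a quasifold structure on the quotient, and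
it is induced from `S`. -/
theorem exists_complexQuasifold_of_slices {d k : ℕ} {A : Finset (Fin d)}
    {N : Submodule ℂ (Fin d → ℂ)} {H : AddSubgroup (Fin d → ℂ)} {S : Set (Fin d → ℂ)}
    {Y : Type} [TopologicalSpace Y] {q : S → Y} (hq : IsTorusQuotient A H q)
    (hsurj : Function.Surjective q) {ι : Type} (σ : ι → Slice k A N H)
    (hσ : ∀ i, (σ i).region ⊆ S) (hcov : ∀ z ∈ S, ∃ i, z ∈ (σ i).region) :
    ∃ C : ComplexQuasifold k Y, C.IsInducedBy S q := by
  refine ⟨⟨ι, fun i => (σ i).chart (hσ i) hq, fun y => ?_,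
    fun i j => (σ i).chart_compatible (σ j) hq (hσ i) (hσ j)⟩, ?_, ?_⟩
  · obtain ⟨z, rfl⟩ := hsurj y
    obtain ⟨i, hi⟩ := hcov z z.2
    exact ⟨i, ((σ i).q_mem_chart_domain_iff (hσ i) hq z).2 hi⟩
  · intro i z x hx
    have hz : z.1 ∈ (σ i).region := by
      refine ((σ i).q_mem_chart_domain_iff (hσ i) hq z).1 ?_
      rw [← hx]
      exact (((σ i).chart (hσ i) hq).homeo _).2
    obtain ⟨O, hO, g, hg, hgz, h⟩ := Slice.exists_lift (hσ i) hq z x hx hz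
    exact ⟨O, hO, g, mdifferentiableOn_iff_differentiableOn.2 hg, hgz, h⟩
  · intro i
    refine ⟨fun u => ⟨(σ i).sect u, hσ i ((σ i).sect_mem_region u)⟩, ?_, fun u => rfl⟩
    exact mdifferentiable_iff_differentiable.2
      (((σ i).contDiff_sect (n := 1)).differentiable (by simp))

/-! ## Faces of polytopes -/

section Faces

variable {𝔡 : Type*} [AddCommGroup 𝔡] [Module ℝ 𝔡] {d : ℕ} {X : Fin d → 𝔡} {lam : Fin d → ℝ}

theorem mem_openFace_iff {I : Finset (Fin d)} {μ : Module.Dual ℝ 𝔡} :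
    μ ∈ openFace X lam I ↔ (∀ j ∈ I, μ (X j) = lam j) ∧ ∀ j ∉ I, lam j < μ (X j) := by
  constructor
  · rintro ⟨h1, h2⟩
    exact ⟨fun j hj => (h2 j).2 hj, fun j hj =>
      lt_of_le_of_ne (h1 j) fun h => hj ((h2 j).1 h.symm)⟩
  · rintro ⟨h1, h2⟩
    refine ⟨fun j => ?_, fun j => ⟨fun h => ?_, h1 j⟩⟩
    · by_cases hj : j ∈ I
      · exact (h1 j hj).ge
      · exact (h2 j hj).le
    · by_contra hj
      exact (h2 j hj).ne' h

theorem Face.ext {F G : Face X lam} (h : F.idx = G.idx) : F = G := Subtype.ext h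

instance : Finite (Face X lam) := inferInstanceAs (Finite (Subtype _))

/-- Every point of the polyhedron lies in an open face. -/
theorem exists_face_of_mem {μ : Module.Dual ℝ 𝔡} (hμ : μ ∈ polyhedron X lam) :
    ∃ F : Face X lam, μ ∈ F.points := by
  classical
  exact ⟨⟨Finset.univ.filter fun j => μ (X j) = lam j, μ, hμ, by simp⟩, hμ, by simp [Face.idx]⟩

theorem lineMap_mem_openFace {I J : Finset (Fin d)} {μ ν : Module.Dual ℝ 𝔡}
    (hμ : μ ∈ openFace X lam I) (hν : ν ∈ openFace X lam J) {t : ℝ} (h0 : 0 < t) (h1 : t < 1) :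
    (1 - t) • μ + t • ν ∈ openFace X lam (I ∩ J) := by
  rw [mem_openFace_iff] at *
  have key : ∀ j, ((1 - t) • μ + t • ν) (X j) = (1 - t) * μ (X j) + t * ν (X j) := fun j => by
    simp
  have hle : ∀ j, lam j ≤ μ (X j) := fun j => by
    by_cases hj : j ∈ I
    · exact (hμ.1 j hj).ge
    · exact (hμ.2 j hj).le
  have hle' : ∀ j, lam j ≤ ν (X j) := fun j => by
    by_cases hj : j ∈ J
    · exact (hν.1 j hj).ge
    · exact (hν.2 j hj).le
  refine ⟨fun j hj => ?_, fun j hj => ?_⟩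
  · rw [key, hμ.1 j (Finset.mem_inter.1 hj).1, hν.1 j (Finset.mem_inter.1 hj).2]
    ring
  · rw [key]
    by_cases hI : j ∈ I
    · have hJ : j ∉ J := fun h => hj (Finset.mem_inter.2 ⟨hI, h⟩)
      nlinarith [hle j, hν.2 j hJ]
    · nlinarith [hle' j, hμ.2 j hI]

/-- The index sets of faces are closed under intersection. -/
theorem exists_face_inter (F G : Face X lam) : ∃ E : Face X lam, E.idx = F.idx ∩ G.idx := by
  obtain ⟨μ, hμ⟩ := F.2
  obtain ⟨ν, hν⟩ := G.2
  exact ⟨⟨_, _, lineMap_mem_openFace hμ hν (t := 1 / 2) (by norm_num) (by norm_num)⟩, rfl⟩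

/-- Among the faces whose index set contains `J` there is one with the smallest index set. -/
theorem exists_minimal_face {J : Finset (Fin d)} (h : ∃ F : Face X lam, J ⊆ F.idx) :
    ∃ F : Face X lam, J ⊆ F.idx ∧ ∀ G : Face X lam, J ⊆ G.idx → F.idx ⊆ G.idx := by
  obtain ⟨F₀, hF₀⟩ := h
  obtain ⟨F, hF, hmin⟩ := (Set.toFinite {F : Face X lam | J ⊆ F.idx}).exists_minimalFor
    (fun F => F.idx.card) _ ⟨F₀, hF₀⟩
  refine ⟨F, hF, fun G hG => ?_⟩
  obtain ⟨E, hE⟩ := exists_face_inter F G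
  have h1 : J ⊆ E.idx := by
    rw [hE]
    exact Finset.subset_inter hF hG
  have h2 : F.idx ∩ G.idx = F.idx := Finset.eq_of_subset_of_card_le Finset.inter_subset_left (by
    rw [← hE]
    refine hmin h1 ?_
    simp only [hE]
    exact Finset.card_le_card Finset.inter_subset_left)
  exact Finset.inter_eq_left.1 h2

theorem exists_pos_forall_lt {I : Finset (Fin d)} {μ : Module.Dual ℝ 𝔡}
    (hμ : μ ∈ openFace X lam I) (ν : Module.Dual ℝ 𝔡) :
    ∃ ε > (0 : ℝ), ∀ j ∉ I, lam j < (μ + ε • ν) (X j) := by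
  rw [mem_openFace_iff] at hμ
  have h : ∀ j ∉ I, ∀ᶠ ε : ℝ in 𝓝[>] 0, lam j < (μ + ε • ν) (X j) := by
    intro j hj
    have hc : Continuous fun ε : ℝ => (μ + ε • ν) (X j) := by
      simp only [LinearMap.add_apply, LinearMap.smul_apply, smul_eq_mul]
      fun_prop
    have := (hc.tendsto 0).eventually_const_lt (u := lam j) (by simpa using hμ.2 j hj)
    exact this.filter_mono nhdsWithin_le_nhds
  have h' : ∀ᶠ ε : ℝ in 𝓝[>] 0, ∀ j, j ∉ I → lam j < (μ + ε • ν) (X j) := by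
    rw [Filter.eventually_all]
    intro j
    by_cases hj : j ∈ I
    · exact Filter.Eventually.of_forall fun ε h => absurd hj h
    · filter_upwards [h j hj] with ε hε _ using hε
  obtain ⟨ε, h1, h2⟩ := (h'.and self_mem_nhdsWithin).exists
  exact ⟨ε, h2, h1⟩

/-- The directions of a face are the linear forms that vanish on its normals. -/
theorem vectorSpan_face (F : Face X lam) : vectorSpan ℝ F.points =
    (Submodule.span ℝ (X '' (F.idx : Set (Fin d)))).dualAnnihilator := by
  refine le_antisymm ?_ fun ν hν => ?_
  · rw [vectorSpan_def, Submodule.span_le]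
    rintro _ ⟨μ, hμ, ν, hν, rfl⟩
    have hμ' := mem_openFace_iff.1 hμ
    have hν' := mem_openFace_iff.1 hν
    rw [SetLike.mem_coe, Submodule.mem_dualAnnihilator]
    intro w hw
    refine Submodule.span_induction (p := fun w _ => (μ -ᵥ ν) w = 0) ?_ (map_zero _) ?_ ?_ hw
    · rintro _ ⟨j, hj, rfl⟩
      simp [vsub_eq_sub, hμ'.1 j hj, hν'.1 j hj]
    · intro x y _ _ hx hy
      rw [map_add, hx, hy, add_zero]
    · intro a x _ hx
      rw [map_smul, hx, smul_zero]
  · obtain ⟨μ, hμ⟩ := F.2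
    obtain ⟨ε, hε, h⟩ := exists_pos_forall_lt hμ ν
    rw [Submodule.mem_dualAnnihilator] at hν
    have h2 : μ + ε • ν ∈ F.points := by
      refine mem_openFace_iff.2 ⟨fun j hj => ?_, h⟩
      rw [LinearMap.add_apply, (mem_openFace_iff.1 hμ).1 j hj, LinearMap.smul_apply,
        hν _ (Submodule.subset_span ⟨j, hj, rfl⟩), smul_zero, add_zero]
    have h3 := vsub_mem_vectorSpan ℝ h2 hμ
    rw [vsub_eq_sub, add_sub_cancel_left] at h3
    exact (Submodule.smul_mem_iff _ hε.ne').1 h3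

theorem face_dim_add [FiniteDimensional ℝ 𝔡] (F : Face X lam) :
    Module.finrank ℝ (Submodule.span ℝ (X '' (F.idx : Set (Fin d)))) + F.dim =
      Module.finrank ℝ 𝔡 := by
  rw [Face.dim, vectorSpan_face]
  exact Subspace.finrank_add_finrank_dualAnnihilator_eq _

/-- The codimension of a face is the dimension of the span of its normals (`face_dim_add`), so
regularity says that there are no more normals than this dimension. -/
theorem face_isRegular_iff [FiniteDimensional ℝ 𝔡] (F : Face X lam) :
    F.IsRegular ↔ LinearIndepOn ℝ X (F.idx : Set (Fin d)) := by
  have h := face_dim_add F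
  rw [LinearIndepOn, linearIndependent_iff_card_eq_finrank_span, Face.IsRegular, Set.finrank]
  simp only [Fintype.card_coe, Finset.coe_sort_coe]
  have hr : Set.range (fun x : F.idx => X x) = X '' (F.idx : Set (Fin d)) := by
    rw [Set.image_eq_range]
    rfl
  have := congrArg (fun s => Module.finrank ℝ (Submodule.span ℝ s)) hr
  omega

theorem face_isSingular_iff [FiniteDimensional ℝ 𝔡] (F : Face X lam) :
    F.IsSingular ↔ ¬ F.IsRegular := by
  have h := face_dim_add F
  have h1 : Module.finrank ℝ (Submodule.span ℝ (X '' (F.idx : Set (Fin d)))) ≤ F.idx.card := by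
    classical
    rw [← Finset.coe_image]
    exact (finrank_span_finset_le_card _).trans Finset.card_image_le
  rw [Face.IsSingular, Face.IsRegular]
  omega

theorem Face.IsRegular.mono [FiniteDimensional ℝ 𝔡] {F G : Face X lam} (hF : F.IsRegular)
    (h : G.idx ⊆ F.idx) : G.IsRegular := by
  rw [face_isRegular_iff] at *
  exact hF.mono (by exact_mod_cast h)

/-- The order of the faces is the reverse inclusion of index sets. -/
theorem face_le_iff {F G : Face X lam} : F ≤ G ↔ G.idx ⊆ F.idx := by
  refine ⟨Face.idx_subset, fun h μ hμ => ?_⟩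
  -- The open segment from μ to a point ν of G lies in G, since I_F ∩ I_G = I_G; let t tend to 0.
  obtain ⟨ν, hν⟩ := G.2
  have hmem : ∀ᶠ t : ℝ in 𝓝[>] 0, (fun v => ((1 - t) • μ + t • ν : Module.Dual ℝ 𝔡) v) ∈
      (fun ν : Module.Dual ℝ 𝔡 => (ν : 𝔡 → ℝ)) '' G.points := by
    filter_upwards [Ioo_mem_nhdsGT one_pos] with t ht
    refine ⟨_, ?_, rfl⟩
    have := lineMap_mem_openFace hμ hν ht.1 ht.2
    rwa [show F.idx ∩ G.1 = G.idx from Finset.inter_eq_right.2 h] at this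
  have ht : Filter.Tendsto (fun t : ℝ => fun v => ((1 - t) • μ + t • ν : Module.Dual ℝ 𝔡) v)
      (𝓝[>] 0) (𝓝 (μ : 𝔡 → ℝ)) := by
    have hc : Continuous fun t : ℝ => fun v => ((1 - t) • μ + t • ν : Module.Dual ℝ 𝔡) v := by
      refine continuous_pi fun v => ?_
      simp only [LinearMap.add_apply, LinearMap.smul_apply, smul_eq_mul]
      fun_prop
    have := hc.tendsto 0
    simp only [sub_zero, one_smul, zero_smul, add_zero] at this
    exact this.mono_left nhdsWithin_le_nhds
  exact mem_closure_of_tendsto ht hmem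

theorem polyhedron_nonempty (hΔ : IsPolytopeWithNormals X lam) :
    (polyhedron X lam).Nonempty := by
  rw [Set.nonempty_iff_ne_empty]
  intro h
  have := hΔ.full
  rw [h, AffineSubspace.span_empty] at this
  exact AffineSubspace.bot_ne_top ℝ _ _ this

/-- A polytope has no lineality: its normals span. -/
theorem span_normals (hΔ : IsPolytopeWithNormals X lam) :
    Submodule.span ℝ (Set.range X) = ⊤ := by
  by_contra hne
  obtain ⟨ν, hν0, hν⟩ := Submodule.exists_le_ker_of_lt_top _ (lt_top_iff_ne_top.2 hne)
  have hνX : ∀ j, ν (X j) = 0 := fun j => hν (Submodule.subset_span ⟨j, rfl⟩)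
  obtain ⟨v, hv⟩ : ∃ v, ν v ≠ 0 := by
    by_contra! h
    exact hν0 (LinearMap.ext h)
  obtain ⟨μ, hμ⟩ := polyhedron_nonempty hΔ
  obtain ⟨s, hs, hP⟩ := hΔ.polytope
  let ev : Module.Dual ℝ 𝔡 →ₗ[ℝ] ℝ := LinearMap.applyₗ v
  have hb : Bornology.IsBounded (ev '' polyhedron X lam) := by
    rw [hP, LinearMap.image_convexHull, isBounded_convexHull]
    exact (hs.image _).isBounded
  obtain ⟨C, hC⟩ := hb.bddAbove
  -- A form that kills all normals can be added freely. The multiple is chosen to give the value C +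
  -- 1 at v, above the bound C.
  have hmem : μ + ((C + 1 - μ v) / ν v) • ν ∈ polyhedron X lam := fun j => by
    simpa [hνX j] using hμ j
  have := hC ⟨_, hmem, rfl⟩
  simp only [ev, LinearMap.applyₗ_apply_apply, LinearMap.add_apply, LinearMap.smul_apply,
    smul_eq_mul, div_mul_cancel₀ _ hv] at this
  linarith

/-- Otherwise the facet would be the whole polytope, which has full dimension instead of codimension
one. -/
theorem exists_lt_of_facet [FiniteDimensional ℝ 𝔡] (hΔ : IsPolytopeWithNormals X lam)
    (j : Fin d) : ∃ μ ∈ polyhedron X lam, lam j < μ (X j) := by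
  by_contra! h
  have heq : facet X lam j = polyhedron X lam := by
    ext μ
    exact ⟨fun h => h.1, fun hμ => ⟨hμ, le_antisymm (h μ hμ) (hμ j)⟩⟩
  have h1 := hΔ.facet_dim j
  rw [heq, ← direction_affineSpan, hΔ.full, AffineSubspace.direction_top, finrank_top,
    Subspace.dual_finrank_eq] at h1
  omega

/-- The interior of the polytope is a face. -/
theorem exists_face_idx_empty [FiniteDimensional ℝ 𝔡] (hΔ : IsPolytopeWithNormals X lam) :
    ∃ F : Face X lam, F.idx = ∅ := by
  obtain ⟨μ, hμ⟩ := polyhedron_nonempty hΔ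
  obtain ⟨F₀, -⟩ := exists_face_of_mem hμ
  obtain ⟨F, -, hF⟩ := exists_minimal_face (J := ∅) ⟨F₀, Finset.empty_subset _⟩
  refine ⟨F, Finset.eq_empty_of_forall_notMem fun j hj => ?_⟩
  obtain ⟨ν, hν, hlt⟩ := exists_lt_of_facet hΔ j
  obtain ⟨G, hG⟩ := exists_face_of_mem hν
  exact hlt.ne' ((mem_openFace_iff.1 hG).1 j (hF G (Finset.empty_subset _) hj))

/-- A linear relation with prescribed positive coefficients exists, or else a linear form
separates. -/
theorem exists_pos_relation_or_form {ι E : Type*} [Fintype ι] [AddCommGroup E] [Module ℝ E]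
    (Y : ι → E) (P : Set ι) :
    (∃ y : ι → ℝ, (∀ j ∈ P, 0 < y j) ∧ ∑ j, y j • Y j = 0) ∨
      ∃ ν : Module.Dual ℝ E, (∀ j ∈ P, 0 ≤ ν (Y j)) ∧ (∀ j ∉ P, ν (Y j) = 0) ∧
        ∃ j ∈ P, 0 < ν (Y j) := by
  classical
  let L : (ι → ℝ) →ₗ[ℝ] E := Fintype.linearCombination ℝ Y
  let O : Set (ι → ℝ) := {y | ∀ j ∈ P, 0 < y j}
  -- Either the kernel of `L` meets the open convex set of vectors positive on `P`, or Hahn–Banach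
  -- separates the two.
  by_cases hd : Disjoint O (LinearMap.ker L : Set (ι → ℝ))
  · right
    have hO : IsOpen O := by
      have : O = ⋂ j ∈ P, {y | 0 < y j} := by
        ext y
        simp [O]
      rw [this]
      exact (Set.toFinite P).isOpen_biInter fun j _ =>
        isOpen_lt continuous_const (continuous_apply j)
    have hOc : Convex ℝ O := by
      intro x hx y hy a b ha hb hab j hj
      have h1 := hx j hj
      have h2 := hy j hj
      simp only [Pi.add_apply, Pi.smul_apply, smul_eq_mul]
      rcases ha.eq_or_lt with rfl | ha
      · have : b = 1 := by linarith
        subst this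
        simpa using h2
      · nlinarith [mul_pos ha h1, mul_nonneg hb h2.le]
    obtain ⟨f, u, hf1, hf2⟩ := geometric_hahn_banach_open hOc hO
      (LinearMap.ker L).convex hd
    have hu : u ≤ 0 := by simpa using hf2 0 (LinearMap.ker L).zero_mem
    -- A functional bounded below on a subspace vanishes there, so f factors through `L` and comes
    -- from a form ν on E.
    have hker : ∀ x ∈ LinearMap.ker L, f x = 0 := by
      intro x hx
      by_contra hne
      have h1 := hf2 (((u - 1) / f x) • x) ((LinearMap.ker L).smul_mem _ hx)
      rw [map_smul, smul_eq_mul, div_mul_cancel₀ _ hne] at h1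
      linarith
    have hr : (f : (ι → ℝ) →ₗ[ℝ] ℝ) ∈ LinearMap.range L.dualMap := by
      rw [LinearMap.range_dualMap_eq_dualAnnihilator_ker, Submodule.mem_dualAnnihilator]
      exact hker
    obtain ⟨ν, hν⟩ := hr
    have hνf : ∀ y, ν (L y) = f y := fun y => LinearMap.congr_fun hν y
    have hsum : ∀ y, ν (L y) = ∑ j, y j * ν (Y j) := fun y => by
      simp [L, Fintype.linearCombination_apply]
    have hYj : ∀ (y : ι → ℝ) (j : ι) (t : ℝ),
        ν (L (y + t • Pi.single j 1)) = ν (L y) + t * ν (Y j) := fun y j t => by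
      rw [map_add, map_smul, map_add, map_smul]
      simp [L]
    have h1 : ∀ j ∈ P, ν (Y j) ≤ 0 := by
      intro j hj
      by_contra! hpos
      -- Increasing a coordinate never leaves O. With ν(Y_j) > 0 this step would make f nonnegative
      -- at a point of O, where f < 0.
      have hm : (1 : ι → ℝ) + ((-ν (L 1) / ν (Y j)) ⊔ 0) • Pi.single j 1 ∈ O := by
        intro l hl
        have : (0 : ℝ) ≤ ((-ν (L 1) / ν (Y j)) ⊔ 0) * (Pi.single j 1 : ι → ℝ) l :=
          mul_nonneg le_sup_right (by by_cases h : l = j <;> simp [h])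
        simp only [Pi.add_apply, Pi.one_apply, Pi.smul_apply, smul_eq_mul]
        linarith
      have h2 := (hf1 _ hm).trans_le hu
      rw [← hνf, hYj] at h2
      have h3 : -ν (L 1) / ν (Y j) * ν (Y j) ≤ ((-ν (L 1) / ν (Y j)) ⊔ 0) * ν (Y j) :=
        mul_le_mul_of_nonneg_right le_sup_left hpos.le
      rw [div_mul_cancel₀ _ hpos.ne'] at h3
      linarith
    have h2 : ∀ j ∉ P, ν (Y j) = 0 := by
      intro j hj
      by_contra hne
      -- Coordinates outside P are unconstrained in O, so a step of either sign is allowed and f can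
      -- be made zero.
      have hm : (1 : ι → ℝ) + (-ν (L 1) / ν (Y j)) • Pi.single j 1 ∈ O := by
        intro l hl
        have : l ≠ j := fun h => hj (h ▸ hl)
        simp [this]
      have h2 := (hf1 _ hm).trans_le hu
      rw [← hνf, hYj, div_mul_cancel₀ _ hne] at h2
      linarith
    have h3 : ν (L 1) < 0 := by
      rw [hνf]
      exact (hf1 1 fun j _ => one_pos).trans_le hu
    refine ⟨-ν, fun j hj => by simpa using h1 j hj, fun j hj => by simpa using h2 j hj, ?_⟩
    by_contra! hcon
    refine h3.not_ge ?_
    rw [hsum]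
    refine Finset.sum_nonneg fun j _ => ?_
    by_cases hj : j ∈ P
    · have := hcon j hj
      simp only [LinearMap.neg_apply, Left.neg_nonpos_iff] at this
      simpa using this
    · simp [h2 j hj]
  · left
    obtain ⟨y, hy, hk⟩ := Set.not_disjoint_iff.1 hd
    exact ⟨y, hy, hk⟩

/-- If `F` is the smallest face whose index set contains `J`, there is a linear relation between
the normals of `F` with positive coefficients outside of `J`. -/
theorem exists_relation_of_minimal {J : Finset (Fin d)} {F : Face X lam} (hJ : J ⊆ F.idx)
    (hmin : ∀ G : Face X lam, J ⊆ G.idx → F.idx ⊆ G.idx) :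
    ∃ y : Fin d → ℝ, (∀ j ∈ F.idx, j ∉ J → 0 < y j) ∧ (∀ j ∉ F.idx, y j = 0) ∧
      ∑ j, y j • X j = 0 := by
  classical
  -- Replacing the normals outside F by zero confines the relation to F. On J its coefficients may
  -- have any sign.
  rcases exists_pos_relation_or_form (fun j => if j ∈ F.idx then X j else 0)
    {j | j ∈ F.idx ∧ j ∉ J} with ⟨y, hy, hs⟩ | ⟨ν, h1, h2, j₀, hj₀, hpos⟩
  · refine ⟨fun j => if j ∈ F.idx then y j else 0, fun j hj hj' => ?_, fun j hj => by simp [hj], ?_⟩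
    · simpa [hj] using hy j ⟨hj, hj'⟩
    · rw [← hs]
      refine Finset.sum_congr rfl fun j _ => ?_
      by_cases hj : j ∈ F.idx <;> simp [hj]
  · exfalso
    have h1' : ∀ j ∈ F.idx, 0 ≤ ν (X j) := by
      intro j hj
      by_cases hj' : j ∈ J
      · have := h2 j fun h => h.2 hj'
        simp only [hj, if_true] at this
        exact this.ge
      · simpa [hj] using h1 j ⟨hj, hj'⟩
    have hJ0 : ∀ j ∈ J, ν (X j) = 0 := fun j hj => by
      have := h2 j fun h => h.2 hj
      simpa only [hJ hj, if_true] using this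
    simp only [hj₀.1, if_true] at hpos
    -- Moving slightly from a point of F along ν stays in the polyhedron and on all facets in J, but
    -- leaves facet j₀. The face reached contains J and not j₀, against minimality.
    obtain ⟨μ, hμ⟩ := F.2
    obtain ⟨ε, hε, hlt⟩ := exists_pos_forall_lt hμ ν
    have hμ' := mem_openFace_iff.1 hμ
    have happ : ∀ j, (μ + ε • ν) (X j) = μ (X j) + ε * ν (X j) := fun j => by simp
    have hP : μ + ε • ν ∈ polyhedron X lam := by
      intro j
      by_cases hj : j ∈ F.idx
      · rw [happ, hμ'.1 j hj]
        have := mul_nonneg hε.le (h1' j hj)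
        linarith
      · exact (hlt j hj).le
    obtain ⟨G, hG⟩ := exists_face_of_mem hP
    have hJG : J ⊆ G.idx := fun j hj => by
      refine (hG.2 j).1 ?_
      rw [happ, hJ0 j hj, mul_zero, add_zero, hμ'.1 j (hJ hj)]
    have h3 := (mem_openFace_iff.1 hG).1 j₀ (hmin G hJG hj₀.1)
    rw [happ, hμ'.1 j₀ hj₀.1] at h3
    have := mul_pos hε hpos
    linarith

end Faces

/-! ## Orbit closures -/

section OrbitClosures

variable {𝔡 : Type*} [AddCommGroup 𝔡] [Module ℝ 𝔡] {d : ℕ} {X : Fin d → 𝔡} {lam : Fin d → ℝ}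
  {Q : Submodule ℤ 𝔡}

theorem mem_groupA_iff {a : Fin d → ℂˣ} : a ∈ groupA X ↔
    ∃ y : Fin d → ℝ, projR X y = 0 ∧ ∀ j, (a j : ℂ) = Real.exp (-(2 * Real.pi * y j)) := by
  have key : ∀ t : ℝ, Complex.exp (2 * Real.pi * Complex.I * (t * Complex.I)) =
      Real.exp (-(2 * Real.pi * t)) := fun t => by
    push_cast
    congr 1
    linear_combination (2 * Real.pi * t : ℂ) * Complex.I_mul_I
  constructor
  · rintro ⟨Z, ⟨⟨-, h2⟩, h3⟩, rfl⟩
    refine ⟨fun j => (Z j).im, h2, fun j => ?_⟩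
    have : Z j = (Z j).im * Complex.I := by
      apply Complex.ext <;> simp
      exact h3 j
    rw [← key, ← this]
    rfl
  · rintro ⟨y, hy, h⟩
    refine ⟨fun j => y j * Complex.I, ⟨⟨by trivial, ?_⟩, fun j => by simp⟩, ?_⟩
    · simpa using hy
    · funext j
      refine Units.ext ?_
      rw [h j, ← key]
      rfl

theorem mem_groupN_iff {g : Fin d → ℂˣ} : g ∈ groupN X Q ↔
    ∃ x : Fin d → ℝ, projR X x ∈ Q ∧ ∀ j, (g j : ℂ) = cexp (x j) := by
  constructor
  · rintro ⟨Z, ⟨⟨h1, -⟩, h3⟩, rfl⟩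
    refine ⟨fun j => (Z j).re, h1, fun j => ?_⟩
    have : Z j = ((Z j).re : ℂ) := by
      apply Complex.ext <;> simp
      exact h3 j
    rw [← this]
    rfl
  · rintro ⟨x, hx, h⟩
    refine ⟨fun j => x j, ⟨⟨?_, by trivial⟩, fun j => by simp⟩, ?_⟩
    · simpa using hx
    · funext j
      exact Units.ext (h j).symm

/-- Two points that differ by the exponential of an element of `H`. -/
def TorusRel (H : AddSubgroup (Fin d → ℂ)) (z w : Fin d → ℂ) : Prop :=
  ∃ Z ∈ H, ∀ j, w j = cexp (Z j) * z j

theorem exists_groupNC_iff {z w : Fin d → ℂ} : (∃ g ∈ groupNC X Q, torusAct g z = w) ↔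
    TorusRel (preimageGroup X Q.toAddSubgroup ⊥) z w := by
  constructor
  · rintro ⟨_, ⟨Z, hZ, rfl⟩, rfl⟩
    exact ⟨Z, hZ, fun j => rfl⟩
  · rintro ⟨Z, hZ, h⟩
    exact ⟨_, ⟨Z, hZ, rfl⟩, funext fun j => (h j).symm⟩

theorem TorusRel.refl (H : AddSubgroup (Fin d → ℂ)) (z : Fin d → ℂ) : TorusRel H z z :=
  ⟨0, H.zero_mem, fun j => by simp [cexp_zero]⟩

theorem TorusRel.symm {H : AddSubgroup (Fin d → ℂ)} {z w : Fin d → ℂ} (h : TorusRel H z w) :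
    TorusRel H w z := by
  obtain ⟨Z, hZ, h⟩ := h
  refine ⟨-Z, H.neg_mem hZ, fun j => ?_⟩
  rw [h j, ← mul_assoc, Pi.neg_apply, cexp_neg_mul_self, one_mul]

theorem TorusRel.trans {H : AddSubgroup (Fin d → ℂ)} {z w v : Fin d → ℂ} (h : TorusRel H z w)
    (h' : TorusRel H w v) : TorusRel H z v := by
  obtain ⟨Z, hZ, h⟩ := h
  obtain ⟨W, hW, h'⟩ := h'
  refine ⟨W + Z, H.add_mem hW hZ, fun j => ?_⟩
  rw [h' j, h j, Pi.add_apply, cexp_add, mul_assoc]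

/-- The indices of the vanishing coordinates. -/
noncomputable def zeros (z : Fin d → ℂ) : Finset (Fin d) := Finset.univ.filter fun j => z j = 0

theorem mem_zeros {z : Fin d → ℂ} {j : Fin d} : j ∈ zeros z ↔ z j = 0 := by simp [zeros]

theorem TorusRel.zeros_eq {H : AddSubgroup (Fin d → ℂ)} {z w : Fin d → ℂ}
    (h : TorusRel H z w) : zeros w = zeros z := by
  obtain ⟨Z, -, h⟩ := h
  ext j
  simp [mem_zeros, h j, cexp_ne_zero]

theorem mem_coordOpen_iff {I : Finset (Fin d)} {z : Fin d → ℂ} :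
    z ∈ coordOpen I ↔ zeros z ⊆ I := by
  simp only [coordOpen, Set.mem_ofPred_eq, Finset.subset_iff, mem_zeros]

theorem mem_coordTorus_iff {I : Finset (Fin d)} {z : Fin d → ℂ} :
    z ∈ coordTorus I ↔ zeros z = I := by
  simp only [coordTorus, Set.mem_ofPred_eq, Finset.ext_iff, mem_zeros]

theorem mem_openDelta_iff {z : Fin d → ℂ} :
    z ∈ openDelta X lam ↔ ∃ F : Face X lam, zeros z ⊆ F.idx := by
  simp only [openDelta, Set.mem_iUnion, mem_coordOpen_iff]

/-- The face with the smallest index set that contains the vanishing coordinates of `z`. -/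
noncomputable def faceOf (z : openDelta X lam) : Face X lam :=
  (exists_minimal_face (mem_openDelta_iff.1 z.2)).choose

theorem zeros_subset_faceOf (z : openDelta X lam) : zeros z.1 ⊆ (faceOf z).idx :=
  (exists_minimal_face (mem_openDelta_iff.1 z.2)).choose_spec.1

theorem faceOf_subset {z : openDelta X lam} {F : Face X lam} (h : zeros z.1 ⊆ F.idx) :
    (faceOf z).idx ⊆ F.idx :=
  (exists_minimal_face (mem_openDelta_iff.1 z.2)).choose_spec.2 F h

theorem faceOf_subset_iff {z : openDelta X lam} {F : Face X lam} :
    (faceOf z).idx ⊆ F.idx ↔ (z : Fin d → ℂ) ∈ coordOpen F.idx :=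
  ⟨fun h => mem_coordOpen_iff.2 ((zeros_subset_faceOf z).trans h),
    fun h => faceOf_subset (mem_coordOpen_iff.1 h)⟩

theorem faceOf_eq_of_subset {z w : openDelta X lam} (h1 : zeros z.1 ⊆ zeros w.1)
    (h2 : zeros w.1 ⊆ (faceOf z).idx) : faceOf w = faceOf z :=
  Face.ext ((faceOf_subset h2).antisymm (faceOf_subset (h1.trans (zeros_subset_faceOf w))))

theorem faceOf_eq_of_zeros_eq {z : openDelta X lam} {F : Face X lam} (h : zeros z.1 = F.idx) :
    faceOf z = F :=
  Face.ext ((faceOf_subset h.subset).antisymm (h ▸ zeros_subset_faceOf z))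

/-- Set the coordinates in `I` to zero. -/
noncomputable def zeroOut (I : Finset (Fin d)) (z : Fin d → ℂ) : Fin d → ℂ :=
  fun j => if j ∈ I then 0 else z j

theorem zeroOut_of_mem {I : Finset (Fin d)} {j : Fin d} (hj : j ∈ I) (z : Fin d → ℂ) :
    zeroOut I z j = 0 := if_pos hj

theorem zeroOut_of_notMem {I : Finset (Fin d)} {j : Fin d} (hj : j ∉ I) (z : Fin d → ℂ) :
    zeroOut I z j = z j := if_neg hj

theorem continuous_zeroOut (I : Finset (Fin d)) : Continuous (zeroOut I) := by
  refine continuous_pi fun j => ?_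
  by_cases hj : j ∈ I
  · simp only [zeroOut_of_mem hj]
    exact continuous_const
  · simp only [zeroOut_of_notMem hj]
    exact continuous_apply j

theorem zeros_zeroOut {I : Finset (Fin d)} {z : Fin d → ℂ} (h : zeros z ⊆ I) :
    zeros (zeroOut I z) = I := by
  ext j
  rw [mem_zeros]
  by_cases hj : j ∈ I
  · simp [zeroOut_of_mem hj, hj]
  · simp only [zeroOut_of_notMem hj, hj, iff_false]
    exact fun h0 => hj (h (mem_zeros.2 h0))

theorem zeroOut_eq_self {I : Finset (Fin d)} {z : Fin d → ℂ} (h : zeros z = I) :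
    zeroOut I z = z := by
  funext j
  by_cases hj : j ∈ I
  · rw [zeroOut_of_mem hj]
    rw [← h, mem_zeros] at hj
    exact hj.symm
  · exact zeroOut_of_notMem hj z

theorem zeroOut_zeroOut {I J : Finset (Fin d)} (h : I ⊆ J) (z : Fin d → ℂ) :
    zeroOut J (zeroOut I z) = zeroOut J z := by
  funext j
  by_cases hj : j ∈ J
  · rw [zeroOut_of_mem hj, zeroOut_of_mem hj]
  · rw [zeroOut_of_notMem hj, zeroOut_of_notMem hj, zeroOut_of_notMem fun h' => hj (h h')]

theorem TorusRel.zeroOut {H : AddSubgroup (Fin d → ℂ)} {z w : Fin d → ℂ} (h : TorusRel H z w)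
    (I : Finset (Fin d)) : TorusRel H (zeroOut I z) (zeroOut I w) := by
  obtain ⟨Z, hZ, h⟩ := h
  refine ⟨Z, hZ, fun j => ?_⟩
  by_cases hj : j ∈ I
  · simp [zeroOut_of_mem hj]
  · simp [zeroOut_of_notMem hj, h j]

/-! ### Invariants and limits of the orbits of A. -/

theorem sum_mul_of_projR_eq_zero {y : Fin d → ℝ} (hy : projR X y = 0) (ν : Module.Dual ℝ 𝔡) :
    ∑ j, y j * ν (X j) = 0 := by
  have := congrArg ν hy
  simpa [projR, Fintype.linearCombination_apply] using this

/-- A monomial with real exponents that is invariant under `A`. -/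
theorem prod_norm_rpow_torusAct {a : Fin d → ℂˣ} (ha : a ∈ groupA X) (ν : Module.Dual ℝ 𝔡)
    (z : Fin d → ℂ) :
    ∏ j, ‖torusAct a z j‖ ^ ν (X j) = ∏ j, ‖z j‖ ^ ν (X j) := by
  obtain ⟨y, hy, h⟩ := mem_groupA_iff.1 ha
  have h1 : ∀ j, ‖torusAct a z j‖ ^ ν (X j) =
      Real.exp (-(2 * Real.pi) * (y j * ν (X j))) * ‖z j‖ ^ ν (X j) := fun j => by
    rw [torusAct, h j, norm_mul, Complex.norm_real, Real.norm_eq_abs, Real.abs_exp,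
      Real.mul_rpow (Real.exp_pos _).le (norm_nonneg _), ← Real.exp_mul]
    congr 2
    ring
  rw [Finset.prod_congr rfl fun j _ => h1 j, Finset.prod_mul_distrib, ← Real.exp_sum,
    ← Finset.mul_sum, sum_mul_of_projR_eq_zero hy, mul_zero, Real.exp_zero, one_mul]

theorem zeros_subset_of_mem_closure {z w : openDelta X lam} (h : w ∈ closureOrbitA X lam z) :
    zeros z.1 ⊆ zeros w.1 := by
  intro j hj
  rw [mem_zeros] at *
  have hc : IsClosed {v : openDelta X lam | v.1 j = 0} :=
    isClosed_eq ((continuous_apply j).comp continuous_subtype_val) continuous_const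
  refine closure_minimal ?_ hc h
  rintro v ⟨a, -, hv⟩
  change v.1 j = 0
  rw [← hv, torusAct, hj, mul_zero]

/-- Take μ in the face of z and μ' in the face of w. The function ∏ |v_j| ^ (μ - μ')(X_j) is
constant on Az, continuous at w and nonzero at z, hence nonzero at w. At a zero of w its exponent
must then be 0, which puts μ on that facet. -/
theorem zeros_subset_faceOf_of_mem_closure {z w : openDelta X lam}
    (h : w ∈ closureOrbitA X lam z) : zeros w.1 ⊆ (faceOf z).idx := by
  obtain ⟨μ, hμ⟩ := (faceOf z).2
  obtain ⟨μ', hμ'⟩ := (faceOf w).2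
  have hμ1 := mem_openFace_iff.1 hμ
  have hμ2 := mem_openFace_iff.1 hμ'
  let ν := μ - μ'
  let f : openDelta X lam → ℝ := fun v => ∏ j, ‖v.1 j‖ ^ ν (X j)
  -- At a zero of w the exponent is μ(X_j) - lam_j ≥ 0, so the power is continuous even at zero.
  have hf : ContinuousAt f w := by
    refine tendsto_finsetProd _ fun j _ => ?_
    have hc : ContinuousAt (fun v : openDelta X lam => ‖v.1 j‖) w :=
      (((continuous_apply j).comp continuous_subtype_val).norm).continuousAt
    refine hc.rpow_const ?_
    by_cases hj : w.1 j = 0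
    · right
      have := hμ2.1 j (zeros_subset_faceOf w (mem_zeros.2 hj))
      simpa [ν, this] using hμ.1 j
    · left
      simpa using hj
  have hfw : f w = f z := by
    have h1 := hf.continuousWithinAt.mem_closure_image h
    have h2 : f '' {w | ∃ a ∈ groupA X, torusAct a z = (w : Fin d → ℂ)} ⊆ {f z} := by
      rintro _ ⟨v, ⟨a, ha, hv⟩, rfl⟩
      simp only [f, ← hv, Set.mem_singleton_iff]
      exact prod_norm_rpow_torusAct ha ν z
    have h3 := closure_mono h2 h1
    rwa [closure_singleton, Set.mem_singleton_iff] at h3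
  -- A zero of z is also a zero of w, so both μ and μ' are tight there. The exponent is 0, and 0 ^ 0
  -- = 1.
  have hfz : f z ≠ 0 := by
    refine Finset.prod_ne_zero_iff.2 fun j _ => ?_
    by_cases hj : z.1 j = 0
    · have h1 := hμ1.1 j (zeros_subset_faceOf z (mem_zeros.2 hj))
      have h2 := hμ2.1 j (zeros_subset_faceOf w (zeros_subset_of_mem_closure h (mem_zeros.2 hj)))
      simp [ν, h1, h2]
    · exact (Real.rpow_pos_of_pos (norm_pos_iff.2 hj) _).ne'
  intro j hj
  rw [← hfw] at hfz
  have h1 := Finset.prod_ne_zero_iff.1 hfz j (Finset.mem_univ j)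
  rw [mem_zeros.1 hj, norm_zero] at h1
  have h2 : ν (X j) = 0 := by
    by_contra hne
    exact h1 (Real.zero_rpow hne)
  refine (hμ.2 j).1 ?_
  have h3 := hμ2.1 j (zeros_subset_faceOf w hj)
  simp only [ν, LinearMap.sub_apply] at h2
  linarith

theorem faceOf_eq_of_mem_closure {z w : openDelta X lam} (h : w ∈ closureOrbitA X lam z) :
    faceOf w = faceOf z :=
  faceOf_eq_of_subset (zeros_subset_of_mem_closure h) (zeros_subset_faceOf_of_mem_closure h)

theorem torusAct_mem_openDelta (a : Fin d → ℂˣ) {z : Fin d → ℂ} (hz : z ∈ openDelta X lam) :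
    torusAct a z ∈ openDelta X lam := by
  obtain ⟨F, hF⟩ := mem_openDelta_iff.1 hz
  refine mem_openDelta_iff.2 ⟨F, fun j hj => hF ?_⟩
  rw [mem_zeros] at *
  simpa [torusAct] using hj

/-- The closure of `A z` contains the `A`-orbit of the point obtained from `z` by setting the
coordinates of its face to zero. -/
theorem mem_closure_of_eq_zeroOut {z v : openDelta X lam} {y₀ : Fin d → ℝ}
    (hy₀ : projR X y₀ = 0)
    (hv : ∀ j, v.1 j = Real.exp (-(2 * Real.pi * y₀ j)) * zeroOut (faceOf z).idx z.1 j) :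
    v ∈ closureOrbitA X lam z := by
  obtain ⟨y, hy1, hy2, hy3⟩ := exists_relation_of_minimal (zeros_subset_faceOf z)
    (fun G hG => faceOf_subset hG)
  -- As t → ∞, the positive coefficients of y kill the nonzero coordinates in the face. The
  -- coordinates outside the face do not depend on t.
  let a : ℝ → Fin d → ℂˣ := fun t j =>
    Units.mk0 (Real.exp (-(2 * Real.pi * (y₀ j + t * y j))) : ℂ)
      (Complex.ofReal_ne_zero.2 (Real.exp_ne_zero _))
  have ha : ∀ t, a t ∈ groupA X := by
    intro t
    refine mem_groupA_iff.2 ⟨y₀ + t • y, ?_, fun j => by simp [a]⟩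
    have : projR X y = 0 := by simpa [projR, Fintype.linearCombination_apply] using hy3
    rw [map_add, map_smul, hy₀, this, smul_zero, add_zero]
  have hlim : Filter.Tendsto
      (fun t => (⟨torusAct (a t) z, torusAct_mem_openDelta _ z.2⟩ : openDelta X lam))
      Filter.atTop (𝓝 v) := by
    rw [tendsto_subtype_rng, tendsto_pi_nhds]
    intro j
    rw [hv j]
    by_cases hj : j ∈ (faceOf z).idx
    · rw [zeroOut_of_mem hj, mul_zero]
      by_cases hz : z.1 j = 0
      · simp only [torusAct, hz, mul_zero]
        exact tendsto_const_nhds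
      · have hpos := hy1 j hj fun h => hz (mem_zeros.1 h)
        have h1 : Filter.Tendsto (fun t : ℝ => -(2 * Real.pi * (y₀ j + t * y j)))
            Filter.atTop Filter.atBot := by
          refine Filter.tendsto_neg_atTop_atBot.comp ?_
          refine Filter.Tendsto.const_mul_atTop Real.two_pi_pos ?_
          exact Filter.tendsto_atTop_add_const_left _ _
            (Filter.tendsto_id.atTop_mul_const hpos)
        have h2 := (Complex.continuous_ofReal.tendsto 0).comp (Real.tendsto_exp_atBot.comp h1)
        simpa [torusAct, a, Function.comp_def] using h2.mul_const (z.1 j)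
    · rw [zeroOut_of_notMem hj]
      simp only [torusAct, a, Units.val_mk0, hy2 j hj, mul_zero, add_zero]
      exact tendsto_const_nhds
  exact mem_closure_of_tendsto hlim (Filter.Eventually.of_forall fun t => ⟨a t, ha t, rfl⟩)

/-- A point of the closure of `A z` agrees with a point of the orbit in the coordinates outside
of the face of `z`. -/
theorem exists_eq_of_mem_closure {z w : openDelta X lam} (h : w ∈ closureOrbitA X lam z) :
    ∃ y : Fin d → ℝ, projR X y = 0 ∧
      ∀ j ∉ (faceOf z).idx, w.1 j = Real.exp (-(2 * Real.pi * y j)) * z.1 j := by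
  set I := (faceOf z).idx with hI
  have hz : ∀ j ∉ I, z.1 j ≠ 0 := fun j hj h0 => hj (zeros_subset_faceOf z (mem_zeros.2 h0))
  have hw : ∀ j ∉ I, w.1 j ≠ 0 := fun j hj h0 =>
    hj (zeros_subset_faceOf_of_mem_closure h (mem_zeros.2 h0))
  let m : (Fin d → ℝ) →ₗ[ℝ] Fin d → ℝ :=
    { toFun := fun y j => if j ∈ I then 0 else y j
      map_add' := fun y y' => by
        funext j
        by_cases hj : j ∈ I <;> simp [hj]
      map_smul' := fun c y => by
        funext j
        by_cases hj : j ∈ I <;> simp [hj] }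
  -- Outside I, the logarithms of the moduli along the orbit lie in this finite-dimensional, hence
  -- closed, subspace; so do those of the limit w.
  let L := (LinearMap.ker (projR X)).map m
  let f : openDelta X lam → Fin d → ℝ := fun v j =>
    if j ∈ I then 0 else Real.log (‖v.1 j‖ / ‖z.1 j‖)
  have hf : ContinuousAt f w := by
    refine continuousAt_pi.2 fun j => ?_
    by_cases hj : j ∈ I
    · simp only [f, hj, if_true]
      exact continuousAt_const
    · simp only [f, hj, if_false]
      refine ContinuousAt.log ?_ (div_ne_zero (norm_ne_zero_iff.2 (hw j hj))
        (norm_ne_zero_iff.2 (hz j hj)))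
      exact ((((continuous_apply j).comp continuous_subtype_val).norm).div_const _).continuousAt
  have hfL : f w ∈ L := by
    have h1 := hf.continuousWithinAt.mem_closure_image h
    refine closure_minimal ?_ L.closed_of_finiteDimensional h1
    rintro _ ⟨v, ⟨a, ha, hv⟩, rfl⟩
    obtain ⟨y, hy, hay⟩ := mem_groupA_iff.1 ha
    refine ⟨(-(2 * Real.pi)) • y, (LinearMap.ker _).smul_mem _ hy, ?_⟩
    funext j
    by_cases hj : j ∈ I
    · simp [m, f, hj]
    · simp only [m, f, hj, if_false, ← hv, torusAct, hay j, LinearMap.coe_mk, AddHom.coe_mk,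
        norm_mul, Complex.norm_real, Real.norm_eq_abs, Real.abs_exp,
        mul_div_cancel_right₀ _ (norm_ne_zero_iff.2 (hz j hj)), Real.log_exp, Pi.smul_apply,
        smul_eq_mul]
      ring
  obtain ⟨y, hy, hym⟩ := hfL
  refine ⟨(-(2 * Real.pi))⁻¹ • y, (LinearMap.ker _).smul_mem _ hy, fun j hj => ?_⟩
  have hnorm : Real.exp (y j) = ‖w.1 j‖ / ‖z.1 j‖ := by
    have h1 := congrFun hym j
    simp only [m, f, hj, if_false, LinearMap.coe_mk, AddHom.coe_mk] at h1
    rw [h1, Real.exp_log (div_pos (norm_pos_iff.2 (hw j hj)) (norm_pos_iff.2 (hz j hj)))]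
  -- Elements of A have positive entries, so the phases are constant on the orbit, and this is a
  -- closed condition.
  have hphase : w.1 j / z.1 j = ((‖w.1 j‖ / ‖z.1 j‖ : ℝ) : ℂ) := by
    have hc : IsClosed {v : openDelta X lam |
        v.1 j / z.1 j = ((‖v.1 j‖ / ‖z.1 j‖ : ℝ) : ℂ)} := by
      have hcj : Continuous fun v : openDelta X lam => v.1 j :=
        (continuous_apply j).comp continuous_subtype_val
      exact isClosed_eq (hcj.div_const _)
        (Complex.continuous_ofReal.comp (hcj.norm.div_const _))
    refine closure_minimal ?_ hc h
    rintro v ⟨a, ha, hv⟩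
    obtain ⟨y, -, hay⟩ := mem_groupA_iff.1 ha
    change v.1 j / z.1 j = ((‖v.1 j‖ / ‖z.1 j‖ : ℝ) : ℂ)
    rw [← hv, torusAct, hay j, mul_div_cancel_right₀ _ (hz j hj), norm_mul,
      mul_div_cancel_right₀ _ (norm_ne_zero_iff.2 (hz j hj)), Complex.norm_real,
      Real.norm_eq_abs, Real.abs_exp]
  have he : -(2 * Real.pi * ((-(2 * Real.pi))⁻¹ • y) j) = y j := by
    have := Real.two_pi_pos.ne'
    simp only [Pi.smul_apply, smul_eq_mul]
    rw [← mul_assoc, ← neg_mul, ← neg_mul, mul_inv_cancel₀ (neg_ne_zero.2 this), one_mul]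
  rw [he, hnorm, ← hphase, div_mul_cancel₀ _ (hz j hj)]

theorem ofReal_exp_eq_cexp (t : ℝ) :
    (Real.exp (-(2 * Real.pi * t)) : ℂ) = cexp (t * Complex.I) := by
  rw [cexp]
  push_cast
  congr 1
  linear_combination -(2 * Real.pi * t : ℂ) * Complex.I_mul_I

/-- The relation `∼_N` in terms of closed orbits. -/
theorem toricRel_iff {z w : openDelta X lam} : toricRel X lam Q z w ↔ faceOf z = faceOf w ∧
    TorusRel (preimageGroup X Q.toAddSubgroup ⊥) (zeroOut (faceOf z).idx z.1)
      (zeroOut (faceOf w).idx w.1) := by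
  constructor
  · rintro ⟨u, hu, v, hv, g, hg, hguv⟩
    obtain ⟨x, hx, hgx⟩ := mem_groupN_iff.1 hg
    have hzeros : zeros u.1 = zeros v.1 := by
      ext j
      rw [mem_zeros, mem_zeros, ← hguv]
      simp [torusAct]
    have hface : faceOf z = faceOf w := by
      rw [← faceOf_eq_of_mem_closure hu, ← faceOf_eq_of_mem_closure hv]
      exact faceOf_eq_of_subset hzeros.ge (hzeros ▸ zeros_subset_faceOf v)
    refine ⟨hface, ?_⟩
    obtain ⟨y, hy, hyu⟩ := exists_eq_of_mem_closure hu
    obtain ⟨y', hy', hyv⟩ := exists_eq_of_mem_closure hv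
    -- From z to u by y, from u to v by x in N, and from v back to w by -y'.
    refine ⟨fun j => x j + (y j - y' j : ℝ) * Complex.I, ⟨?_, ?_⟩, fun j => ?_⟩
    · simpa using hx
    · have : (fun j => ((x j + (y j - y' j : ℝ) * Complex.I : ℂ)).im) = y - y' := by
        funext j
        simp
      rw [this, map_sub, hy, hy', sub_zero]
      rfl
    · by_cases hj : j ∈ (faceOf z).idx
      · rw [zeroOut_of_mem hj, zeroOut_of_mem (hface ▸ hj), mul_zero]
      · have hj' : j ∉ (faceOf w).idx := hface ▸ hj
        rw [zeroOut_of_notMem hj, zeroOut_of_notMem hj']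
        have h1 : v.1 j = g j * u.1 j := (congrFun hguv j).symm
        rw [hyv j hj', hyu j hj, hgx j, ofReal_exp_eq_cexp, ofReal_exp_eq_cexp] at h1
        have h2 : w.1 j = cexp (-(y' j * Complex.I)) * (cexp (y' j * Complex.I) * w.1 j) := by
          rw [← mul_assoc, cexp_neg_mul_self, one_mul]
        rw [h2, h1, ← mul_assoc, ← mul_assoc, ← cexp_add, ← cexp_add]
        congr 2
        push_cast
        ring
  · rintro ⟨hface, Z, ⟨hre, him⟩, hZ⟩
    have him' : projR X (fun j => (Z j).im) = 0 := him
    have hmem : ∀ (v : Fin d → ℂ), zeros v = (faceOf z).idx → v ∈ openDelta X lam :=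
      fun v hv => mem_openDelta_iff.2 ⟨_, hv.subset⟩
    have hz0 := zeros_zeroOut (zeros_subset_faceOf z)
    let u : openDelta X lam := ⟨zeroOut (faceOf z).idx z.1, hmem _ hz0⟩
    -- Split exp Z into its unitary part g, which lies in N, and its part in A, which is absorbed by
    -- the closure of Aw.
    let g : Fin d → ℂˣ := fun j => Units.mk0 (cexp ((Z j).re : ℂ)) (cexp_ne_zero _)
    let v : openDelta X lam := ⟨torusAct g u, torusAct_mem_openDelta g u.2⟩
    refine ⟨u, ?_, v, ?_, g, mem_groupN_iff.2 ⟨_, hre, fun j => rfl⟩, rfl⟩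
    · exact mem_closure_of_eq_zeroOut (map_zero _) fun j => by simp [u]
    · refine mem_closure_of_eq_zeroOut (y₀ := -fun j => (Z j).im)
        (by rw [map_neg, him', neg_zero]) fun j => ?_
      rw [hZ j, ofReal_exp_eq_cexp, ← mul_assoc, ← cexp_add]
      change cexp _ * _ = _
      congr 2
      have h := Complex.re_add_im (Z j)
      simp only [Pi.neg_apply, Complex.ofReal_neg]
      linear_combination h

theorem toricRel_equivalence : Equivalence (toricRel X lam Q) where
  refl z := toricRel_iff.2 ⟨rfl, .refl _ _⟩
  symm h := by
    obtain ⟨h1, h2⟩ := toricRel_iff.1 h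
    exact toricRel_iff.2 ⟨h1.symm, h2.symm⟩
  trans h h' := by
    obtain ⟨h1, h2⟩ := toricRel_iff.1 h
    obtain ⟨h3, h4⟩ := toricRel_iff.1 h'
    exact toricRel_iff.2 ⟨h1.trans h3, h2.trans h4⟩

end OrbitClosures

/-! ## The pieces -/

section Pieces

variable {𝔡 : Type*} [AddCommGroup 𝔡] [Module ℝ 𝔡] {d : ℕ} {X : Fin d → 𝔡} {lam : Fin d → ℝ}
  {Q : Submodule ℤ 𝔡}

/-- The projection of `ℂ^d_Δ` onto the toric space. -/
def toricMk (X : Fin d → 𝔡) (lam : Fin d → ℝ) (Q : Submodule ℤ 𝔡) (z : openDelta X lam) :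
    ToricSpace X lam Q := Quot.mk _ z

theorem continuous_toricMk : Continuous (toricMk X lam Q) := continuous_quot_mk

theorem toricMk_eq_iff {z w : openDelta X lam} :
    toricMk X lam Q z = toricMk X lam Q w ↔ toricRel X lam Q z w :=
  toricRel_equivalence.quot_mk_eq_iff z w

theorem exists_toricMk_eq (t : ToricSpace X lam Q) : ∃ z, toricMk X lam Q z = t :=
  Quot.exists_rep t

theorem faceOf_eq_of_toricRel {z w : openDelta X lam} (h : toricRel X lam Q z w) :
    faceOf z = faceOf w := (toricRel_iff.1 h).1

theorem isOpen_coordOpen (I : Finset (Fin d)) : IsOpen (coordOpen I) := by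
  have : coordOpen I = ⋂ j ∈ Iᶜ, {z : Fin d → ℂ | z j ≠ 0} := by
    ext z
    simp only [coordOpen, Set.mem_ofPred_eq, Set.mem_iInter, Finset.mem_compl]
    exact forall_congr' fun j => not_imp_not.symm
  rw [this]
  exact isOpen_biInter_finset fun j _ => isOpen_ne_fun (continuous_apply j) continuous_const

/-- For a property inherited by smaller index sets, the set is the union of the open sets `coordOpen
F.idx` over the faces F with the property. All openness statements about pieces come from this. -/
theorem isOpen_faceOf {P : Face X lam → Prop} (hP : ∀ F G, P F → G.idx ⊆ F.idx → P G) :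
    IsOpen {z : openDelta X lam | P (faceOf z)} := by
  have : {z : openDelta X lam | P (faceOf z)} =
      ⋃ F ∈ {F | P F}, Subtype.val ⁻¹' coordOpen F.idx := by
    ext z
    simp only [Set.mem_iUnion, Set.mem_preimage, Set.mem_ofPred_eq, exists_prop]
    exact ⟨fun h => ⟨_, h, faceOf_subset_iff.1 subset_rfl⟩,
      fun ⟨F, hF, hz⟩ => hP F _ hF (faceOf_subset_iff.2 hz)⟩
  rw [this]
  exact isOpen_biUnion fun F _ => (isOpen_coordOpen _).preimage continuous_subtype_val

theorem isOpen_toricMk_image {V : Set (openDelta X lam)} (hV : IsOpen V)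
    (hsat : ∀ z w, toricRel X lam Q z w → z ∈ V → w ∈ V) : IsOpen (toricMk X lam Q '' V) := by
  refine isOpen_coinduced.2 ?_
  have : Quot.mk _ ⁻¹' (toricMk X lam Q '' V) = V := by
    ext z
    refine ⟨?_, fun h => ⟨z, h, rfl⟩⟩
    rintro ⟨w, hw, h⟩
    exact hsat _ _ (toricMk_eq_iff.1 h) hw
  exact this.symm ▸ hV

/-- The part of the toric space in which the face satisfies `P`. -/
def facePart (Q : Submodule ℤ 𝔡) (P : Face X lam → Prop) : Set (ToricSpace X lam Q) :=
  toricMk X lam Q '' {z | P (faceOf z)}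

theorem toricMk_mem_facePart {P : Face X lam → Prop} {z : openDelta X lam} :
    toricMk X lam Q z ∈ facePart Q P ↔ P (faceOf z) := by
  refine ⟨?_, fun h => ⟨z, h, rfl⟩⟩
  rintro ⟨w, hw, h⟩
  rw [← faceOf_eq_of_toricRel (toricMk_eq_iff.1 h)]
  exact hw

theorem isOpen_facePart {P : Face X lam → Prop} (hP : ∀ F G, P F → G.idx ⊆ F.idx → P G) :
    IsOpen (facePart Q P) :=
  isOpen_toricMk_image (isOpen_faceOf hP) fun z w h hz => by
    change P (faceOf w)
    rw [← faceOf_eq_of_toricRel h]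
    exact hz

theorem coordTorus_subset_openDelta (F : Face X lam) : coordTorus F.idx ⊆ openDelta X lam :=
  fun _ hz => mem_openDelta_iff.2 ⟨F, (mem_coordTorus_iff.1 hz).subset⟩

theorem zeroOut_mem_coordTorus {F : Face X lam} {z : Fin d → ℂ} (h : z ∈ coordOpen F.idx) :
    zeroOut F.idx z ∈ coordTorus F.idx :=
  mem_coordTorus_iff.2 (zeros_zeroOut (mem_coordOpen_iff.1 h))

theorem faceOf_of_mem_coordTorus {F : Face X lam} {z : openDelta X lam}
    (h : (z : Fin d → ℂ) ∈ coordTorus F.idx) : faceOf z = F :=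
  faceOf_eq_of_zeros_eq (mem_coordTorus_iff.1 h)

/-- The closed orbit representative of a point. -/
noncomputable def closedRep (z : openDelta X lam) : openDelta X lam :=
  ⟨zeroOut (faceOf z).idx z.1, coordTorus_subset_openDelta (faceOf z)
    (zeroOut_mem_coordTorus (faceOf_subset_iff.1 subset_rfl))⟩

theorem closedRep_mem (z : openDelta X lam) : (closedRep z).1 ∈ coordTorus (faceOf z).idx :=
  zeroOut_mem_coordTorus (faceOf_subset_iff.1 subset_rfl)

theorem closedRep_mem_closure (z : openDelta X lam) : closedRep z ∈ closureOrbitA X lam z :=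
  mem_closure_of_eq_zeroOut (map_zero _) fun j => by simp [closedRep]

theorem toricRel_closedRep (z : openDelta X lam) : toricRel X lam Q z (closedRep z) := by
  have h := faceOf_of_mem_coordTorus (closedRep_mem z)
  refine toricRel_iff.2 ⟨h.symm, ?_⟩
  rw [h]
  have : zeroOut (faceOf z).idx (closedRep z).1 = zeroOut (faceOf z).idx z.1 :=
    zeroOut_zeroOut subset_rfl _
  rw [this]
  exact .refl _ _

theorem piece_some (F : SingularFace X lam) :
    piece X lam Q (some F) = facePart Q fun G => G = F.1 := by
  refine congrArg (fun s => Quot.mk (toricRel X lam Q) '' s) (Set.ext fun z => ?_)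
  constructor
  · rintro ⟨u, hu, huF⟩
    change faceOf z = F.1
    rw [← faceOf_eq_of_mem_closure hu]
    exact faceOf_of_mem_coordTorus huF
  · intro h
    have h' : faceOf z = F.1 := h
    exact ⟨_, closedRep_mem_closure z, h' ▸ closedRep_mem z⟩

variable [FiniteDimensional ℝ 𝔡]

theorem mem_regularSet_iff {z : openDelta X lam} :
    (z : Fin d → ℂ) ∈ regularSet X lam ↔ (faceOf z).IsRegular := by
  simp only [regularSet, Set.mem_iUnion]
  constructor
  · rintro ⟨⟨F, hF⟩, h⟩
    exact hF.mono (faceOf_subset_iff.2 h)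
  · exact fun h => ⟨⟨_, h⟩, faceOf_subset_iff.1 subset_rfl⟩

theorem piece_top : piece X lam Q ⊤ = facePart Q fun G => G.IsRegular :=
  congrArg (fun s => Quot.mk (toricRel X lam Q) '' s) (Set.ext fun _ => mem_regularSet_iff)

theorem isOpen_piece_top : IsOpen (piece X lam Q ⊤) := by
  rw [piece_top]
  exact isOpen_facePart fun F G hF h => hF.mono h

/-- At the points of a regular face exactly the coordinates of the face vanish. -/
theorem zeros_eq_of_regular {z : openDelta X lam} (h : (faceOf z).IsRegular) :
    zeros z.1 = (faceOf z).idx := by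
  refine (zeros_subset_faceOf z).antisymm fun j hj => ?_
  by_contra hj'
  obtain ⟨y, hy1, hy2, hy3⟩ := exists_relation_of_minimal (zeros_subset_faceOf z)
    (fun G hG => faceOf_subset hG)
  rw [face_isRegular_iff, linearIndepOn_finset_iff] at h
  -- The relation has a positive coefficient at j, which independence of the normals excludes.
  refine (hy1 j hj hj').ne' (h y ?_ j hj)
  rw [← hy3]
  exact Finset.sum_subset (Finset.subset_univ _) fun l _ hl => by rw [hy2 l hl, zero_smul]

omit [FiniteDimensional ℝ 𝔡]

/-! ### The pieces as orbit spaces. -/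

theorem isOpenMap_orbitMk {G : Subgroup (Fin d → ℂˣ)} {S : Set (Fin d → ℂ)}
    (hS : ∀ g, ∀ z ∈ S, torusAct g z ∈ S) :
    IsOpenMap (Quotient.mk (orbitSetoid G S)) := by
  intro O hO
  refine isOpen_coinduced.2 ?_
  have : Quotient.mk (orbitSetoid G S) ⁻¹' (Quotient.mk (orbitSetoid G S) '' O) =
      ⋃ g ∈ G, (fun z : S => (⟨torusAct g z, hS g z z.2⟩ : S)) ⁻¹' O := by
    ext w
    simp only [Set.mem_preimage, Set.mem_image, Set.mem_iUnion, exists_prop]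
    constructor
    · rintro ⟨z, hz, h⟩
      obtain ⟨g, hg, h⟩ := Quotient.exact h.symm
      refine ⟨g, hg, ?_⟩
      rwa [show (⟨torusAct g w, hS g w w.2⟩ : S) = z from Subtype.ext h]
    · rintro ⟨g, hg, h⟩
      exact ⟨_, h, (Quotient.sound ⟨g, hg, rfl⟩ : Quotient.mk (orbitSetoid G S) w = _).symm⟩
  change IsOpen (Quotient.mk (orbitSetoid G S) ⁻¹' (Quotient.mk (orbitSetoid G S) '' O))
  rw [this]
  refine isOpen_biUnion fun g _ => hO.preimage (Continuous.subtype_mk ?_ _)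
  exact continuous_pi fun j =>
    continuous_const.mul ((continuous_apply j).comp continuous_subtype_val)

/-- The orbit space of `S` is homeomorphic to `T` if the points of `T` have representatives in `S`
and the orbits in `S` can be read off continuously in a saturated neighbourhood `U` of `S`. -/
theorem exists_orbitSpace_homeomorph {S : Set (Fin d → ℂ)} {T : Set (ToricSpace X lam Q)}
    {U : Set (openDelta X lam)} {r : (Fin d → ℂ) → Fin d → ℂ} (hSΔ : S ⊆ openDelta X lam)
    (hr : Continuous r) (hU : IsOpen U) (hsat : ∀ z w, toricRel X lam Q z w → z ∈ U → w ∈ U)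
    (hSU : ∀ z : openDelta X lam, z.1 ∈ S → z ∈ U) (hrS : ∀ z ∈ U, r z.1 ∈ S)
    (hrr : ∀ z ∈ S, r z = z)
    (hrel : ∀ z ∈ U, ∀ w, toricRel X lam Q z w →
      TorusRel (preimageGroup X Q.toAddSubgroup ⊥) (r z.1) (r w.1))
    (hrel' : ∀ z w : openDelta X lam, z.1 ∈ S → w.1 ∈ S →
      TorusRel (preimageGroup X Q.toAddSubgroup ⊥) z.1 w.1 → toricRel X lam Q z w)
    (hT : ∀ z, toricMk X lam Q z ∈ T ↔ ∃ w : openDelta X lam, w.1 ∈ S ∧ toricRel X lam Q z w) :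
    ∃ h : OrbitSpace (groupNC X Q) S ≃ₜ T, ∀ (z : S) (hz : (z : Fin d → ℂ) ∈ openDelta X lam),
      (h (Quotient.mk _ z) : ToricSpace X lam Q) = Quot.mk _ ⟨z, hz⟩ := by
  have hST : ∀ z : S, toricMk X lam Q ⟨z, hSΔ z.2⟩ ∈ T := fun z =>
    (hT _).2 ⟨⟨z, hSΔ z.2⟩, z.2, toricRel_equivalence.refl _⟩
  let f : OrbitSpace (groupNC X Q) S → T :=
    Quotient.lift (fun z => ⟨toricMk X lam Q ⟨z, hSΔ z.2⟩, hST z⟩) fun z w h =>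
      Subtype.ext (toricMk_eq_iff.2 (hrel' _ _ z.2 w.2 (exists_groupNC_iff.1 h)))
  have hinj : Function.Injective f := by
    intro a b
    refine Quotient.inductionOn₂ a b fun z w h => Quotient.sound ?_
    have h1 := hrel _ (hSU ⟨z, hSΔ z.2⟩ z.2) _ (toricMk_eq_iff.1 (congrArg Subtype.val h))
    simp only [hrr _ z.2, hrr _ w.2] at h1
    exact exists_groupNC_iff.2 h1
  have hsurj : Function.Surjective f := by
    rintro ⟨t, ht⟩
    obtain ⟨z, rfl⟩ := exists_toricMk_eq t
    obtain ⟨w, hw, h⟩ := (hT z).1 ht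
    exact ⟨Quotient.mk _ ⟨w, hw⟩, Subtype.ext (toricMk_eq_iff.2 h).symm⟩
  refine ⟨(Equiv.ofBijective f ⟨hinj, hsurj⟩).toHomeomorphOfContinuousOpen ?_ ?_,
    fun z hz => rfl⟩
  · refine Continuous.quotient_lift (Continuous.subtype_mk ?_ _) _
    exact continuous_toricMk.comp (continuous_subtype_val.subtype_mk _)
  · intro O hO
    -- The map p sends z to the orbit of r z and is constant on classes. It is a continuous inverse
    -- of f over T, so f(O) is the trace on T of the open image of p⁻¹(O).
    let p : U → OrbitSpace (groupNC X Q) S := fun z => Quotient.mk _ ⟨r z.1.1, hrS z.1 z.2⟩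
    have hp : Continuous p := continuous_quotient_mk'.comp
      ((hr.comp (continuous_subtype_val.comp continuous_subtype_val)).subtype_mk _)
    have hpe : ∀ z w : U, toricRel X lam Q z.1 w.1 → p z = p w := fun z w h =>
      Quotient.sound (exists_groupNC_iff.2 (hrel _ z.2 _ h))
    have hpS : ∀ (w : U) (hw : w.1.1 ∈ S), p w = Quotient.mk _ ⟨w.1.1, hw⟩ := fun w hw =>
      congrArg (Quotient.mk _) (Subtype.ext (hrr _ hw))
    have hV : IsOpen (toricMk X lam Q '' (Subtype.val '' (p ⁻¹' O))) := by
      refine isOpen_toricMk_image (hU.isOpenMap_subtype_val _ (hO.preimage hp)) ?_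
      rintro _ w h ⟨z, hz, rfl⟩
      have hw := hsat _ _ h z.2
      refine ⟨⟨w, hw⟩, ?_, rfl⟩
      rwa [Set.mem_preimage, ← hpe z ⟨w, hw⟩ h]
    refine ⟨_, hV, ?_⟩
    ext ⟨t, ht⟩
    constructor
    · rintro ⟨_, ⟨z, hz, rfl⟩, h⟩
      change toricMk X lam Q z.1 = t at h
      subst h
      obtain ⟨w, hw, hzw⟩ := (hT z.1).1 ht
      refine ⟨Quotient.mk _ ⟨w, hw⟩, ?_, Subtype.ext (toricMk_eq_iff.2 hzw).symm⟩
      rwa [← hpS ⟨w, hSU w hw⟩ hw, ← hpe z ⟨w, hSU w hw⟩ hzw]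
    · rintro ⟨a, ha, h⟩
      induction a using Quotient.inductionOn with
      | h w =>
        refine ⟨_, ⟨⟨⟨w, hSΔ w.2⟩, hSU _ w.2⟩, ?_, rfl⟩, congrArg Subtype.val h⟩
        rwa [Set.mem_preimage, hpS _ w.2]

theorem exists_homeomorph_piece_some (F : SingularFace X lam) :
    ∃ h : OrbitSpace (groupNC X Q) (coordTorus F.1.idx) ≃ₜ piece X lam Q F,
      ∀ (z : coordTorus F.1.idx) (hz : (z : Fin d → ℂ) ∈ openDelta X lam),
        (h (Quotient.mk _ z) : ToricSpace X lam Q) = Quot.mk _ ⟨z, hz⟩ := by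
  -- U also contains points of other pieces. Truncation along I_F sends them into the torus of F
  -- without preserving their class, but related points go to the same N_ℂ-orbit, and this suffices.
  refine exists_orbitSpace_homeomorph (U := {z | (faceOf z).idx ⊆ F.1.idx})
    (r := zeroOut F.1.idx) (coordTorus_subset_openDelta _) (continuous_zeroOut _)
    (isOpen_faceOf fun _ _ h1 h2 => h2.trans h1) ?_ ?_ ?_ ?_ ?_ ?_ ?_
  · intro z w h hz
    change (faceOf w).idx ⊆ _
    rw [← faceOf_eq_of_toricRel h]
    exact hz
  · intro z hz
    exact (congrArg Face.idx (faceOf_of_mem_coordTorus hz)).subset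
  · exact fun z hz => zeroOut_mem_coordTorus (faceOf_subset_iff.1 hz)
  · exact fun z hz => zeroOut_eq_self (mem_coordTorus_iff.1 hz)
  · intro z hz w h
    obtain ⟨h1, h2⟩ := toricRel_iff.1 h
    have h3 := h2.zeroOut F.1.idx
    rwa [zeroOut_zeroOut hz, zeroOut_zeroOut (h1 ▸ hz)] at h3
  · intro z w hz hw h
    have h1 := faceOf_of_mem_coordTorus hz
    have h2 := faceOf_of_mem_coordTorus hw
    refine toricRel_iff.2 ⟨h1.trans h2.symm, ?_⟩
    rw [h1, h2]
    exact h.zeroOut _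
  · intro z
    change toricMk X lam Q z ∈ piece X lam Q (some F) ↔ _
    rw [piece_some, toricMk_mem_facePart]
    constructor
    · exact fun h => ⟨closedRep z, h ▸ closedRep_mem z, toricRel_closedRep z⟩
    · rintro ⟨w, hw, h⟩
      rw [faceOf_eq_of_toricRel h]
      exact faceOf_of_mem_coordTorus hw

theorem regularSet_subset_openDelta : regularSet X lam ⊆ openDelta X lam :=
  Set.iUnion_subset fun F => Set.subset_iUnion (fun F : Face X lam => coordOpen F.idx) F.1

theorem exists_homeomorph_piece_top [FiniteDimensional ℝ 𝔡] :
    ∃ h : OrbitSpace (groupNC X Q) (regularSet X lam) ≃ₜ piece X lam Q ⊤,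
      ∀ (z : regularSet X lam) (hz : (z : Fin d → ℂ) ∈ openDelta X lam),
        (h (Quotient.mk _ z) : ToricSpace X lam Q) = Quot.mk _ ⟨z, hz⟩ := by
  have hz0 : ∀ z : openDelta X lam, (faceOf z).IsRegular →
      zeroOut (faceOf z).idx z.1 = z.1 := fun z hz => zeroOut_eq_self (zeros_eq_of_regular hz)
  refine exists_orbitSpace_homeomorph (U := {z | (faceOf z).IsRegular}) (r := id)
    regularSet_subset_openDelta continuous_id (isOpen_faceOf fun _ _ h1 h2 => h1.mono h2)
    ?_ ?_ ?_ ?_ ?_ ?_ ?_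
  · intro z w h hz
    change (faceOf w).IsRegular
    rw [← faceOf_eq_of_toricRel h]
    exact hz
  · exact fun z hz => mem_regularSet_iff.1 hz
  · exact fun z hz => mem_regularSet_iff.2 hz
  · exact fun z _ => rfl
  · intro z hz w h
    obtain ⟨h1, h2⟩ := toricRel_iff.1 h
    rwa [hz0 z hz, hz0 w (h1 ▸ hz)] at h2
  · intro z w hz hw h
    rw [mem_regularSet_iff] at hz hw
    refine toricRel_iff.2 ⟨?_, by rwa [hz0 z hz, hz0 w hw]⟩
    refine Face.ext ?_
    rw [← zeros_eq_of_regular hz, ← zeros_eq_of_regular hw, h.zeros_eq]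
  · intro z
    rw [piece_top, toricMk_mem_facePart]
    constructor
    · exact fun h => ⟨z, mem_regularSet_iff.2 h, toricRel_equivalence.refl _⟩
    · rintro ⟨w, hw, h⟩
      rw [faceOf_eq_of_toricRel h]
      exact mem_regularSet_iff.1 hw

/-! ### The decomposition -/

theorem coordTorus_eq_range (I : Finset (Fin d)) :
    coordTorus I = Set.range fun u : Fin d → ℂ => zeroOut I (partialExp Iᶜ u) := by
  ext z
  constructor
  · intro hz
    have h : (fun j => if j ∈ I then 1 else z j) ∈ Set.range (partialExp Iᶜ) := by
      rw [range_partialExp]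
      intro j hj
      rw [Finset.mem_compl] at hj
      simpa [hj] using fun h0 => hj ((hz j).1 h0)
    obtain ⟨u, hu⟩ := h
    refine ⟨u, funext fun j => ?_⟩
    by_cases hj : j ∈ I
    · simp [zeroOut_of_mem hj, (hz j).2 hj]
    · simp [zeroOut_of_notMem hj, hu, hj]
  · rintro ⟨u, rfl⟩
    refine mem_coordTorus_iff.2 (zeros_zeroOut fun j hj => ?_)
    by_contra hne
    rw [mem_zeros, partialExp_apply_of_mem _ (Finset.mem_compl.2 hne)] at hj
    exact cexp_ne_zero _ hj

theorem isConnected_coordTorus (I : Finset (Fin d)) : IsConnected (coordTorus I) := by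
  rw [coordTorus_eq_range]
  exact isConnected_range ((continuous_zeroOut I).comp (contDiff_partialExp (n := 0) _).continuous)

/-- Replace the zero coordinates outside J by a small t > 0; shrinking the zero set does not leave
`openDelta X lam`. -/
theorem mem_closure_coordTorus (z : openDelta X lam) {J : Finset (Fin d)} (hJ : J ⊆ zeros z.1) :
    z ∈ closure {w : openDelta X lam | w.1 ∈ coordTorus J} := by
  let p : ℝ → Fin d → ℂ := fun t j => if z.1 j = 0 ∧ j ∉ J then (t : ℂ) else z.1 j
  have hp : ∀ t ≠ 0, zeros (p t) = J := by
    intro t ht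
    ext j
    rw [mem_zeros]
    by_cases hj : j ∈ J
    · simp [p, hj, mem_zeros.1 (hJ hj)]
    · by_cases h0 : z.1 j = 0 <;> simp [p, hj, h0, ht]
  have hmem : ∀ t, p t ∈ openDelta X lam := by
    intro t
    obtain ⟨F, hF⟩ := mem_openDelta_iff.1 z.2
    refine mem_openDelta_iff.2 ⟨F, fun j hj => hF ?_⟩
    rw [mem_zeros] at *
    by_contra h0
    simp [p, h0] at hj
  have hc : Continuous fun t => (⟨p t, hmem t⟩ : openDelta X lam) := by
    refine Continuous.subtype_mk (continuous_pi fun j => ?_) _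
    by_cases h : z.1 j = 0 ∧ j ∉ J
    · simp only [p, h]
      exact Complex.continuous_ofReal
    · simp only [p, h, if_false]
      exact continuous_const
  have h0 : (⟨p 0, hmem 0⟩ : openDelta X lam) = z := by
    refine Subtype.ext (funext fun j => ?_)
    by_cases h : z.1 j = 0 ∧ j ∉ J
    · simp [p, h]
    · simp [p, h]
  have ht : Filter.Tendsto (fun t => (⟨p t, hmem t⟩ : openDelta X lam)) (𝓝[>] 0) (𝓝 z) := by
    have := hc.tendsto 0
    rw [h0] at this
    exact this.mono_left nhdsWithin_le_nhds
  refine mem_closure_of_tendsto ht ?_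
  filter_upwards [self_mem_nhdsWithin] with t ht
  exact mem_coordTorus_iff.2 (hp t (ne_of_gt ht))

theorem toricMk_image_coordTorus (F : SingularFace X lam) :
    toricMk X lam Q '' {w | w.1 ∈ coordTorus F.1.idx} = piece X lam Q (some F) := by
  rw [piece_some]
  ext t
  constructor
  · rintro ⟨w, hw, rfl⟩
    exact toricMk_mem_facePart.2 (faceOf_of_mem_coordTorus hw)
  · rintro ⟨z, hz, rfl⟩
    have hz' : faceOf z = F.1 := hz
    exact ⟨closedRep z, hz' ▸ closedRep_mem z, (toricMk_eq_iff.2 (toricRel_closedRep z)).symm⟩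

theorem isConnected_image_coordTorus (F : Face X lam) :
    IsConnected {w : openDelta X lam | w.1 ∈ coordTorus F.idx} := by
  have : {w : openDelta X lam | w.1 ∈ coordTorus F.idx} =
      (fun z : coordTorus F.idx => ⟨z.1, coordTorus_subset_openDelta F z.2⟩) '' Set.univ := by
    ext w
    exact ⟨fun hw => ⟨⟨w.1, hw⟩, trivial, rfl⟩, by rintro ⟨z, -, rfl⟩; exact z.2⟩
  rw [this]
  have := isConnected_iff_connectedSpace.1 (isConnected_coordTorus F.idx)
  exact isConnected_univ.image _ (continuous_subtype_val.subtype_mk _).continuousOn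

variable [FiniteDimensional ℝ 𝔡]

theorem exists_regular_face (hΔ : IsPolytopeWithNormals X lam) :
    ∃ F : Face X lam, F.idx = ∅ ∧ F.IsRegular := by
  obtain ⟨F, hF⟩ := exists_face_idx_empty hΔ
  refine ⟨F, hF, ?_⟩
  rw [face_isRegular_iff, hF, Finset.coe_empty]
  exact linearIndepOn_empty _ _

theorem image_coordTorus_subset_piece_top {F : Face X lam} (hF : F.IsRegular) :
    toricMk X lam Q '' {w | w.1 ∈ coordTorus F.idx} ⊆ piece X lam Q ⊤ := by
  rw [piece_top]
  rintro _ ⟨w, hw, rfl⟩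
  rw [toricMk_mem_facePart, faceOf_of_mem_coordTorus hw]
  exact hF

/-- The open torus of points without zero coordinates, which belongs to the interior of the
polytope, has a connected dense image. It gives both density and connectedness of the maximal piece.
-/
theorem isConnected_dense_image (hΔ : IsPolytopeWithNormals X lam) :
    ∃ D ⊆ piece X lam Q ⊤, IsConnected D ∧ Dense D := by
  obtain ⟨F, hF0, hF⟩ := exists_regular_face hΔ
  refine ⟨_, image_coordTorus_subset_piece_top hF,
    (isConnected_image_coordTorus F).image _ continuous_toricMk.continuousOn, fun t => ?_⟩
  obtain ⟨z, rfl⟩ := exists_toricMk_eq t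
  refine image_closure_subset_closure_image continuous_toricMk ⟨z, ?_, rfl⟩
  exact mem_closure_coordTorus z (by simp [hF0])

theorem dense_piece_top (hΔ : IsPolytopeWithNormals X lam) : Dense (piece X lam Q ⊤) := by
  obtain ⟨D, hD, -, hd⟩ := isConnected_dense_image (Q := Q) hΔ
  exact hd.mono hD

theorem isConnected_piece (hΔ : IsPolytopeWithNormals X lam) (i : StratumIndex X lam) :
    IsConnected (piece X lam Q i) := by
  rcases i with _ | F
  · obtain ⟨D, hD, hc, hd⟩ := isConnected_dense_image (Q := Q) hΔ
    exact hc.subset_closure hD fun t _ => hd t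
  · rw [← toricMk_image_coordTorus]
    exact (isConnected_image_coordTorus F.1).image _ continuous_toricMk.continuousOn

theorem isLocallyClosed_piece (i : StratumIndex X lam) : IsLocallyClosed (piece X lam Q i) := by
  rcases i with _ | F
  · exact isOpen_piece_top.isLocallyClosed
  -- The piece of F consists of the classes with index set contained in I_F but not strictly: a
  -- difference of two open sets.
  · refine ⟨facePart Q fun G => G.idx ⊆ F.1.idx, (facePart Q fun G => G.idx ⊂ F.1.idx)ᶜ,
      isOpen_facePart fun _ _ h1 h2 => h2.trans h1,
      (isOpen_facePart fun _ _ h1 h2 => h2.trans_ssubset h1).isClosed_compl, ?_⟩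
    rw [piece_some]
    ext t
    obtain ⟨z, rfl⟩ := exists_toricMk_eq t
    simp only [Set.mem_inter_iff, Set.mem_compl_iff, toricMk_mem_facePart]
    constructor
    · rintro h
      rw [h]
      exact ⟨subset_rfl, ssubset_irrefl _⟩
    · rintro ⟨h1, h2⟩
      exact Face.ext (h1.antisymm (by_contra fun h => h2 ⟨h1, h⟩))

theorem exists_mem_piece (t : ToricSpace X lam Q) : ∃ i, t ∈ piece X lam Q i := by
  obtain ⟨z, rfl⟩ := exists_toricMk_eq t
  by_cases h : (faceOf z).IsRegular
  · refine ⟨⊤, ?_⟩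
    rw [piece_top]
    exact toricMk_mem_facePart.2 h
  · refine ⟨some ⟨faceOf z, (face_isSingular_iff _).2 h⟩, ?_⟩
    rw [piece_some]
    exact toricMk_mem_facePart.2 rfl

theorem disjoint_piece_some_top (F : SingularFace X lam) :
    Disjoint (piece X lam Q (some F)) (piece X lam Q ⊤) := by
  rw [piece_some, piece_top, Set.disjoint_left]
  intro t
  obtain ⟨z, rfl⟩ := exists_toricMk_eq t
  rw [toricMk_mem_facePart, toricMk_mem_facePart]
  rintro h
  rw [h]
  exact (face_isSingular_iff _).1 F.2

theorem disjoint_piece {i j : StratumIndex X lam} (hij : i ≠ j) :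
    Disjoint (piece X lam Q i) (piece X lam Q j) := by
  rcases i with _ | F <;> rcases j with _ | G
  · exact absurd rfl hij
  · exact (disjoint_piece_some_top G).symm
  · exact disjoint_piece_some_top F
  · rw [piece_some, piece_some, Set.disjoint_left]
    intro t
    obtain ⟨z, rfl⟩ := exists_toricMk_eq t
    rw [toricMk_mem_facePart, toricMk_mem_facePart]
    exact fun h1 h2 => hij (congrArg some (Subtype.ext (h1.symm.trans h2)))

theorem piece_subset_closure (hΔ : IsPolytopeWithNormals X lam) {i j : StratumIndex X lam}
    (h : i ≤ j) : piece X lam Q i ⊆ closure (piece X lam Q j) := by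
  rcases j with _ | G
  · exact fun t _ => dense_piece_top hΔ t
  rcases i with _ | F
  · exact absurd h (WithTop.not_top_le_coe G)
  rw [← toricMk_image_coordTorus, ← toricMk_image_coordTorus]
  rintro _ ⟨z, hz, rfl⟩
  refine image_closure_subset_closure_image continuous_toricMk ⟨z, ?_, rfl⟩
  refine mem_closure_coordTorus z ?_
  rw [mem_coordTorus_iff.1 hz]
  have hFG : F ≤ G := WithTop.coe_le_coe.1 h
  exact face_le_iff.1 hFG

/-- The classes with index set contained in I_F form an open neighbourhood of the piece of F. If
that piece meets the closure of the piece of G, the neighbourhood meets the piece of G itself, so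
I_G ⊆ I_F. -/
theorem le_of_meets_closure {i j : StratumIndex X lam}
    (h : (piece X lam Q i ∩ closure (piece X lam Q j)).Nonempty) : i ≤ j := by
  rcases j with _ | G
  · exact le_top
  obtain ⟨t, hti, htj⟩ := h
  rcases i with _ | F
  · obtain ⟨s, hs1, hs2⟩ := mem_closure_iff.1 htj _ isOpen_piece_top hti
    exact absurd hs1 (Set.disjoint_left.1 (disjoint_piece_some_top G) hs2)
  · refine WithTop.coe_le_coe.2 (face_le_iff.2 ?_)
    have ht : t ∈ facePart Q fun E => E.idx ⊆ F.1.idx := by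
      change t ∈ piece X lam Q (some F) at hti
      rw [piece_some] at hti
      obtain ⟨z, rfl⟩ := exists_toricMk_eq t
      rw [toricMk_mem_facePart] at hti ⊢
      rw [hti]
    obtain ⟨s, hs1, hs2⟩ := mem_closure_iff.1 htj _
      (isOpen_facePart fun _ _ h1 h2 => h2.trans h1) ht
    change s ∈ piece X lam Q (some G) at hs2
    rw [piece_some] at hs2
    obtain ⟨z, rfl⟩ := exists_toricMk_eq s
    rw [toricMk_mem_facePart] at hs1 hs2
    rwa [← hs2]

theorem isDecomposition (hΔ : IsPolytopeWithNormals X lam)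
    (hqf : ∀ i, Nonempty (ComplexQuasifold (pieceDim X lam i) (piece X lam Q i))) :
    IsDecompositionByComplexQuasifolds (piece X lam Q) (pieceDim X lam)
      (Module.finrank ℝ 𝔡) where
  finite := inferInstanceAs (Finite (Option _))
  disjoint _ _ := disjoint_piece
  locallyClosed := isLocallyClosed_piece
  connected := isConnected_piece hΔ
  quasifold := hqf
  covers := Set.eq_univ_of_forall fun t => Set.mem_iUnion.2 (exists_mem_piece t)
  meets_closure_iff_subset i j := by
    refine ⟨fun h => piece_subset_closure hΔ (le_of_meets_closure h), fun h => ?_⟩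
    obtain ⟨t, ht⟩ := (isConnected_piece (Q := Q) hΔ i).nonempty
    exact ⟨t, ht, h ht⟩
  subset_closure_iff_le i j := by
    refine ⟨fun h => ?_, piece_subset_closure hΔ⟩
    obtain ⟨t, ht⟩ := (isConnected_piece (Q := Q) hΔ i).nonempty
    exact le_of_meets_closure ⟨t, ht, h ht⟩
  maximal := ⟨⊤, isTop_top, isOpen_piece_top, dense_piece_top hΔ, rfl⟩

end Pieces

/-! ## Slices from bases -/

section Bases

variable {E : Type*} [AddCommGroup E] [Module ℝ E] {d : ℕ}

/-- A linearly independent part of a finite spanning family can be extended to a basis that is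
part of the family. -/
theorem exists_basis_of_span_eq_top {k : ℕ} (Y : Fin d → E) (I : Finset (Fin d))
    (hI : LinearIndepOn ℝ Y (I : Set (Fin d))) (hspan : Submodule.span ℝ (Set.range Y) = ⊤)
    (hk : Module.finrank ℝ E = k) :
    ∃ (e : Fin k → Fin d) (b : Module.Basis (Fin k) ℝ E), (∀ i, b i = Y (e i)) ∧
      ∀ j ∈ I, ∃ i, e i = j := by
  obtain ⟨s, -, hIs, hs, hli⟩ := exists_linearIndepOn_extension hI (Set.subset_univ _)
  have htop : ⊤ ≤ Submodule.span ℝ (Set.range fun j : s => Y j) := by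
    rw [← Set.image_eq_range, ← hspan, Submodule.span_le, ← Set.image_univ]
    exact hs
  let b₀ : Module.Basis s ℝ E := Module.Basis.mk hli htop
  have hcard : Nat.card s = k := by rw [← hk, Module.finrank_eq_nat_card_basis b₀]
  let f : s ≃ Fin k := (Finite.equivFinOfCardEq hcard)
  refine ⟨fun i => f.symm i, b₀.reindex f, fun i => ?_, fun j hj => ?_⟩
  · rw [Module.Basis.reindex_apply]
    exact Module.Basis.mk_apply _ _ _
  · exact ⟨f ⟨j, hIs hj⟩, by simp⟩

/-- The complexified kernel of `ℝ^d → E`. -/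
def complexKer (Y : Fin d → E) : Submodule ℂ (Fin d → ℂ) where
  carrier := {Z | projR Y (fun j => (Z j).re) = 0 ∧ projR Y (fun j => (Z j).im) = 0}
  zero_mem' := by
    have h : (fun _ : Fin d => (0 : ℝ)) = 0 := rfl
    simp [h]
  add_mem' := by
    rintro Z W ⟨h1, h2⟩ ⟨h3, h4⟩
    have e1 : (fun j => ((Z + W) j).re) = (fun j => (Z j).re) + fun j => (W j).re := rfl
    have e2 : (fun j => ((Z + W) j).im) = (fun j => (Z j).im) + fun j => (W j).im := rfl
    exact ⟨by rw [e1, map_add, h1, h3, add_zero], by rw [e2, map_add, h2, h4, add_zero]⟩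
  smul_mem' := by
    rintro c Z ⟨h1, h2⟩
    have e1 : (fun j => ((c • Z) j).re) =
        c.re • (fun j => (Z j).re) - c.im • fun j => (Z j).im := by
      funext j
      simp
    have e2 : (fun j => ((c • Z) j).im) =
        c.re • (fun j => (Z j).im) + c.im • fun j => (Z j).re := by
      funext j
      simp
    constructor
    · rw [e1, map_sub, map_smul, map_smul, h1, h2, smul_zero, smul_zero, sub_zero]
    · rw [e2, map_add, map_smul, map_smul, h1, h2, smul_zero, smul_zero, add_zero]

/-- The complex linear extension of the coordinates of `ℝ^d → E` in a basis. -/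
noncomputable def complexCoords {k : ℕ} (Y : Fin d → E) (b : Module.Basis (Fin k) ℝ E) :
    (Fin d → ℂ) →ₗ[ℂ] Fin k → ℂ :=
  Fintype.linearCombination ℂ fun j i => (b.repr (Y j) i : ℂ)

theorem complexCoords_apply {k : ℕ} (Y : Fin d → E) (b : Module.Basis (Fin k) ℝ E)
    (Z : Fin d → ℂ) (i : Fin k) : complexCoords Y b Z i =
      (b.repr (projR Y fun j => (Z j).re) i : ℂ) +
        (b.repr (projR Y fun j => (Z j).im) i : ℂ) * Complex.I := by
  simp only [complexCoords, projR, Fintype.linearCombination_apply, Finset.sum_apply,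
    Pi.smul_apply, smul_eq_mul, map_sum, map_smul, Finsupp.coe_finsetSum, Finsupp.coe_smul]
  push_cast
  rw [Finset.sum_mul, ← Finset.sum_add_distrib]
  refine Finset.sum_congr rfl fun j _ => ?_
  conv_lhs => rw [← Complex.re_add_im (Z j)]
  ring

/-- The slice given by a basis that is part of the family `Y`. -/
noncomputable def sliceOfBasis {k : ℕ} (Y : Fin d → E) (Q : AddSubgroup E)
    (hQ : (Q : Set E).Countable) (hY : ∀ j, Y j ∈ Q) (A : Finset (Fin d))
    (hA : ∀ j ∈ A, Y j = 0) (K : Finset (Fin k)) (e : Fin k → Fin d)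
    (b : Module.Basis (Fin k) ℝ E) (hb : ∀ i, b i = Y (e i)) :
    Slice k A (complexKer Y) (preimageGroup Y Q ⊥) where
  e := e
  B := complexCoords Y b
  K := K
  B_single i := by
    rw [complexCoords, Fintype.linearCombination_apply_single, one_smul]
    funext l
    rw [← hb, b.repr_self]
    by_cases h : l = i <;> simp [h]
  B_of_mem j hj := by
    rw [complexCoords, Fintype.linearCombination_apply_single, one_smul]
    funext l
    simp [hA j hj]
  B_eq_zero_iff Z := by
    constructor
    · intro h
      have h1 : ∀ i, b.repr (projR Y fun j => (Z j).re) i = 0 ∧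
          b.repr (projR Y fun j => (Z j).im) i = 0 := by
        intro i
        have := congrFun h i
        rw [complexCoords_apply, Pi.zero_apply] at this
        exact ⟨by simpa using congrArg Complex.re this, by simpa using congrArg Complex.im this⟩
      exact ⟨b.repr.map_eq_zero_iff.1 (Finsupp.ext fun i => (h1 i).1),
        b.repr.map_eq_zero_iff.1 (Finsupp.ext fun i => (h1 i).2)⟩
    · rintro ⟨h1, h2⟩
      funext i
      rw [complexCoords_apply, h1, h2]
      simp
  ker_le Z hZ := ⟨by rw [hZ.1]; exact Q.zero_mem, hZ.2⟩
  single_mem j := by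
    have h1 : (fun l => ((Pi.single j 1 : Fin d → ℂ) l).re) = Pi.single j 1 := by
      funext l
      by_cases h : l = j <;> simp [h]
    have h2 : (fun l => ((Pi.single j 1 : Fin d → ℂ) l).im) = 0 := by
      funext l
      by_cases h : l = j <;> simp [h]
    refine ⟨?_, ?_⟩
    · rw [h1, projR, Fintype.linearCombination_apply_single, one_smul]
      exact hY j
    · rw [h2, map_zero]
      exact AddSubgroup.zero_mem _
  countable := by
    -- On this group the imaginary parts map to 0, so the coordinates of Z depend only on the
    -- element of Q that is the image of its real part.
    refine (hQ.image fun q i => (b.repr q i : ℂ)).mono ?_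
    rintro _ ⟨Z, ⟨h1, h2⟩, rfl⟩
    refine ⟨_, h1, ?_⟩
    funext i
    rw [complexCoords_apply, show projR Y (fun j => (Z j).im) = 0 from h2]
    simp

end Bases

/-! ### Quasifold structures on the pieces, and the theorem. -/

section Main

variable {𝔡 : Type*} [AddCommGroup 𝔡] [Module ℝ 𝔡] {d : ℕ} {X : Fin d → 𝔡} {lam : Fin d → ℝ}
  {Q : Submodule ℤ 𝔡}

theorem IsQuasilattice.countable (hQ : IsQuasilattice Q) : (Q : Set 𝔡).Countable := by
  have : Module.Finite ℤ Q := Module.Finite.iff_fg.2 hQ.1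
  have : Countable Q := Finsupp.Countable.of_moduleFinite (R := ℤ)
  exact this.to_set

theorem isTorusQuotient_of_homeomorph {A : Finset (Fin d)} {H : AddSubgroup (Fin d → ℂ)}
    {S : Set (Fin d → ℂ)} {T : Set (ToricSpace X lam Q)}
    (h : OrbitSpace (groupNC X Q) S ≃ₜ T) (hS : ∀ g, ∀ z ∈ S, torusAct g z ∈ S)
    (hA : ∀ z ∈ S, ∀ j ∈ A, z j = 0)
    (hH : ∀ z ∈ S, ∀ w ∈ S, TorusRel (preimageGroup X Q.toAddSubgroup ⊥) z w ↔ TorusRel H z w) :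
    IsTorusQuotient A H fun z : S => h (Quotient.mk _ z) where
  continuous := h.continuous.comp continuous_quotient_mk'
  isOpenMap := h.isOpenMap.comp (isOpenMap_orbitMk hS)
  eq_iff z w := by
    rw [h.injective.eq_iff, Quotient.eq]
    exact exists_groupNC_iff.trans (hH z z.2 w w.2)
  zero := hA

theorem torusAct_mem_coordTorus {I : Finset (Fin d)} (g : Fin d → ℂˣ) {z : Fin d → ℂ}
    (hz : z ∈ coordTorus I) : torusAct g z ∈ coordTorus I := fun j => by
  simpa [torusAct] using hz j

theorem torusAct_mem_regularSet (g : Fin d → ℂˣ) {z : Fin d → ℂ}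
    (hz : z ∈ regularSet X lam) : torusAct g z ∈ regularSet X lam := by
  obtain ⟨F, hF⟩ := Set.mem_iUnion.1 hz
  exact Set.mem_iUnion.2 ⟨F, fun j hj => hF j (by simpa [torusAct] using hj)⟩

/-- On the points whose coordinates in `I` vanish, the orbits of `N_ℂ` are the orbits of the group
that is defined by the quotient by the span of the normals with index in `I`. -/
theorem torusRel_mkQ_iff {I : Finset (Fin d)} {z w : Fin d → ℂ} (hz : ∀ j ∈ I, z j = 0)
    (hw : ∀ j ∈ I, w j = 0) :
    TorusRel (preimageGroup X Q.toAddSubgroup ⊥) z w ↔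
      TorusRel (preimageGroup (fun j => (Submodule.span ℝ (X '' (I : Set (Fin d)))).mkQ (X j))
        (Q.toAddSubgroup.map
          (Submodule.span ℝ (X '' (I : Set (Fin d)))).mkQ.toAddMonoidHom) ⊥) z w := by
  set V := Submodule.span ℝ (X '' (I : Set (Fin d)))
  have hproj : ∀ x : Fin d → ℝ, projR (fun j => V.mkQ (X j)) x = V.mkQ (projR X x) := fun x => by
    simp [projR, Fintype.linearCombination_apply]
  have hV : ∀ v ∈ V, ∃ y : Fin d → ℝ, (∀ j ∉ I, y j = 0) ∧ projR X y = v := by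
    intro v hv
    obtain ⟨l, hl, rfl⟩ := (Finsupp.mem_span_image_iff_linearCombination ℝ).1 hv
    refine ⟨l, fun j hj => (Finsupp.mem_supported' ℝ l).1 hl j hj, ?_⟩
    rw [projR, Fintype.linearCombination_apply, Finsupp.linearCombination_apply,
      Finsupp.sum_fintype _ _ fun j => zero_smul ℝ (X j)]
  constructor
  · rintro ⟨Z, ⟨h1, h2⟩, h⟩
    refine ⟨Z, ⟨⟨_, h1, (hproj _).symm⟩, ?_⟩, h⟩
    rw [hproj, show projR X (fun j => (Z j).im) = 0 from h2, map_zero]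
    exact AddSubgroup.zero_mem _
  · rintro ⟨Z, ⟨⟨q, hq, h1⟩, h2⟩, h⟩
    have h1' : projR X (fun j => (Z j).re) - q ∈ V := by
      rw [← Submodule.ker_mkQ V, LinearMap.mem_ker, map_sub, ← hproj, ← h1]
      exact sub_self _
    have h2' : projR X (fun j => (Z j).im) ∈ V := by
      rw [← Submodule.ker_mkQ V, LinearMap.mem_ker, ← hproj]
      exact h2
    obtain ⟨y, hy, hyv⟩ := hV _ h1'
    obtain ⟨y', hy', hyv'⟩ := hV _ h2'
    -- The errors in V are linear combinations of the normals in I. Subtracting their coefficients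
    -- changes Z only at indices in I, where both points vanish.
    refine ⟨fun j => Z j - (y j + y' j * Complex.I), ⟨?_, ?_⟩, fun j => ?_⟩
    · have : (fun j => (Z j - (y j + y' j * Complex.I)).re) = (fun j => (Z j).re) - y := by
        funext j
        simp
      rw [this, map_sub, hyv, sub_sub_cancel]
      exact hq
    · have : (fun j => (Z j - (y j + y' j * Complex.I)).im) = (fun j => (Z j).im) - y' := by
        funext j
        simp
      rw [this, map_sub, hyv', sub_self]
      exact AddSubgroup.zero_mem _
    · by_cases hj : j ∈ I
      · rw [hz j hj, hw j hj, mul_zero]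
      · simp [h j, hy j hj, hy' j hj]

variable [FiniteDimensional ℝ 𝔡]

theorem finrank_quotient_eq_dim (F : Face X lam) : Module.finrank ℝ
    (𝔡 ⧸ Submodule.span ℝ (X '' (F.idx : Set (Fin d)))) = F.dim := by
  have h1 := face_dim_add F
  have h2 := Submodule.finrank_quotient_add_finrank
    (Submodule.span ℝ (X '' (F.idx : Set (Fin d))))
  omega

/-- Modulo the span V of the normals of F, the space has dimension `F.1.dim` and the coordinates in
I become irrelevant. No other coordinate vanishes on the torus, so a single slice with `K` empty
covers the piece. The image of Q is used only as a countable group. -/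
theorem exists_quasifold_piece_some (hΔ : IsPolytopeWithNormals X lam) (hQ : IsQuasilattice Q)
    (hX : ∀ j, X j ∈ Q) (F : SingularFace X lam) :
    ∃ A : ComplexQuasifold F.1.dim (piece X lam Q F),
      IsOrbitQuasifold (coordTorus F.1.idx) (piece X lam Q F) A := by
  set I := F.1.idx
  set V := Submodule.span ℝ (X '' (I : Set (Fin d)))
  obtain ⟨h, hh⟩ := exists_homeomorph_piece_some (Q := Q) F
  let Y : Fin d → 𝔡 ⧸ V := fun j => V.mkQ (X j)
  let Q' : AddSubgroup (𝔡 ⧸ V) := Q.toAddSubgroup.map V.mkQ.toAddMonoidHom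
  have hspan : Submodule.span ℝ (Set.range Y) = ⊤ := by
    have : Set.range Y = V.mkQ '' Set.range X := by rw [← Set.range_comp]; rfl
    rw [this, ← Submodule.map_span, span_normals hΔ, Submodule.map_top, Submodule.range_mkQ]
  obtain ⟨e, b, hb, -⟩ := exists_basis_of_span_eq_top Y ∅
    (by rw [Finset.coe_empty]; exact linearIndepOn_empty _ _) hspan (finrank_quotient_eq_dim F.1)
  have hQ' : (Q' : Set (𝔡 ⧸ V)).Countable := hQ.countable.image _
  let σ := sliceOfBasis Y Q' hQ' (fun j => ⟨_, hX j, rfl⟩) I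
    (fun j hj => (Submodule.Quotient.mk_eq_zero _).2 (Submodule.subset_span ⟨j, hj, rfl⟩)) ∅ e b hb
  have hregion : σ.region = coordTorus I := by
    ext z
    constructor
    · rintro ⟨h1, h2⟩ j
      refine ⟨fun h0 => ?_, h1 j⟩
      by_contra hj
      obtain ⟨i, hi, -⟩ := h2 j hj h0
      exact absurd hi (Finset.notMem_empty i)
    · exact fun hz => ⟨fun j hj => (hz j).2 hj, fun j hj h0 => absurd ((hz j).1 h0) hj⟩
  have hq : IsTorusQuotient I (preimageGroup Y Q' ⊥)
      fun z : coordTorus I => h (Quotient.mk _ z) :=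
    isTorusQuotient_of_homeomorph h (fun g z hz => torusAct_mem_coordTorus g hz)
      (fun z hz j hj => (hz j).2 hj)
      fun z hz w hw => torusRel_mkQ_iff (fun j hj => (hz j).2 hj) fun j hj => (hw j).2 hj
  obtain ⟨C, hC⟩ := exists_complexQuasifold_of_slices hq
    (h.surjective.comp Quotient.mk_surjective) (fun _ : Unit => σ)
    (fun _ => hregion.subset) fun z hz => ⟨(), hregion.superset hz⟩
  exact ⟨C, coordTorus_subset_openDelta F.1, h, hh, hC⟩

/-- The independent normals of a regular face F extend to a basis taken from the normals. With `K`
the basis indices that belong to F, the region of the slice is `coordOpen F.1.idx`, so there is one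
chart for each regular face. -/
theorem exists_quasifold_piece_top (hΔ : IsPolytopeWithNormals X lam) (hQ : IsQuasilattice Q)
    (hX : ∀ j, X j ∈ Q) :
    ∃ A : ComplexQuasifold (Module.finrank ℝ 𝔡) (piece X lam Q ⊤),
      IsOrbitQuasifold (regularSet X lam) (piece X lam Q ⊤) A := by
  classical
  obtain ⟨h, hh⟩ := exists_homeomorph_piece_top (X := X) (lam := lam) (Q := Q)
  have hb := fun F : {F : Face X lam // F.IsRegular} => exists_basis_of_span_eq_top X F.1.idx
    ((face_isRegular_iff _).1 F.2) (span_normals hΔ) rfl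
  choose e b hb he using hb
  let σ := fun F : {F : Face X lam // F.IsRegular} => sliceOfBasis X Q.toAddSubgroup hQ.countable
    hX ∅ (by simp) (Finset.univ.filter fun i => e F i ∈ F.1.idx) (e F) (b F) (hb F)
  have hregion : ∀ F, (σ F).region = coordOpen F.1.idx := by
    intro F
    ext z
    constructor
    · rintro ⟨-, h2⟩ j h0
      obtain ⟨i, hi, hij⟩ := h2 j (Finset.notMem_empty j) h0
      rw [← hij]
      exact (Finset.mem_filter.1 hi).2
    · refine fun hz => ⟨by simp, fun j _ h0 => ?_⟩
      obtain ⟨i, hi⟩ := he F j (hz j h0)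
      exact ⟨i, Finset.mem_filter.2 ⟨Finset.mem_univ _, hi ▸ hz j h0⟩, hi⟩
  have hq : IsTorusQuotient ∅ (preimageGroup X Q.toAddSubgroup ⊥)
      fun z : regularSet X lam => h (Quotient.mk _ z) :=
    isTorusQuotient_of_homeomorph h (fun g z hz => torusAct_mem_regularSet g hz) (by simp)
      fun z _ w _ => Iff.rfl
  obtain ⟨C, hC⟩ := exists_complexQuasifold_of_slices hq
    (h.surjective.comp Quotient.mk_surjective) σ
    (fun F => by rw [hregion]; exact Set.subset_iUnion (fun F : {F : Face X lam // F.IsRegular} =>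
      coordOpen F.1.idx) F) fun z hz => by
      obtain ⟨F, hF⟩ := Set.mem_iUnion.1 hz
      exact ⟨F, (hregion F).superset hF⟩
  exact ⟨C, regularSet_subset_openDelta, h, hh, hC⟩

end Main

theorem mainTheorem4 {𝔡 : Type*} [AddCommGroup 𝔡] [Module ℝ 𝔡] [FiniteDimensional ℝ 𝔡] {d : ℕ}
    (X : Fin d → 𝔡) (lam : Fin d → ℝ) (hΔ : IsPolytopeWithNormals X lam)
    (Q : Submodule ℤ 𝔡) (hQ : IsQuasilattice Q) (hX : ∀ j, X j ∈ Q) :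
    Equivalence (toricRel X lam Q) ∧
    (∀ F : SingularFace X lam, ∃ A : ComplexQuasifold F.1.dim (piece X lam Q F),
      IsOrbitQuasifold (coordTorus F.1.idx) (piece X lam Q F) A) ∧
    (∃ A : ComplexQuasifold (Module.finrank ℝ 𝔡) (piece X lam Q ⊤),
      IsOrbitQuasifold (regularSet X lam) (piece X lam Q ⊤) A) ∧
    IsDecompositionByComplexQuasifolds (piece X lam Q) (pieceDim X lam)
      (Module.finrank ℝ 𝔡) := by
  have h1 := exists_quasifold_piece_some hΔ hQ hX
  have h2 := exists_quasifold_piece_top hΔ hQ hX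
  refine ⟨toricRel_equivalence, h1, h2, isDecomposition hΔ ?_⟩
  rintro (_ | F)
  · exact ⟨h2.choose⟩
  · exact ⟨(h1 F).choose⟩
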